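/- Let $F$ be an algebraically closed field of characteristic $p>0$, let $G$ be a finite group with $p\nmid |G|$, let $V_1,\dots,V_r$ be a complete set of pairwise non-isomorphic finite dimensional simple $FG$-modules, $d_k=\dim_F V_k$, and $c_k=|G|/d_k\in\mathbb I\setminus\{0\}$, where $\mathbb I=\{0,1,\dots,p-1\}=\mathbb F_p\subseteq F$. Let $n\ge 0$. The wreath Hecke algebra $\mathcal H_n(G)$ is the $F$-algebra generated by the group $G^n$, by $s_1,\dots,s_{n-1}$ and by $x_1,\dots,x_n$, subject to the Coxeter relations of $S_n$ for the $s_i$ and to $$x_ix_j=x_jx_i,\quad x_ig=gx_i,\quad s_ig={}^{s_i}g\,s_i,\quad s_ix_i=x_{i+1}s_i-t_{i,i+1},\quad s_ix_j=x_js_i\ (j\ne i,i+1),$$ where $g\in G^n$, ${}^{s_i}g$ is $g$ with its $i$-th and $(i+1)$-st components exchanged, and $t_{ij}=\sum_{h\in G}h^{(i)}(h^{-1})^{(j)}$, with $h^{(i)}\in G^n$ the element $h$ in the $i$-th factor. For $\lambda=(\lambda_i)_{i\in\mathbb I}$ with $\lambda_i\in\mathbb Z_{\ge0}$ let $\mathcal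 H_n^\lambda(G)$ be the quotient of $\mathcal H_n(G)$ by the two-sided ideal generated by $\prod_{i\in\mathbb I}(x_1-i)^{\lambda_i}$ (no relation is imposed if $n=0$). For $G=\{1\}$ write $\mathcal H_n$ and $\mathcal H_n^\lambda$ (the degenerate affine and degenerate cyclotomic Hecke algebras), with polynomial generators $y_i$ instead of $x_i$. For $1\le k\le r$ let $\lambda[k]$ be the weight with $\lambda[k]_i=\lambda_{ic_k}$ for $i\in\mathbb I$. With $\widehat n=(n_1,\dots,n_r)$ running over all $r$-tuples of non-negative integers of sum $n$, put $$A_{n,r}=\bigoplus_{\widehat n}\mathcal H_{n_1}\otimes\cdots\otimes\mathcal H_{n_r},\qquad A_{n,r}^\lambda=\bigoplus_{\widehat n}\mathcal H_{n_1}^{\lambda[1]}\otimes\cdots\otimes\mathcal H_{n_r}^{\lambda[r]}.$$ For an algebra $R$ let $R\text{-}\mathbf{mod}$ be the category of finite dimensional left $R$-modules. Put $V(\widehat n)=V_1^{\otimes n_1}\otimes\cdots\otimes V_r^{\otimes n_r}$, an $FG^n$-module, and for $M\in\mathcal H_n(G)\text{-}\mathbf{mod}$ let $I_{\widehat n}M$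 be the sum of all $FG^n$-submodules of $M$ isomorphic to $V(\widehat n)$. Let $\mathcal F:\mathcal H_n(G)\text{-}\mathbf{mod}\to A_{n,r}\text{-}\mathbf{mod}$ be the functor $$\mathcal F(M)=\bigoplus_{\widehat n}\mathrm{Hom}_{FG^n}(V(\widehat n),I_{\widehat n}M),$$ where the summand $\mathcal H_{n_1}\otimes\cdots\otimes\mathcal H_{n_r}$ acts on $\mathrm{Hom}_{FG^n}(V(\widehat n),I_{\widehat n}M)$ by $$(\pi\diamond\phi)(v_1\otimes\cdots\otimes v_n)=\pi\,\phi(v_{\pi(1)}\otimes\cdots\otimes v_{\pi(n)}),\qquad (y_j\diamond\phi)(v)=c_k^{-1}\,x_j\,\phi(v)$$ for $\pi\in S_{n_1}\times\cdots\times S_{n_r}\subseteq S_n$ and for $n_1+\dots+n_{k-1}<j\le n_1+\dots+n_k$ (the $y_j$ of the tensor factors being numbered consecutively), and where $\mathcal F$ acts on morphisms by composition. **Theorem.** The functor $\mathcal F$ is well defined and is an equivalence of categories $\mathcal H_n(G)\text{-}\mathbf{mod}\to A_{n,r}\text{-}\mathbf{mod}$, and for every $\lambda$ it induces an equivalence of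 categories $$\mathcal F^\lambda:\mathcal H_n^\lambda(G)\text{-}\mathbf{mod}\longrightarrow A_{n,r}^\lambda\text{-}\mathbf{mod};$$ that is, there is such an equivalence $\mathcal F^\lambda$ which followed by inflation along $A_{n,r}\to A_{n,r}^\lambda$ is isomorphic to inflation along $\mathcal H_n(G)\to\mathcal H_n^\lambda(G)$ followed by $\mathcal F$. -/

import Mathlib

open CategoryTheory Polynomial
open scoped TensorProduct ModuleCat

universe u

noncomputable section

namespace WreathHecke

/-! ### Wreath Hecke algebras -/

/-- The position `i` (counted from `0`) of the simple transposition `s_i = (i, i+1)`. -/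
def lo {n : ℕ} (i : Fin (n - 1)) : Fin n := ⟨i.1, by omega⟩

/-- The position `i + 1` of the simple transposition `s_i = (i, i+1)`. -/
def hi {n : ℕ} (i : Fin (n - 1)) : Fin n := ⟨i.1 + 1, by omega⟩

/-- The generators of the wreath Hecke algebra: the elements of `G^n`, the simple transpositions
`s_1, …, s_{n-1}` and the polynomial generators `x_1, …, x_n` (all counted from `0`). -/
inductive Gen (G : Type u) (n : ℕ) : Type u
  | g (a : Fin n → G) : Gen G n
  | s (i : Fin (n - 1)) : Gen G n
  | x (i : Fin n) : Gen G n

section Affine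

variable (F : Type u) [Field F] (G : Type u) [Group G] [Fintype G] (n : ℕ)

/-- The generator `a ∈ G^n` in the free algebra. -/
def fg {G : Type u} {n : ℕ} (a : Fin n → G) : FreeAlgebra F (Gen G n) := FreeAlgebra.ι F (Gen.g a)

/-- The generator `s_i` in the free algebra. -/
def fs {n : ℕ} (i : Fin (n - 1)) : FreeAlgebra F (Gen G n) := FreeAlgebra.ι F (Gen.s i)

/-- The generator `x_i` in the free algebra. -/
def fx {n : ℕ} (i : Fin n) : FreeAlgebra F (Gen G n) := FreeAlgebra.ι F (Gen.x i)

/-- `t_{ij} = ∑_{h ∈ G} h^{(i)} (h⁻¹)^{(j)}`. -/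
def ft {n : ℕ} (i j : Fin n) : FreeAlgebra F (Gen G n) :=
  ∑ h : G, fg F (Pi.mulSingle i h * Pi.mulSingle j h⁻¹)

/-- The defining relations of the wreath Hecke algebra. The first two say that the generators
from `G^n` multiply as in the group `G^n`. -/
inductive Rel : FreeAlgebra F (Gen G n) → FreeAlgebra F (Gen G n) → Prop
  | g_one : Rel (fg F 1) 1
  | g_mul (a b : Fin n → G) : Rel (fg F (a * b)) (fg F a * fg F b)
  | x_comm (i j : Fin n) : Rel (fx F G i * fx F G j) (fx F G j * fx F G i)
  | x_g (i : Fin n) (a : Fin n → G) : Rel (fx F G i * fg F a) (fg F a * fx F G i)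
  | s_sq (i : Fin (n - 1)) : Rel (fs F G i * fs F G i) 1
  | s_comm (i j : Fin (n - 1)) (h : i.1 + 1 < j.1 ∨ j.1 + 1 < i.1) :
      Rel (fs F G i * fs F G j) (fs F G j * fs F G i)
  | braid (i j : Fin (n - 1)) (h : i.1 + 1 = j.1) :
      Rel (fs F G i * fs F G j * fs F G i) (fs F G j * fs F G i * fs F G j)
  | s_x (i : Fin (n - 1)) :
      Rel (fs F G i * fx F G (lo i)) (fx F G (hi i) * fs F G i - ft F G (lo i) (hi i))
  | s_x_far (i : Fin (n - 1)) (j : Fin n) (h₁ : j ≠ lo i) (h₂ : j ≠ hi i) :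
      Rel (fs F G i * fx F G j) (fx F G j * fs F G i)
  | s_g (i : Fin (n - 1)) (a : Fin n → G) :
      Rel (fs F G i * fg F a) (fg F (fun m => a (Equiv.swap (lo i) (hi i) m)) * fs F G i)

/-- The wreath Hecke algebra `H_n(G)` over `F`. -/
def Affine : Type u := RingQuot (Rel F G n)

instance : Ring (Affine F G n) := inferInstanceAs (Ring (RingQuot (Rel F G n)))

instance : Algebra F (Affine F G n) := inferInstanceAs (Algebra F (RingQuot (Rel F G n)))

/-- The canonical map from the free algebra on the generators. -/
def toAffine : FreeAlgebra F (Gen G n) →ₐ[F] Affine F G n := RingQuot.mkAlgHom F (Rel F G n)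

variable {G n}

/-- The image of `a ∈ G^n` in `H_n(G)`. -/
def ofG (a : Fin n → G) : Affine F G n := toAffine F G n (fg F a)

variable (G)

/-- The generator `s_i` of `H_n(G)`. -/
def s (i : Fin (n - 1)) : Affine F G n := toAffine F G n (fs F G i)

/-- The generator `x_i` of `H_n(G)`. -/
def x (i : Fin n) : Affine F G n := toAffine F G n (fx F G i)

end Affine

/-- The degenerate affine Hecke algebra `H_n`, i.e. the wreath Hecke algebra of the trivial
group; there `t_{i,i+1} = 1`, so that `s_i y_i = y_{i+1} s_i - 1`. -/
abbrev DegAffine (F : Type u) [Field F] (n : ℕ) : Type u := Affine F PUnit.{u + 1} n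

/-! ### Cyclotomic quotients -/

section Cyclotomic

variable (F : Type u) [Field F] (p : ℕ) [Fact p.Prime] [CharP F p]

/-- The polynomial `g_λ(X) = ∏_{i ∈ 𝕀} (X - i)^{λ_i}`, where `𝕀 = {0, …, p-1} = 𝔽_p ⊆ F`. -/
def cycPoly (lam : ZMod p → ℕ) : F[X] :=
  ∏ i : ZMod p, (X - C (ZMod.castHom (dvd_refl p) F i)) ^ lam i

variable (G : Type u) [Group G] [Fintype G] (n : ℕ) (lam : ZMod p → ℕ)

/-- The relation `g_λ(x_1) = 0`. There is no relation if `n = 0`. -/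
inductive CycRel : Affine F G n → Affine F G n → Prop
  | g_lam (i : Fin n) (h : i.1 = 0) : CycRel (aeval (x F G i) (cycPoly F p lam)) 0

/-- The cyclotomic wreath Hecke algebra `H_n^λ(G)`: the quotient of `H_n(G)` by the two-sided
ideal generated by `g_λ(x_1)`. -/
def Cyc : Type u := RingQuot (CycRel F p G n lam)

instance : Ring (Cyc F p G n lam) := inferInstanceAs (Ring (RingQuot (CycRel F p G n lam)))

instance : Algebra F (Cyc F p G n lam) :=
  inferInstanceAs (Algebra F (RingQuot (CycRel F p G n lam)))

/-- The canonical surjection `H_n(G) → H_n^λ(G)`. -/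
def toCyc : Affine F G n →ₐ[F] Cyc F p G n lam := RingQuot.mkAlgHom F (CycRel F p G n lam)

/-- The degenerate cyclotomic Hecke algebra
`H_n^μ = H_n / ⟨∏_{i ∈ 𝕀} (y_1 - i)^{μ_i}⟩`, where `μ_i = ⟨h_i, μ⟩`. -/
abbrev DegCyc : Type u := Cyc F p PUnit.{u + 1} n lam

end Cyclotomic

/-! ### Compositions and the algebras `A_{n,r}` and `A_{n,r}^λ` -/

/-- The set of compositions `n̂ = (n_1, …, n_r)` of `n` into `r` parts (zero parts allowed). -/
abbrev Comp (r n : ℕ) : Type := {m : Fin r → ℕ // ∑ k, m k = n}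

section Blocks

variable {r n : ℕ} (nh : Comp r n)

/-- The bijection which lays the blocks of sizes `n_1, …, n_r` one after the other; it sends the
`j`-th place of the `k`-th block to the place `n_1 + ⋯ + n_{k-1} + j`. -/
def place : (Σ k, Fin (nh.1 k)) ≃ Fin n := finSigmaFinEquiv.trans (finCongr nh.2)

theorem place_hi (k : Fin r) (j : Fin (nh.1 k - 1)) :
    (place nh ⟨k, hi j⟩).1 = (place nh ⟨k, lo j⟩).1 + 1 := by
  simp [place, lo, hi, finSigmaFinEquiv_apply, add_assoc]

/-- The index in `S_n` of the `j`-th simple transposition of the `k`-th factor of the Young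
subgroup `S_{n_1} × ⋯ × S_{n_r}`. -/
def simplePlace (k : Fin r) (j : Fin (nh.1 k - 1)) : Fin (n - 1) :=
  ⟨(place nh ⟨k, lo j⟩).1, by
    have h := place_hi nh k j
    have h' := (place nh ⟨k, hi j⟩).2
    omega⟩

end Blocks

section Target

variable (F : Type u) [Field F] (r n : ℕ)

/-- `A_{n̂,r} = H_{n_1} ⊗ ⋯ ⊗ H_{n_r}`. -/
abbrev AHat {r n : ℕ} (nh : Comp r n) : Type u := ⨂[F] k : Fin r, DegAffine F (nh.1 k)

/-- `A_{n,r} = ⨁_{n̂} A_{n̂,r}`, a finite direct sum of algebras. -/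
abbrev A : Type u := ∀ nh : Comp r n, AHat F nh

variable (p : ℕ) [Fact p.Prime] [CharP F p] (mu : Fin r → ZMod p → ℕ)

/-- `⨁_{n̂} H_{n_1}^{μ[1]} ⊗ ⋯ ⊗ H_{n_r}^{μ[r]}`. -/
abbrev ACyc : Type u := ∀ nh : Comp r n, ⨂[F] k : Fin r, DegCyc F p (nh.1 k) (mu k)

/-- The tensor product of a family of algebra homomorphisms. -/
def tensorMap {ι : Type} {B C : ι → Type u} [∀ i, Ring (B i)] [∀ i, Algebra F (B i)]
    [∀ i, Ring (C i)] [∀ i, Algebra F (C i)] (f : ∀ i, B i →ₐ[F] C i) :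
    (⨂[F] i, B i) →ₐ[F] ⨂[F] i, C i :=
  PiTensorProduct.liftAlgHom
    ((PiTensorProduct.tprod F).compLinearMap fun i => (f i).toLinearMap)
    (by
      simp only [MultilinearMap.compLinearMap_apply, PiTensorProduct.one_def]
      congr 1
      funext i
      simp)
    (by
      intro a b
      simp only [MultilinearMap.compLinearMap_apply, PiTensorProduct.tprod_mul_tprod]
      congr 1
      funext i
      simp)

/-- The canonical surjection from `A_{n,r}` onto its cyclotomic quotient. -/
def toACyc : A F r n →ₐ[F] ACyc F r n p mu :=
  AlgHom.pi fun nh =>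
    (tensorMap F fun k => toCyc F p PUnit.{u + 1} (nh.1 k) (mu k)).comp (Pi.evalAlgHom F _ nh)

end Target

/-! ### Categories of finite dimensional modules -/

section Modules

variable (F : Type u) [Field F]

/-- The category of left modules over the `F`-algebra `B` that are finite dimensional over `F`. -/
abbrev FDMod (B : Type u) [Ring B] [Algebra F B] : Type (u + 1) :=
  ObjectProperty.FullSubcategory fun M : ModuleCat.{u} B => Module.Finite F M

theorem finite_restrictScalars {B C : Type u} [Ring B] [Algebra F B] [Ring C] [Algebra F C]
    (f : B →ₐ[F] C) (M : ModuleCat.{u} C) (hM : Module.Finite F M) :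
    Module.Finite F ((ModuleCat.restrictScalars f.toRingHom).obj M) := by
  let e : M →ₗ[F] ((ModuleCat.restrictScalars f.toRingHom).obj M) :=
    { toFun := fun m => m
      map_add' := fun _ _ => rfl
      map_smul' := fun c m => by
        change algebraMap F C c • m = f (algebraMap F B c) • m
        rw [f.commutes] }
  exact Module.Finite.of_surjective e fun m => ⟨m, rfl⟩

/-- Restriction of finite dimensional modules along an algebra homomorphism (inflation, if the
homomorphism is surjective). -/
def inflation {B C : Type u} [Ring B] [Algebra F B] [Ring C] [Algebra F C] (f : B →ₐ[F] C) :
    FDMod F C ⥤ FDMod F B :=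
  ObjectProperty.lift _
    (ObjectProperty.ι (fun M : ModuleCat.{u} C => Module.Finite F M) ⋙
      ModuleCat.restrictScalars f.toRingHom)
    fun M => finite_restrictScalars F f M.obj M.property

end Modules

/-! ### The functor -/

section Hom

variable {F : Type u} [Field F] {G : Type u} [Group G] [Fintype G] {r n : ℕ}
  {V : Fin r → Type u} [∀ k, AddCommGroup (V k)] [∀ k, Module F (V k)]
  (ρ : ∀ k, Representation F G (V k))

/-- `V(n̂) = V_1^{⊗ n_1} ⊗ ⋯ ⊗ V_r^{⊗ n_r}`. -/
abbrev VHat (F : Type u) [Field F] {r n : ℕ} (V : Fin r → Type u) [∀ k, AddCommGroup (V k)]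
    [∀ k, Module F (V k)] (nh : Comp r n) : Type u :=
  ⨂[F] a : (Σ k, Fin (nh.1 k)), V a.1

/-- The action of `G^n` on `V(n̂)`: the `i`-th component of `g` acts on the `i`-th factor. -/
def gAct (nh : Comp r n) (g : Fin n → G) : VHat F V nh →ₗ[F] VHat F V nh :=
  PiTensorProduct.map fun a => ρ a.1 (g (place nh a))

section

variable (M : Type u) [AddCommGroup M] [Module F M] [Module (Affine F G n) M]

/-- A linear map `V(n̂) → M` is `G^n`-equivariant. -/
def IsEquivariant (nh : Comp r n) (φ : VHat F V nh →ₗ[F] M) : Prop :=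
  ∀ (g : Fin n → G) (v : VHat F V nh), φ (gAct ρ nh g v) = ofG F g • φ v

/-- `I_{n̂} M`, the isotypical subspace of `V(n̂)` in `M`: the sum of all `FG^n`-submodules of `M`
isomorphic to `V(n̂)`. -/
def isotypical (nh : Comp r n) : Submodule F M :=
  sSup {W | ∃ φ : VHat F V nh →ₗ[F] M,
    IsEquivariant ρ M nh φ ∧ Function.Injective φ ∧ LinearMap.range φ = W}

variable [IsScalarTower F (Affine F G n) M]

/-- `Hom_{FG^n}(V(n̂), I_{n̂} M)`. -/
def HomHat (nh : Comp r n) : Submodule F (VHat F V nh →ₗ[F] M) where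
  carrier := {φ | IsEquivariant ρ M nh φ ∧ ∀ v, φ v ∈ isotypical ρ M nh}
  add_mem' := by
    rintro φ ψ ⟨h₁, h₂⟩ ⟨h₃, h₄⟩
    refine ⟨fun g v => ?_, fun v => Submodule.add_mem _ (h₂ v) (h₄ v)⟩
    rw [LinearMap.add_apply, LinearMap.add_apply, h₁ g v, h₃ g v, smul_add]
  zero_mem' := ⟨fun g v => by simp, fun v => Submodule.zero_mem _⟩
  smul_mem' := by
    rintro c φ ⟨h₁, h₂⟩
    refine ⟨fun g v => ?_, fun v => Submodule.smul_mem _ c (h₂ v)⟩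
    rw [LinearMap.smul_apply, LinearMap.smul_apply, h₁ g v, ← algebraMap_smul (Affine F G n) c,
      ← algebraMap_smul (Affine F G n) c, ← mul_smul, ← mul_smul,
      Algebra.commutes]

end

/-- `c_k = |G| / d_k`, where `d_k = dim V_k`, as an element of `𝔽_p`. -/
def cScalar (F : Type u) [Field F] (p : ℕ) [Fact p.Prime] (G : Type u) [Fintype G] {r : ℕ}
    (V : Fin r → Type u) [∀ k, AddCommGroup (V k)] [∀ k, Module F (V k)] (k : Fin r) : ZMod p :=
  (Fintype.card G : ZMod p) / (Module.finrank F (V k) : ZMod p)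

/-- The weight `λ[k]`: its value at `i` is `λ_{i c_k}`. -/
def scaledWeight (F : Type u) [Field F] {p : ℕ} [Fact p.Prime] (G : Type u) [Fintype G] {r : ℕ}
    (V : Fin r → Type u) [∀ k, AddCommGroup (V k)] [∀ k, Module F (V k)] (lam : ZMod p → ℕ)
    (k : Fin r) : ZMod p → ℕ :=
  fun i => lam (i * cScalar F p G V k)

/-- `(v_a) ↦ (v_{π(a)})` for an element `π` of the Young subgroup `S_{n_1} × ⋯ × S_{n_r}`. -/
def permute {nh : Comp r n} (π : ∀ k, Equiv.Perm (Fin (nh.1 k)))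
    (v : ∀ a : (Σ k, Fin (nh.1 k)), V a.1) : ∀ a : (Σ k, Fin (nh.1 k)), V a.1 :=
  fun a => v ⟨a.1, π a.1 a.2⟩

/-- A functor `T : H_n(G)-mod ⥤ A_{n,r}-mod` *is* the functor
`M ↦ ⨁_{n̂} Hom_{FG^n}(V(n̂), I_{n̂} M)`. Here `A_{n̂,r}` acts on the summand for `n̂` by
`(s ⋄ φ)(⊗ v_a) = s φ(⊗ v_{s(a)})` for a simple transposition `s` of the Young subgroup and by
`(y ⋄ φ)(v) = c_k⁻¹ x φ(v)` for a polynomial generator `y` of the `k`-th tensor factor and the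
generator `x` of `H_n(G)` at the same place; on morphisms the functor is composition. -/
structure IsHomFunctor (p : ℕ) [Fact p.Prime] [CharP F p]
    (T : FDMod F (Affine F G n) ⥤ FDMod F (A F r n)) where
  /-- the action of `A_{n̂,r}` on `Hom_{FG^n}(V(n̂), I_{n̂} M)` -/
  act (M : FDMod F (Affine F G n)) (nh : Comp r n) :
    AHat F nh →ₐ[F] Module.End F (HomHat ρ M.obj nh)
  act_s (M : FDMod F (Affine F G n)) (nh : Comp r n) (k : Fin r) (j : Fin (nh.1 k - 1))
    (φ : HomHat ρ M.obj nh) (v : ∀ a : (Σ k, Fin (nh.1 k)), V a.1) :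
    (act M nh (PiTensorProduct.singleAlgHom k (s F PUnit.{u + 1} j)) φ).1
        (PiTensorProduct.tprod F v) =
      s F G (simplePlace nh k j) •
        φ.1 (PiTensorProduct.tprod F
          (permute (Pi.mulSingle k (Equiv.swap (lo j) (hi j))) v))
  act_y (M : FDMod F (Affine F G n)) (nh : Comp r n) (k : Fin r) (j : Fin (nh.1 k))
    (φ : HomHat ρ M.obj nh) (v : VHat F V nh) :
    (act M nh (PiTensorProduct.singleAlgHom k (x F PUnit.{u + 1} j)) φ).1 v =
      (ZMod.castHom (dvd_refl p) F (cScalar F p G V k))⁻¹ •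
        (x F G (place nh ⟨k, j⟩) • φ.1 v)
  /-- the identification of `T(M)` with the direct sum of the spaces of homomorphisms -/
  iso (M : FDMod F (Affine F G n)) :
    (T.obj M).obj ≃ₗ[F] ∀ nh : Comp r n, HomHat ρ M.obj nh
  iso_smul (M : FDMod F (Affine F G n)) (a : A F r n) (u : (T.obj M).obj) (nh : Comp r n) :
    iso M (a • u) nh = act M nh (a nh) (iso M u nh)
  iso_map {M N : FDMod F (Affine F G n)} (f : M ⟶ N) (u : (T.obj M).obj) (nh : Comp r n)
    (v : VHat F V nh) :
    (iso N ((T.map f).hom.hom u) nh).1 v = f.hom.hom ((iso M u nh).1 v)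

end Hom

end WreathHecke

end

/-! As `|G|` is invertible in `F`, the Schur relations produce matrix units in `F G^n`, one family
for every labelling of the `n` places by simple modules, and their diagonal elements sum to `1`. A
labelling is a shuffle `α` of the blocks `1, …, r`, whose permutation `w_α` carries the standard
labelling to it, so every `H_n(G)`-module `M` is spanned by the vectors `w_α φ(v)` with `φ` in
`Hom_{FG^n}(V(n̂), M)`. On them `t_{i,i+1}` acts by `0` if the places `i` and `i + 1` have different
labels, and by `c_k` times the exchange of two tensor factors if both have label `k`. In the first
case `s_i x_i = x_{i+1} s_i`; in the second, `c_k⁻¹ x_j` satisfies the relations of the degenerate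
affine Hecke algebra. Hence the functor `𝓕` is well defined, a homomorphism `f : 𝓕(M) → 𝓕(N)`
extends uniquely to `M → N` through `w_α φ(v) ↦ w_α (fφ)(v)`, and the same formulas define an
`H_n(G)`-module structure on `⨁_α V(n̂) ⊗ Y`, whose image under `𝓕` is the given `Y`.

For the cyclotomic quotients, `g(x_{α(a)}) w_α φ(v) = w_α g(x_a) φ(v)` for every polynomial `g`, and
`∏ (c_k y - i)^{λ_i}` is a non-zero multiple of `∏ (y - i)^{λ[k]_i}`. So `g_λ(x_1)` kills `M`
exactly if `g_{λ[k]}` of the first `y` of each block kills `𝓕(M)`: the first place of a shuffle is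
the first place of some block, and every block comes first in some shuffle. -/

noncomputable section

namespace WreathHecke

section Schur

variable {F : Type u} [Field F] {G : Type u} [Group G]

theorem trace_conj {W : Type*} [AddCommGroup W] [Module F W] (σ : Representation F G W) (h : G)
    (Y : W →ₗ[F] W) :
    LinearMap.trace F W (σ h ∘ₗ Y ∘ₗ σ h⁻¹) = LinearMap.trace F W Y := by
  simp only [← Module.End.mul_eq_comp]
  rw [LinearMap.trace_mul_comm, mul_assoc, ← map_mul, inv_mul_cancel, map_one, mul_one]

section Averaging

variable [Fintype G] {W W' : Type*} [AddCommGroup W] [Module F W] [AddCommGroup W'] [Module F W']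
  (σ : Representation F G W) (τ : Representation F G W')

/-- The intertwining map `∑ h, h ∘ Y ∘ h⁻¹` attached to a linear map `Y` between two
representations; it is not divided by the order of the group. -/
def sumConj (Y : W →ₗ[F] W') : σ.IntertwiningMap τ where
  toLinearMap := ∑ h : G, τ h ∘ₗ Y ∘ₗ σ h⁻¹
  isIntertwining' g := by
    ext v
    simp only [LinearMap.comp_apply, LinearMap.sum_apply, map_sum]
    refine Fintype.sum_equiv (Equiv.mulLeft g⁻¹) _ _ fun h => ?_
    simp [← Module.End.mul_apply, ← map_mul]

theorem toLinearMap_sumConj (Y : W →ₗ[F] W') :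
    (sumConj σ τ Y).toLinearMap = ∑ h : G, τ h ∘ₗ Y ∘ₗ σ h⁻¹ :=
  rfl

theorem sumConj_apply (Y : W →ₗ[F] W') (v : W) :
    sumConj σ τ Y v = ∑ h : G, τ h (Y (σ h⁻¹ v)) := by
  change (sumConj σ τ Y).toLinearMap v = _
  simp [toLinearMap_sumConj, LinearMap.sum_apply]

theorem trace_sumConj (Y : W →ₗ[F] W) :
    LinearMap.trace F W (sumConj σ σ Y).toLinearMap = Fintype.card G * LinearMap.trace F W Y := by
  simp [toLinearMap_sumConj, trace_conj]

theorem sum_bilinear_eq {X : Type*} [AddCommGroup X] [Module F X] [FiniteDimensional F W']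
    (B : W →ₗ[F] W' →ₗ[F] X) (x : W) (y : W') :
    ∑ h : G, B (σ h x) (τ h⁻¹ y) =
      ∑ i, B (∑ h : G, (Module.finBasis F W').coord i (τ h⁻¹ y) • σ h x)
        (Module.finBasis F W' i) := by
  let b := Module.finBasis F W'
  have hexpand (h : G) :
      B (σ h x) (τ h⁻¹ y) = ∑ i, B (b.coord i (τ h⁻¹ y) • σ h x) (b i) := by
    conv_lhs => rw [← b.sum_repr (τ h⁻¹ y), map_sum]
    simp
  simp only [hexpand, map_sum, LinearMap.sum_apply]
  exact Finset.sum_comm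

end Averaging

section Irreducible

variable {W W' : Type*} [AddCommGroup W] [Module F W] [AddCommGroup W'] [Module F W']
  {σ : Representation F G W} {τ : Representation F G W'}

theorem nontrivial_of_isIrreducible [σ.IsIrreducible] : Nontrivial W := by
  obtain ⟨A, B, hAB⟩ := (inferInstance : Nontrivial (Subrepresentation σ))
  by_contra hW
  rw [not_nontrivial_iff_subsingleton] at hW
  exact hAB (Subrepresentation.toSubmodule_injective (Subsingleton.elim _ _))

variable [Fintype G] [FiniteDimensional F W]

theorem finrank_smul_sumConj (hσ : Function.Surjective (algebraMap F (σ.IntertwiningMap σ)))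
    (Y : W →ₗ[F] W) (v : W) :
    (Module.finrank F W : F) • sumConj σ σ Y v =
      (Fintype.card G * LinearMap.trace F W Y : F) • v := by
  obtain ⟨a, ha⟩ := hσ (sumConj σ σ Y)
  have hscalar : (sumConj σ σ Y).toLinearMap = a • LinearMap.id := by
    rw [← ha]; rfl
  have htrace := trace_sumConj σ Y
  rw [hscalar, map_smul, LinearMap.trace_id, smul_eq_mul] at htrace
  rw [← htrace, mul_comm, mul_smul]
  congr 1
  exact LinearMap.congr_fun hscalar v

theorem finrank_ne_zero (hσ : Function.Surjective (algebraMap F (σ.IntertwiningMap σ)))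
    [Nontrivial W] (hG : (Fintype.card G : F) ≠ 0) : (Module.finrank F W : F) ≠ 0 := by
  intro hd
  obtain ⟨v, hv⟩ := exists_ne (0 : W)
  obtain ⟨ξ, hξ⟩ := not_forall.1 (mt (Module.forall_dual_apply_eq_zero_iff F v).1 hv)
  have h := finrank_smul_sumConj hσ (ξ.smulRight v) v
  rw [hd, zero_smul, LinearMap.trace_smulRight] at h
  exact smul_ne_zero (mul_ne_zero hG hξ) hv h.symm

theorem sum_coefficient_smul_self
    (hσ : Function.Surjective (algebraMap F (σ.IntertwiningMap σ)))
    (hd : (Module.finrank F W : F) ≠ 0) (ξ : Module.Dual F W) (u v : W) :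
    ∑ h : G, ξ (σ h⁻¹ v) • σ h u =
      ((Fintype.card G : F) / (Module.finrank F W : F)) • ξ u • v := by
  have h := finrank_smul_sumConj hσ (ξ.smulRight u) v
  simp only [sumConj_apply, LinearMap.smulRight_apply, map_smul, LinearMap.trace_smulRight] at h
  rw [smul_smul, div_mul_eq_mul_div, ← inv_mul_eq_div, ← smul_smul, ← h, inv_smul_smul₀ hd]

omit [FiniteDimensional F W] in
theorem sum_coefficient_smul_of_isEmpty_equiv [σ.IsIrreducible] [τ.IsIrreducible]
    [IsEmpty (σ.Equiv τ)] (ξ : Module.Dual F W) (u : W') (v : W) :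
    ∑ h : G, ξ (σ h⁻¹ v) • τ h u = 0 := by
  have hzero : sumConj σ τ (ξ.smulRight u) = 0 := Subsingleton.elim _ _
  simpa [hzero] using (sumConj_apply σ τ (ξ.smulRight u) v).symm

end Irreducible

section Family

variable [Fintype G] {ι : Type*} {V : ι → Type u} [∀ k, AddCommGroup (V k)] [∀ k, Module F (V k)]

/-- The Schur orthogonality relations for the matrix coefficients of a family of representations,
with Schur elements `c k`. -/
structure SchurOrthogonality (ρ : ∀ k, Representation F G (V k)) (c : ι → F) : Prop where
  ne_zero (k : ι) : c k ≠ 0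
  same (k : ι) (ξ : Module.Dual F (V k)) (u v : V k) :
    ∑ h : G, ξ (ρ k h⁻¹ v) • ρ k h u = c k • ξ u • v
  diff (k l : ι) (hkl : k ≠ l) (ξ : Module.Dual F (V l)) (u : V k) (v : V l) :
    ∑ h : G, ξ (ρ l h⁻¹ v) • ρ k h u = 0

theorem schurOrthogonality [∀ k, FiniteDimensional F (V k)] (ρ : ∀ k, Representation F G (V k))
    (hG : (Fintype.card G : F) ≠ 0) (hsimple : ∀ k, (ρ k).IsIrreducible)
    (hend : ∀ k, Function.Surjective (algebraMap F ((ρ k).IntertwiningMap (ρ k))))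
    (hdistinct : ∀ k l, k ≠ l → IsEmpty ((ρ k).Equiv (ρ l))) :
    SchurOrthogonality ρ fun k => (Fintype.card G : F) / (Module.finrank F (V k) : F) := by
  have : ∀ k, Nontrivial (V k) := fun k => nontrivial_of_isIrreducible (σ := ρ k)
  have hd k : (Module.finrank F (V k) : F) ≠ 0 := finrank_ne_zero (hend k) hG
  exact
    { ne_zero := fun k => div_ne_zero hG (hd k)
      same := fun k => sum_coefficient_smul_self (hend k) (hd k)
      diff := fun k l hkl =>
        have := hdistinct l k hkl.symm
        sum_coefficient_smul_of_isEmpty_equiv (σ := ρ l) (τ := ρ k) }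

/-- The element of the group algebra whose coefficients are those of the regular character
divided by the order of the group, when the `ρ k` are the simple modules and the `c k` their
Schur elements. -/
def characterUnit [Fintype ι] (ρ : ∀ k, Representation F G (V k)) (c : ι → F) : MonoidAlgebra F G :=
  ∑ g : G, MonoidAlgebra.single g (∑ k, (c k)⁻¹ * LinearMap.trace F (V k) (ρ k g⁻¹))

variable [∀ k, FiniteDimensional F (V k)] {ρ : ∀ k, Representation F G (V k)} {c : ι → F}

namespace SchurOrthogonality

open Classical in
theorem sum_trace_smul (hρ : SchurOrthogonality ρ c) (k l : ι) (u : V l) :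
    ∑ g : G, LinearMap.trace F (V k) (ρ k g⁻¹) • ρ l g u = if k = l then c l • u else 0 := by
  let b := Module.finBasis F (V k)
  have htrace (g : G) : LinearMap.trace F (V k) (ρ k g⁻¹) = ∑ i, b.coord i (ρ k g⁻¹ (b i)) := by
    simp [LinearMap.trace_eq_matrix_trace F b, Matrix.trace, LinearMap.toMatrix_apply]
  simp only [htrace, Finset.sum_smul]
  rw [Finset.sum_comm]
  split_ifs with hkl
  · subst hkl
    calc ∑ i, ∑ g : G, b.coord i (ρ k g⁻¹ (b i)) • ρ k g u
        = ∑ i, c k • b.coord i u • b i :=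
          Finset.sum_congr rfl fun i _ => hρ.same k (b.coord i) u (b i)
      _ = c k • u := by rw [← Finset.smul_sum]; simp
  · exact Finset.sum_eq_zero fun i _ => hρ.diff l k (Ne.symm hkl) _ u _

theorem asAlgebraHom_characterUnit [Fintype ι] (hρ : SchurOrthogonality ρ c) (l : ι) :
    (ρ l).asAlgebraHom (characterUnit ρ c) = 1 := by
  classical
  ext u
  simp only [characterUnit, map_sum, Representation.asAlgebraHom_single, LinearMap.sum_apply,
    LinearMap.smul_apply, Finset.sum_smul, mul_smul]
  rw [Finset.sum_comm]
  simp only [← Finset.smul_sum, hρ.sum_trace_smul]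
  simp [hρ.ne_zero]

omit [∀ k, FiniteDimensional F (V k)]

variable {X : Type*} [AddCommGroup X] [Module F X]

theorem sum_bilinear_same (hρ : SchurOrthogonality ρ c) {k : ι} [FiniteDimensional F (V k)]
    (B : V k →ₗ[F] V k →ₗ[F] X) (x y : V k) :
    ∑ h : G, B (ρ k h x) (ρ k h⁻¹ y) = c k • B y x := by
  let b := Module.finBasis F (V k)
  calc ∑ h : G, B (ρ k h x) (ρ k h⁻¹ y)
      = ∑ i, B (c k • b.coord i x • y) (b i) := by simp only [sum_bilinear_eq, hρ.same, b]
    _ = c k • B y (∑ i, b.repr x i • b i) := by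
        simp only [map_sum, map_smul, LinearMap.smul_apply, Finset.smul_sum,
          Module.Basis.coord_apply]
    _ = c k • B y x := by rw [b.sum_repr]

theorem sum_bilinear_diff (hρ : SchurOrthogonality ρ c) {k l : ι} (hkl : k ≠ l)
    [FiniteDimensional F (V l)] (B : V k →ₗ[F] V l →ₗ[F] X) (x : V k) (y : V l) :
    ∑ h : G, B (ρ k h x) (ρ l h⁻¹ y) = 0 := by
  simp only [sum_bilinear_eq, hρ.diff k l hkl, map_zero, LinearMap.zero_apply,
    Finset.sum_const_zero]

end SchurOrthogonality

end Family

theorem equiv_asAlgebraHom {W W' : Type*} [AddCommGroup W] [Module F W] [AddCommGroup W']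
    [Module F W'] {σ : Representation F G W} {τ : Representation F G W'} (e : σ.Equiv τ)
    (a : MonoidAlgebra F G) (w : W) :
    e (σ.asAlgebraHom a w) = τ.asAlgebraHom a (e w) := by
  induction a using MonoidAlgebra.induction_on with
  | of g => simpa using LinearMap.congr_fun (e.isIntertwining' g) w
  | add a b ha hb => simp [ha, hb]
  | smul r a ha => simp [ha]

section OfModule

variable {M : Type*} [AddCommGroup M] [Module F M] [Module (MonoidAlgebra F G) M]
  [IsScalarTower F (MonoidAlgebra F G) M]

theorem asAlgebraHom_ofModule' (a : MonoidAlgebra F G) (m : M) :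
    (Representation.ofModule' (k := F) (G := G) M).asAlgebraHom a m = a • m := by
  rw [Representation.asAlgebraHom, Representation.ofModule', Equiv.apply_symm_apply]
  rfl

theorem isIrreducible_ofModule' [IsSimpleModule (MonoidAlgebra F G) M] :
    (Representation.ofModule' (k := F) (G := G) M).IsIrreducible := by
  rw [Representation.irreducible_iff_isSimpleModule_asModule]
  let σ := Representation.ofModule' (k := F) (G := G) M
  let e : σ.asModule ≃ₗ[MonoidAlgebra F G] M :=
    { σ.asModuleEquiv with
      map_smul' := fun a m => by
        change σ.asModuleEquiv (a • m) = a • σ.asModuleEquiv m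
        rw [Representation.asModuleEquiv_map_smul, asAlgebraHom_ofModule'] }
  exact IsSimpleModule.congr e

end OfModule

section Complete

variable [Fintype G] {ι : Type*} [Fintype ι] {V : ι → Type u} [∀ k, AddCommGroup (V k)]
  [∀ k, Module F (V k)]
  [∀ k, FiniteDimensional F (V k)] {ρ : ∀ k, Representation F G (V k)} {c : ι → F}

theorem SchurOrthogonality.characterUnit_smul (hρ : SchurOrthogonality ρ c)
    (hcomplete : ∀ (W : Type u) [AddCommGroup W] [Module F W] [FiniteDimensional F W]
      (σ : Representation F G W), σ.IsIrreducible → ∃ k, Nonempty (σ.Equiv (ρ k)))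
    (S : Type u) [AddCommGroup S] [Module F S] [FiniteDimensional F S]
    [Module (MonoidAlgebra F G) S] [IsScalarTower F (MonoidAlgebra F G) S]
    [IsSimpleModule (MonoidAlgebra F G) S] (m : S) : characterUnit ρ c • m = m := by
  obtain ⟨l, ⟨e⟩⟩ := hcomplete S (Representation.ofModule' (k := F) (G := G) S)
    isIrreducible_ofModule'
  apply e.toLinearEquiv.injective
  calc e (characterUnit ρ c • m)
      = (ρ l).asAlgebraHom (characterUnit ρ c) (e m) := by
        rw [← equiv_asAlgebraHom, asAlgebraHom_ofModule']
    _ = e m := by rw [hρ.asAlgebraHom_characterUnit, Module.End.one_apply]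

theorem SchurOrthogonality.characterUnit_eq_one (hρ : SchurOrthogonality ρ c)
    (hG : (Fintype.card G : F) ≠ 0)
    (hcomplete : ∀ (W : Type u) [AddCommGroup W] [Module F W] [FiniteDimensional F W]
      (σ : Representation F G W), σ.IsIrreducible → ∃ k, Nonempty (σ.Equiv (ρ k))) :
    characterUnit ρ c = 1 := by
  have : NeZero (Nat.card G : F) := ⟨by rwa [Nat.card_eq_fintype_card]⟩
  let fixed : Submodule (MonoidAlgebra F G) (MonoidAlgebra F G) :=
    sSup {S | IsSimpleModule (MonoidAlgebra F G) S}
  have hfixed : ∀ m ∈ fixed, characterUnit ρ c * m = m := by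
    intro m hm
    simp only [fixed, sSup_eq_iSup'] at hm
    refine Submodule.iSup_induction _ (motive := fun m => characterUnit ρ c * m = m) hm ?_
      (mul_zero _) fun a b ha hb => by rw [mul_add, ha, hb]
    rintro ⟨S, hS⟩ m hm
    have : IsSimpleModule (MonoidAlgebra F G) S := hS
    exact congrArg Subtype.val (hρ.characterUnit_smul hcomplete S ⟨m, hm⟩)
  have htop : fixed = ⊤ := IsSemisimpleModule.sSup_simples_eq_top ..
  simpa using hfixed 1 (htop ▸ Submodule.mem_top)

open Classical in
/-- The Schur orthogonality relations, together with the decomposition of the regular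
character. -/
structure SchurRelations (ρ : ∀ k, Representation F G (V k)) (c : ι → F) : Prop
    extends SchurOrthogonality ρ c where
  nontrivial (k : ι) : Nontrivial (V k)
  regular (g : G) :
    ∑ k, (c k)⁻¹ * LinearMap.trace F (V k) (ρ k g) = if g = 1 then 1 else 0

theorem schurRelations (hG : (Fintype.card G : F) ≠ 0) (hsimple : ∀ k, (ρ k).IsIrreducible)
    (hend : ∀ k, Function.Surjective (algebraMap F ((ρ k).IntertwiningMap (ρ k))))
    (hdistinct : ∀ k l, k ≠ l → IsEmpty ((ρ k).Equiv (ρ l)))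
    (hcomplete : ∀ (W : Type u) [AddCommGroup W] [Module F W] [FiniteDimensional F W]
      (σ : Representation F G W), σ.IsIrreducible → ∃ k, Nonempty (σ.Equiv (ρ k))) :
    SchurRelations ρ fun k => (Fintype.card G : F) / (Module.finrank F (V k) : F) := by
  classical
  have horth := schurOrthogonality ρ hG hsimple hend hdistinct
  refine { horth with
    nontrivial := fun k => nontrivial_of_isIrreducible (σ := ρ k)
    regular := fun g => ?_ }
  have hcoeff := congrArg (fun a => MonoidAlgebra.coeff a g⁻¹)
    (horth.characterUnit_eq_one hG hcomplete)
  simpa [characterUnit, MonoidAlgebra.coeff_sum, MonoidAlgebra.one_def, Finsupp.single_apply,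
    eq_comm (a := (1 : G))] using hcoeff

end Complete

end Schur

section SymmetricGroup

variable {n : ℕ}

/-- The simple transposition `(i, i+1)`. -/
def simpleSwap (i : Fin (n - 1)) : Equiv.Perm (Fin n) := Equiv.swap (lo i) (hi i)

theorem lo_ne_hi (i : Fin (n - 1)) : lo i ≠ hi i := by
  simp [lo, hi, Fin.ext_iff]

@[simp] theorem simpleSwap_lo (i : Fin (n - 1)) : simpleSwap i (lo i) = hi i :=
  Equiv.swap_apply_left _ _

@[simp] theorem simpleSwap_hi (i : Fin (n - 1)) : simpleSwap i (hi i) = lo i :=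
  Equiv.swap_apply_right _ _

theorem simpleSwap_of_ne {i : Fin (n - 1)} {b : Fin n} (h₁ : b ≠ lo i) (h₂ : b ≠ hi i) :
    simpleSwap i b = b :=
  Equiv.swap_apply_of_ne_of_ne h₁ h₂

@[simp] theorem simpleSwap_inv (i : Fin (n - 1)) : (simpleSwap i)⁻¹ = simpleSwap i :=
  Equiv.swap_inv _ _

@[simp] theorem simpleSwap_mul_self (i : Fin (n - 1)) : simpleSwap i * simpleSwap i = 1 :=
  Equiv.swap_mul_self _ _

@[simp] theorem simpleSwap_mul_cancel (i : Fin (n - 1)) (w : Equiv.Perm (Fin n)) :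
    simpleSwap i * (simpleSwap i * w) = w := by
  rw [← mul_assoc, simpleSwap_mul_self, one_mul]

@[simp] theorem simpleSwap_apply_self (i : Fin (n - 1)) (b : Fin n) :
    simpleSwap i (simpleSwap i b) = b := by
  rw [← Equiv.Perm.mul_apply, simpleSwap_mul_self, Equiv.Perm.one_apply]

theorem simpleSwap_lo_of_far {i j : Fin (n - 1)} (h : i.1 + 1 < j.1 ∨ j.1 + 1 < i.1) :
    simpleSwap i (lo j) = lo j := by
  apply simpleSwap_of_ne <;> simp only [lo, hi, ne_eq, Fin.mk.injEq] <;> omega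

theorem simpleSwap_hi_of_far {i j : Fin (n - 1)} (h : i.1 + 1 < j.1 ∨ j.1 + 1 < i.1) :
    simpleSwap i (hi j) = hi j := by
  apply simpleSwap_of_ne <;> simp only [lo, hi, ne_eq, Fin.mk.injEq] <;> omega

theorem simpleSwap_mul_comm {i j : Fin (n - 1)} (h : i.1 + 1 < j.1 ∨ j.1 + 1 < i.1) :
    simpleSwap i * simpleSwap j = simpleSwap j * simpleSwap i := by
  have hconj := Equiv.mul_swap_eq_swap_mul (simpleSwap i) (lo j) (hi j)
  rwa [simpleSwap_lo_of_far h, simpleSwap_hi_of_far h] at hconj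

theorem hi_eq_lo {i j : Fin (n - 1)} (h : i.1 + 1 = j.1) : hi i = lo j := Fin.ext h

theorem lo_ne_hi_of_adjacent {i j : Fin (n - 1)} (h : i.1 + 1 = j.1) : lo i ≠ hi j := by
  simp only [lo, hi, ne_eq, Fin.mk.injEq]
  omega

theorem simpleSwap_braid {i j : Fin (n - 1)} (h : i.1 + 1 = j.1) :
    simpleSwap i * simpleSwap j * simpleSwap i = simpleSwap j * simpleSwap i * simpleSwap j := by
  have hj := Equiv.swap_mul_swap_mul_swap (lo_ne_hi j).symm (lo_ne_hi_of_adjacent h).symm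
  have hi' := Equiv.swap_mul_swap_mul_swap (lo_ne_hi i) (lo_ne_hi_of_adjacent h)
  rw [← hi_eq_lo h, Equiv.swap_comm (hi i) (lo i), Equiv.swap_comm (hi j)] at hj
  simp only [simpleSwap]
  rw [← hi_eq_lo h, hj, hi', Equiv.swap_comm]

/-- The word `w⁻¹(1) ⋯ w⁻¹(n)` has a descent at `i`; equivalently, `s_i w` is shorter than
`w`. -/
def Descent (w : Equiv.Perm (Fin n)) (i : Fin (n - 1)) : Prop := w⁻¹ (hi i) < w⁻¹ (lo i)

theorem Descent.of_not {w : Equiv.Perm (Fin n)} {i : Fin (n - 1)} (h : ¬ Descent w i) :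
    Descent (simpleSwap i * w) i := by
  have hne : w⁻¹ (lo i) ≠ w⁻¹ (hi i) := w⁻¹.injective.ne (lo_ne_hi i)
  simp only [Descent, not_lt] at h ⊢
  simpa [mul_inv_rev] using lt_of_le_of_ne h hne

theorem Descent.of_far {w : Equiv.Perm (Fin n)} {i j : Fin (n - 1)} (hw : Descent w j)
    (h : i.1 + 1 < j.1 ∨ j.1 + 1 < i.1) : Descent (simpleSwap i * w) j := by
  simpa [Descent, mul_inv_rev, simpleSwap_lo_of_far h, simpleSwap_hi_of_far h] using hw

/-- A statistic on permutations which decreases when a descent is removed; it takes the place of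
the number of inversions. -/
def disorder (w : Equiv.Perm (Fin n)) : ℕ := ∑ b : Fin n, (w⁻¹ b : ℕ) * (n - (b : ℕ))

theorem disorder_simpleSwap_mul (w : Equiv.Perm (Fin n)) (i : Fin (n - 1)) :
    disorder (simpleSwap i * w) + (w⁻¹ (lo i) : ℕ) = disorder w + (w⁻¹ (hi i) : ℕ) := by
  have hreindex : disorder (simpleSwap i * w) =
      ∑ b : Fin n, (w⁻¹ b : ℕ) * (n - (simpleSwap i b : ℕ)) :=
    Fintype.sum_equiv (simpleSwap i) _ _ fun b => by simp [mul_inv_rev]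
  have hterm (b : Fin n) : (w⁻¹ b : ℕ) * (n - (simpleSwap i b : ℕ)) +
      (if b = lo i then (w⁻¹ b : ℕ) else 0) =
      (w⁻¹ b : ℕ) * (n - (b : ℕ)) + if b = hi i then (w⁻¹ b : ℕ) else 0 := by
    have hlo : n - (lo i : ℕ) = n - (hi i : ℕ) + 1 := by
      have := (hi i).2
      simp only [lo, hi] at this ⊢
      omega
    rcases eq_or_ne b (lo i) with rfl | hb
    · rw [simpleSwap_lo, if_pos rfl, if_neg (lo_ne_hi i), hlo]; ring
    rcases eq_or_ne b (hi i) with rfl | hb'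
    · rw [simpleSwap_hi, if_pos rfl, if_neg (lo_ne_hi i).symm, hlo]; ring
    rw [simpleSwap_of_ne hb hb', if_neg hb, if_neg hb']
  have hsum := Finset.sum_congr (s₁ := Finset.univ) rfl fun b _ => hterm b
  rw [hreindex, disorder]
  simpa only [Finset.sum_add_distrib, Finset.sum_ite_eq', Finset.mem_univ, if_true] using hsum

theorem disorder_lt {w : Equiv.Perm (Fin n)} {i : Fin (n - 1)} (h : Descent w i) :
    disorder (simpleSwap i * w) < disorder w := by
  have := disorder_simpleSwap_mul w i
  have : (w⁻¹ (hi i) : ℕ) < w⁻¹ (lo i) := h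
  omega

theorem eq_one_of_no_descent {w : Equiv.Perm (Fin n)} (h : ∀ i, ¬ Descent w i) : w = 1 := by
  rcases n with _ | m
  · exact Subsingleton.elim _ _
  have hmono : StrictMono (w⁻¹ : Equiv.Perm (Fin (m + 1))) := by
    refine Fin.strictMono_iff_lt_succ.2 fun i => ?_
    exact lt_of_le_of_ne (not_lt.1 (h i)) (w⁻¹.injective.ne (lo_ne_hi (n := m + 1) i))
  have hrefl := Subsingleton.elim (StrictMono.orderIsoOfSurjective _ hmono w⁻¹.surjective)
    (OrderIso.refl _)
  exact inv_eq_one.1 (Equiv.ext fun b => congrArg (fun e : Fin (m + 1) ≃o Fin (m + 1) => e b) hrefl)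

theorem perm_induction {P : Equiv.Perm (Fin n) → Prop} (one : P 1)
    (step : ∀ w i, Descent w i → P (simpleSwap i * w) → P w) (w : Equiv.Perm (Fin n)) : P w := by
  induction hm : disorder w using Nat.strong_induction_on generalizing w with
  | _ m ih =>
  subst hm
  by_cases h : ∃ i, Descent w i
  · obtain ⟨i, h⟩ := h
    exact step w i h (ih _ (disorder_lt h) _ rfl)
  · rw [eq_one_of_no_descent (not_exists.1 h)]
    exact one

variable {U : Type*} [Monoid U] (t : Fin (n - 1) → U)

/-- The Coxeter relations of the symmetric group. -/
structure CoxeterRelations : Prop where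
  sq (i : Fin (n - 1)) : t i * t i = 1
  comm (i j : Fin (n - 1)) (h : i.1 + 1 < j.1 ∨ j.1 + 1 < i.1) : t i * t j = t j * t i
  braid (i j : Fin (n - 1)) (h : i.1 + 1 = j.1) : t i * t j * t i = t j * t i * t j

/-- The product of the elements `t i` along a reduced word for `w`. -/
def wordProd (w : Equiv.Perm (Fin n)) : U := by
  classical exact
  if h : ∃ i, Descent w i then t h.choose * wordProd (simpleSwap h.choose * w) else 1
termination_by disorder w
decreasing_by exact disorder_lt h.choose_spec

theorem wordProd_one : wordProd t 1 = 1 := by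
  rw [wordProd, dif_neg]
  rintro ⟨i, hdescent⟩
  simp only [Descent, inv_one, Equiv.Perm.one_apply, lo, hi, Fin.lt_def] at hdescent
  omega

variable {t}

section Confluence

variable {w : Equiv.Perm (Fin n)}
  (ih : ∀ w', disorder w' < disorder w → ∀ i, Descent w' i →
    wordProd t w' = t i * wordProd t (simpleSwap i * w'))
  {i j : Fin (n - 1)} (hi' : Descent w i) (hj' : Descent w j)

include ih hi' hj'

theorem wordProd_confluent_of_far (ht : CoxeterRelations t)
    (hij : i.1 + 1 < j.1 ∨ j.1 + 1 < i.1) :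
    t i * wordProd t (simpleSwap i * w) = t j * wordProd t (simpleSwap j * w) := by
  rw [ih _ (disorder_lt hi') j (hj'.of_far hij), ih _ (disorder_lt hj') i (hi'.of_far hij.symm)]
  simp only [← mul_assoc]
  rw [ht.comm i j hij, simpleSwap_mul_comm hij]

theorem wordProd_confluent_of_adjacent (ht : CoxeterRelations t) (hij : i.1 + 1 = j.1) :
    t i * wordProd t (simpleSwap i * w) = t j * wordProd t (simpleSwap j * w) := by
  have hmid := hi_eq_lo hij
  have hfix : simpleSwap j (lo i) = lo i :=
    simpleSwap_of_ne (hmid ▸ lo_ne_hi i) (lo_ne_hi_of_adjacent hij)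
  have hfix' : simpleSwap i (hi j) = hi j :=
    simpleSwap_of_ne (lo_ne_hi_of_adjacent hij).symm (hmid ▸ (lo_ne_hi j).symm)
  have hmove : simpleSwap j (hi i) = hi j := by rw [hmid, simpleSwap_lo]
  have hmove' : simpleSwap i (lo j) = lo i := by rw [← hmid, simpleSwap_hi]
  have hlt : w⁻¹ (hi i) < w⁻¹ (lo i) := hi'
  have hlt' : w⁻¹ (hi j) < w⁻¹ (hi i) := by rw [hmid]; exact hj'
  have hij' : Descent (simpleSwap i * w) j := by
    simpa [Descent, mul_inv_rev, hfix', hmove'] using hlt'.trans hlt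
  have hji' : Descent (simpleSwap j * w) i := by
    simpa [Descent, mul_inv_rev, hfix, hmove] using hlt'.trans hlt
  have hiji' : Descent (simpleSwap j * (simpleSwap i * w)) i := by
    simpa [Descent, mul_inv_rev, hfix, hfix', hmove] using hlt'
  have hjij' : Descent (simpleSwap i * (simpleSwap j * w)) j := by
    simpa [Descent, mul_inv_rev, hfix, hfix', hmove', hmid] using hlt
  rw [ih _ (disorder_lt hi') j hij', ih _ ((disorder_lt hij').trans (disorder_lt hi')) i hiji',
    ih _ (disorder_lt hj') i hji', ih _ ((disorder_lt hji').trans (disorder_lt hj')) j hjij']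
  simp only [← mul_assoc]
  rw [ht.braid i j hij, simpleSwap_braid hij]

theorem wordProd_confluent (ht : CoxeterRelations t) :
    t i * wordProd t (simpleSwap i * w) = t j * wordProd t (simpleSwap j * w) := by
  obtain hfar | hij | hji | rfl :
      (i.1 + 1 < j.1 ∨ j.1 + 1 < i.1) ∨ i.1 + 1 = j.1 ∨ j.1 + 1 = i.1 ∨ i = j := by omega
  · exact wordProd_confluent_of_far ih hi' hj' ht hfar
  · exact wordProd_confluent_of_adjacent ih hi' hj' ht hij
  · exact (wordProd_confluent_of_adjacent ih hj' hi' ht hji).symm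
  · rfl

end Confluence

theorem wordProd_descent (ht : CoxeterRelations t) {w : Equiv.Perm (Fin n)} {i : Fin (n - 1)}
    (h : Descent w i) : wordProd t w = t i * wordProd t (simpleSwap i * w) := by
  induction hm : disorder w using Nat.strong_induction_on generalizing w i with
  | _ m ih =>
  subst hm
  have hdescent : ∃ i, Descent w i := ⟨i, h⟩
  rw [wordProd, dif_pos hdescent]
  exact wordProd_confluent (fun w' hlt i h => ih _ hlt h rfl) hdescent.choose_spec h ht

theorem wordProd_simpleSwap_mul (ht : CoxeterRelations t) (w : Equiv.Perm (Fin n))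
    (i : Fin (n - 1)) : wordProd t (simpleSwap i * w) = t i * wordProd t w := by
  by_cases h : Descent w i
  · rw [wordProd_descent ht h, ← mul_assoc, ht.sq, one_mul]
  · rw [wordProd_descent ht (Descent.of_not h), simpleSwap_mul_cancel]

theorem wordProd_mul (ht : CoxeterRelations t) (w w' : Equiv.Perm (Fin n)) :
    wordProd t (w * w') = wordProd t w * wordProd t w' := by
  induction w using perm_induction with
  | one => rw [wordProd_one, one_mul, one_mul]
  | step w i h ih =>
    rw [wordProd_descent ht h, mul_assoc, ← ih, mul_assoc, ← wordProd_simpleSwap_mul ht,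
      simpleSwap_mul_cancel]

/-- The homomorphism from the symmetric group defined by elements which satisfy the Coxeter
relations. -/
def coxeterHom (ht : CoxeterRelations t) : Equiv.Perm (Fin n) →* U where
  toFun := wordProd t
  map_one' := wordProd_one t
  map_mul' := wordProd_mul ht

theorem coxeterHom_simpleSwap (ht : CoxeterRelations t) (i : Fin (n - 1)) :
    coxeterHom ht (simpleSwap i) = t i := by
  change wordProd t (simpleSwap i) = _
  rw [← mul_one (simpleSwap i), wordProd_simpleSwap_mul ht, wordProd_one, mul_one]

end SymmetricGroup

section Shuffles

variable {r n : ℕ} {nh : Comp r n}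

/-- The labellings of the places of the blocks by `Fin n` that are increasing on every block. -/
abbrev Shuffle (nh : Comp r n) : Type :=
  {α : (Σ k, Fin (nh.1 k)) ≃ Fin n // ∀ k, StrictMono fun j => α ⟨k, j⟩}

theorem place_strictMono (nh : Comp r n) (k : Fin r) : StrictMono fun j => place nh ⟨k, j⟩ := by
  intro j j' h
  simp only [place, Equiv.trans_apply, finCongr_apply, Fin.lt_def, Fin.val_cast,
    finSigmaFinEquiv_apply]
  exact Nat.add_lt_add_left h _

/-- The standard labelling. -/
def placeShuffle (nh : Comp r n) : Shuffle nh := ⟨place nh, place_strictMono nh⟩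

theorem place_lo_eq (nh : Comp r n) (k : Fin r) (j : Fin (nh.1 k - 1)) :
    place nh ⟨k, lo j⟩ = lo (simplePlace nh k j) := rfl

theorem place_hi_eq (nh : Comp r n) (k : Fin r) (j : Fin (nh.1 k - 1)) :
    place nh ⟨k, hi j⟩ = hi (simplePlace nh k j) := Fin.ext (place_hi nh k j)

theorem coe_simpleSwap_apply (i : Fin (n - 1)) (b : Fin n) :
    (simpleSwap i b : ℕ) =
      if (b : ℕ) = i then (i : ℕ) + 1 else if (b : ℕ) = i + 1 then (i : ℕ) else b := by
  simp only [simpleSwap, Equiv.swap_apply_def, lo, hi, Fin.ext_iff]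
  split_ifs <;> rfl

theorem simpleSwap_lt {i : Fin (n - 1)} {x y : Fin n} (h : x < y) (hne : x = lo i → y ≠ hi i) :
    simpleSwap i x < simpleSwap i y := by
  simp only [lo, hi, ne_eq, Fin.ext_iff] at hne
  rw [Fin.lt_def] at h ⊢
  rw [coe_simpleSwap_apply, coe_simpleSwap_apply]
  split_ifs <;> omega

/-- The colouring of `Fin n` determined by a labelling. -/
def colour (α : (Σ k, Fin (nh.1 k)) ≃ Fin n) (i : Fin n) : Fin r := (α.symm i).1

theorem colour_apply (α : (Σ k, Fin (nh.1 k)) ≃ Fin n) (a : Σ k, Fin (nh.1 k)) :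
    colour α (α a) = a.1 := by rw [colour, Equiv.symm_apply_apply]

/-- The adjacent positions `i` and `i + 1` have different colours, so that exchanging them turns
shuffles into shuffles. -/
abbrev Mixed (α : (Σ k, Fin (nh.1 k)) ≃ Fin n) (i : Fin (n - 1)) : Prop :=
  colour α (lo i) ≠ colour α (hi i)

/-- Exchange adjacent positions of different colours in a shuffle. -/
def Shuffle.swap (α : Shuffle nh) (i : Fin (n - 1)) (h : Mixed α.1 i) :
    Shuffle nh :=
  ⟨α.1.trans (simpleSwap i), fun k j j' hj => by
    refine simpleSwap_lt (α.2 k hj) fun hlo hhi => h ?_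
    rw [← hlo, ← hhi, colour_apply, colour_apply]⟩

theorem colour_swap (α : (Σ k, Fin (nh.1 k)) ≃ Fin n) (i : Fin (n - 1))
    (b : Fin n) : colour (α.trans (simpleSwap i)) b = colour α (simpleSwap i b) := by
  change (α.symm ((simpleSwap i)⁻¹ b)).1 = _
  rw [simpleSwap_inv]; rfl

theorem mixed_swap {α : (Σ k, Fin (nh.1 k)) ≃ Fin n} {i : Fin (n - 1)} (h : Mixed α i) :
    Mixed (α.trans (simpleSwap i)) i := by
  rw [Mixed, colour_swap, colour_swap, simpleSwap_lo, simpleSwap_hi]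
  exact h.symm

theorem Shuffle.eq_succ_of_apply_eq (α : Shuffle nh) {k : Fin r} {j j' : Fin (nh.1 k)}
    (h : (α.1 ⟨k, j'⟩ : ℕ) = α.1 ⟨k, j⟩ + 1) : (j' : ℕ) = j + 1 := by
  have hlt : j < j' := (α.2 k).lt_iff_lt.1 (Fin.lt_def.2 (by omega))
  by_contra hne
  have hbetween : (j : ℕ) + 1 < j' := by
    have := Fin.lt_def.1 hlt
    omega
  let m : Fin (nh.1 k) := ⟨j + 1, hbetween.trans j'.2⟩
  have hjm : (α.1 ⟨k, j⟩ : ℕ) < α.1 ⟨k, m⟩ := α.2 k (Fin.lt_def.2 (Nat.lt_succ_self j))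
  have hmj' : (α.1 ⟨k, m⟩ : ℕ) < α.1 ⟨k, j'⟩ := α.2 k (Fin.lt_def.2 hbetween)
  omega

theorem exists_of_not_mixed (α : Shuffle nh) (i : Fin (n - 1)) (h : ¬ Mixed α.1 i) :
    ∃ (k : Fin r) (j : Fin (nh.1 k - 1)), α.1 ⟨k, lo j⟩ = lo i ∧ α.1 ⟨k, hi j⟩ = hi i := by
  obtain ⟨⟨k, j⟩, hlo⟩ := α.1.surjective (lo i)
  obtain ⟨⟨k', j'⟩, hhi⟩ := α.1.surjective (hi i)
  rw [not_not, ← hlo, ← hhi, colour_apply, colour_apply] at h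
  obtain rfl : k = k' := h
  have hsucc : (j' : ℕ) = j + 1 := α.eq_succ_of_apply_eq (by rw [hlo, hhi]; rfl)
  have := j'.2
  refine ⟨k, ⟨j, by omega⟩, hlo, ?_⟩
  rw [← hhi]
  congr 2
  exact Fin.ext hsucc.symm

theorem not_mixed_of_same_block {α : (Σ k, Fin (nh.1 k)) ≃ Fin n} {i : Fin (n - 1)}
    {k : Fin r} {j j' : Fin (nh.1 k)} (hlo : α ⟨k, j⟩ = lo i) (hhi : α ⟨k, j'⟩ = hi i) :
    ¬ Mixed α i := by
  rw [not_not, ← hlo, ← hhi, colour_apply, colour_apply]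

/-- The permutation which carries the standard labelling to a given one. -/
def labelPerm (α : (Σ k, Fin (nh.1 k)) ≃ Fin n) : Equiv.Perm (Fin n) :=
  (place nh).symm.trans α

theorem labelPerm_place : labelPerm (place nh) = 1 := Equiv.symm_trans_self _

theorem labelPerm_apply (α : (Σ k, Fin (nh.1 k)) ≃ Fin n)
    (a : Σ k, Fin (nh.1 k)) : labelPerm α (place nh a) = α a := by
  simp [labelPerm]

theorem labelPerm_inv_apply (α : (Σ k, Fin (nh.1 k)) ≃ Fin n) (a : Σ k, Fin (nh.1 k)) :
    (labelPerm α)⁻¹ (α a) = place nh a := by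
  rw [← labelPerm_apply]
  exact Equiv.symm_apply_apply _ _

theorem mixed_of_descent (α : Shuffle nh) (i : Fin (n - 1)) (h : Descent (labelPerm α.1) i) :
    Mixed α.1 i := by
  intro hsame
  obtain ⟨k, j, hlo, hhi⟩ := exists_of_not_mixed α i (not_not.2 hsame)
  rw [Descent, ← hlo, ← hhi, labelPerm_inv_apply, labelPerm_inv_apply] at h
  exact absurd (place_strictMono nh k (show lo j < hi j by simp [lo, hi, Fin.lt_def])) h.asymm

theorem simpleSwap_mul_labelPerm {α : (Σ k, Fin (nh.1 k)) ≃ Fin n} {i : Fin (n - 1)} {k : Fin r}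
    {j : Fin (nh.1 k - 1)} (hlo : α ⟨k, lo j⟩ = lo i) (hhi : α ⟨k, hi j⟩ = hi i) :
    simpleSwap i * labelPerm α = labelPerm α * simpleSwap (simplePlace nh k j) := by
  rw [simpleSwap, simpleSwap, Equiv.mul_swap_eq_swap_mul, ← place_lo_eq, ← place_hi_eq,
    labelPerm_apply, labelPerm_apply, hlo, hhi]

theorem Shuffle.range_block (α : Shuffle nh) (k : Fin r) :
    Set.range (fun j => α.1 ⟨k, j⟩) = {i | colour α.1 i = k} := by
  ext i
  constructor
  · rintro ⟨j, rfl⟩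
    exact colour_apply _ _
  · rintro rfl
    exact ⟨(α.1.symm i).2, α.1.apply_symm_apply i⟩

theorem Shuffle.ncard_colour (α : Shuffle nh) (k : Fin r) :
    {i | colour α.1 i = k}.ncard = nh.1 k := by
  rw [← α.range_block, Set.ncard_range_of_injective (α.2 k).injective, Nat.card_eq_fintype_card,
    Fintype.card_fin]

theorem Shuffle.eq_of_colour_eq {α β : Shuffle nh} (h : colour α.1 = colour β.1) : α = β := by
  refine Subtype.ext (Equiv.ext fun ⟨k, j⟩ => ?_)
  have hblock : (fun j => α.1 ⟨k, j⟩) = fun j => β.1 ⟨k, j⟩ :=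
    (StrictMono.range_inj (α.2 k) (β.2 k)).1 (by rw [α.range_block, β.range_block, h])
  exact congrFun hblock j

/-- The shuffles of all compositions; they index the blocks of a matrix-unit decomposition of the
group algebra of `G^n`. -/
abbrev Label (r n : ℕ) : Type := Σ nh : Comp r n, Shuffle nh

theorem Label.ext_colour {x y : Label r n} (h : colour x.2.1 = colour y.2.1) : x = y := by
  obtain ⟨nh, α⟩ := x
  obtain ⟨nh', β⟩ := y
  simp only at h
  obtain rfl : nh = nh' := Subtype.ext (funext fun k => by
    rw [← α.ncard_colour, ← β.ncard_colour, h])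
  rw [Shuffle.eq_of_colour_eq h]

theorem Label.exists_colour (f : Fin n → Fin r) : ∃ x : Label r n, colour x.2.1 = f := by
  classical
  let S : Fin r → Finset (Fin n) := fun k => Finset.univ.filter fun i => f i = k
  have hS : ∑ k, (S k).card = n := by
    rw [← Finset.card_eq_sum_card_fiberwise (s := Finset.univ) (t := Finset.univ) (f := f)
      fun _ _ => Finset.mem_univ _]
    simp
  let nh : Comp r n := ⟨fun k => (S k).card, hS⟩
  let e : (Σ k, Fin (nh.1 k)) → Fin n := fun a => (S a.1).orderEmbOfFin rfl a.2
  have he : ∀ a, f (e a) = a.1 := fun a =>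
    (Finset.mem_filter.1 ((S a.1).orderEmbOfFin_mem rfl a.2)).2
  have hinj : Function.Injective e := by
    rintro ⟨k, j⟩ ⟨k', j'⟩ h
    have hk : k = k' := (he ⟨k, j⟩).symm.trans ((congrArg f h).trans (he ⟨k', j'⟩))
    subst hk
    exact congrArg (Sigma.mk k) (((S k).orderEmbOfFin rfl).injective h)
  have hbij : Function.Bijective e := (Fintype.bijective_iff_injective_and_card e).2
    ⟨hinj, by simpa using hS⟩
  refine ⟨⟨nh, Equiv.ofBijective e hbij, fun k => ((S k).orderEmbOfFin rfl).strictMono⟩, ?_⟩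
  funext i
  obtain ⟨a, rfl⟩ := hbij.surjective i
  rw [he]
  exact colour_apply (Equiv.ofBijective e hbij) a

/-- A label is determined by its colouring, which is arbitrary. -/
def labelEquiv : Label r n ≃ (Fin n → Fin r) :=
  Equiv.ofBijective (fun x => colour x.2.1) ⟨fun _ _ => Label.ext_colour, Label.exists_colour⟩

instance : Finite (Label r n) := Finite.of_equiv _ labelEquiv.symm

instance : Fintype (Label r n) := Fintype.ofFinite _

instance : Finite (Comp r n) :=
  Finite.of_surjective (fun x : Label r n => x.1) fun nh => ⟨⟨nh, placeShuffle nh⟩, rfl⟩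

instance : Fintype (Comp r n) := Fintype.ofFinite _

end Shuffles

section TensorAction

variable {F : Type u} [Field F] {G : Type u} [Group G] {r n : ℕ} {V : Fin r → Type u}
  [∀ k, AddCommGroup (V k)] [∀ k, Module F (V k)] (ρ : ∀ k, Representation F G (V k))
  {nh : Comp r n} (α : (Σ k, Fin (nh.1 k)) ≃ Fin n)

/-- The action of `G^n` on `V(n̂)` through a labelling of the tensor factors. -/
def labelAct (g : Fin n → G) :
    VHat F V nh →ₗ[F] VHat F V nh :=
  PiTensorProduct.map fun a => ρ a.1 (g (α a))

@[simp] theorem labelAct_tprod (g : Fin n → G) (v : ∀ a : (Σ k, Fin (nh.1 k)), V a.1) :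
    labelAct ρ α g (PiTensorProduct.tprod F v) =
      PiTensorProduct.tprod F fun a => ρ a.1 (g (α a)) (v a) :=
  PiTensorProduct.map_tprod _ _

theorem labelAct_one : labelAct ρ α 1 = 1 := by
  simp [labelAct]

theorem labelAct_mul (g h : Fin n → G) :
    labelAct ρ α (g * h) = labelAct ρ α g * labelAct ρ α h := by
  simp [labelAct, PiTensorProduct.map_mul]

theorem labelAct_trans (w : Equiv.Perm (Fin n)) (g : Fin n → G) :
    labelAct ρ (α.trans w) g = labelAct ρ α (fun m => g (w m)) := rfl

omit [∀ k, AddCommGroup (V k)] in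
theorem permute_update (π : ∀ k, Equiv.Perm (Fin (nh.1 k))) (v : ∀ a : (Σ k, Fin (nh.1 k)), V a.1)
    [DecidableEq (Σ k, Fin (nh.1 k))] (a : Σ k, Fin (nh.1 k)) (x : V a.1) :
    permute π (Function.update v a x) =
      Function.update (permute π v) ⟨a.1, (π a.1)⁻¹ a.2⟩ x := by
  funext b
  by_cases h : b = ⟨a.1, (π a.1)⁻¹ a.2⟩
  · subst h
    rw [Function.update_self]
    have heq : ∀ c : Σ k, Fin (nh.1 k), c = a → HEq (Function.update v a x c) x := by
      rintro c rfl
      rw [Function.update_self]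
    exact eq_of_heq (heq ⟨a.1, π a.1 ((π a.1)⁻¹ a.2)⟩ (by simp))
  · rw [Function.update_of_ne h, permute, permute, Function.update_of_ne]
    rintro rfl
    exact h (by simp)

variable (F V) in
/-- The place permutations of `V(n̂)` by the Young subgroup. -/
def permV (π : ∀ k, Equiv.Perm (Fin (nh.1 k))) : VHat F V nh →ₗ[F] VHat F V nh :=
  PiTensorProduct.lift
    { toFun := fun v => PiTensorProduct.tprod F (permute π v)
      map_update_add' := fun v a x y => by
        simp only [permute_update, MultilinearMap.map_update_add]
      map_update_smul' := fun v a c x => by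
        simp only [permute_update, MultilinearMap.map_update_smul] }

@[simp] theorem permV_tprod (π : ∀ k, Equiv.Perm (Fin (nh.1 k)))
    (v : ∀ a : (Σ k, Fin (nh.1 k)), V a.1) :
    permV F V π (PiTensorProduct.tprod F v) = PiTensorProduct.tprod F (permute π v) := by
  rw [permV, PiTensorProduct.lift.tprod]; rfl

theorem permV_one : permV F V (1 : ∀ k, Equiv.Perm (Fin (nh.1 k))) = 1 := by
  refine PiTensorProduct.ext (MultilinearMap.ext fun v => ?_)
  simp only [LinearMap.compMultilinearMap_apply, permV_tprod]
  rfl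

theorem permV_mul (π π' : ∀ k, Equiv.Perm (Fin (nh.1 k))) :
    permV F V π * permV F V π' = permV F V (π' * π) := by
  refine PiTensorProduct.ext (MultilinearMap.ext fun v => ?_)
  simp only [LinearMap.compMultilinearMap_apply, Module.End.mul_apply, permV_tprod]
  rfl

theorem permV_labelAct (π : ∀ k, Equiv.Perm (Fin (nh.1 k))) (g : Fin n → G) (u : VHat F V nh) :
    permV F V π (labelAct ρ α g u) =
      labelAct ρ ((Equiv.sigmaCongrRight π).trans α) g (permV F V π u) := by
  induction u using PiTensorProduct.induction_on with
  | smul_tprod c v => simp only [map_smul, labelAct_tprod, permV_tprod]; rfl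
  | add x y hx hy => simp only [map_add, hx, hy]

/-- The `j`-th simple transposition of the block `k`, as an element of the Young subgroup. -/
def blockSwap (nh : Comp r n) (k : Fin r) (j : Fin (nh.1 k - 1)) :
    ∀ k, Equiv.Perm (Fin (nh.1 k)) :=
  Pi.mulSingle k (simpleSwap j)

theorem sigmaCongrRight_mulSingle_swap (k : Fin r) (j j' : Fin (nh.1 k)) :
    Equiv.sigmaCongrRight (Pi.mulSingle k (Equiv.swap j j')) =
      Equiv.swap (⟨k, j⟩ : Σ k, Fin (nh.1 k)) ⟨k, j'⟩ := by
  ext1 ⟨l, m⟩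
  by_cases h : l = k
  · subst h
    simp only [Equiv.sigmaCongrRight_apply, Pi.mulSingle_eq_same]
    rw [Equiv.swap_apply_def, Equiv.swap_apply_def]
    simp only [Sigma.mk.injEq, heq_eq_eq, true_and]
    split_ifs <;> rfl
  · rw [Equiv.swap_apply_of_ne_of_ne (by simp [h]) (by simp [h])]
    simp [Pi.mulSingle_eq_of_ne h]

theorem sigmaCongrRight_blockSwap_trans {i : Fin (n - 1)} {k : Fin r} {j : Fin (nh.1 k - 1)}
    (hlo : α ⟨k, lo j⟩ = lo i) (hhi : α ⟨k, hi j⟩ = hi i) :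
    (Equiv.sigmaCongrRight (blockSwap nh k j)).trans α = α.trans (simpleSwap i) := by
  ext1 a
  rw [blockSwap, simpleSwap, sigmaCongrRight_mulSingle_swap, simpleSwap, ← hlo, ← hhi,
    Equiv.trans_apply, Equiv.trans_apply, Equiv.swap_apply_def, Equiv.swap_apply_def]
  simp only [EmbeddingLike.apply_eq_iff_eq]
  split_ifs <;> rfl

omit [∀ k, AddCommGroup (V k)] in
theorem permute_mulSingle_swap (v : ∀ a : (Σ k, Fin (nh.1 k)), V a.1) (k : Fin r)
    {j j' : Fin (nh.1 k)} :
    permute (Pi.mulSingle k (Equiv.swap j j')) v =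
      Function.update (Function.update v ⟨k, j⟩ (v ⟨k, j'⟩)) ⟨k, j'⟩ (v ⟨k, j⟩) := by
  funext ⟨l, m⟩
  rcases eq_or_ne l k with rfl | hl
  · have hblock : permute (Pi.mulSingle l (Equiv.swap j j')) v ⟨l, m⟩ =
        v ⟨l, Equiv.swap j j' m⟩ := by
      simp only [permute]
      rw [Pi.mulSingle_eq_same]
    rw [hblock]
    rcases eq_or_ne m j' with rfl | hj'
    · rw [Function.update_self, Equiv.swap_apply_right]
    rw [Function.update_of_ne (by simpa using hj')]
    rcases eq_or_ne m j with rfl | hj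
    · rw [Function.update_self, Equiv.swap_apply_left]
    rw [Function.update_of_ne (by simpa using hj), Equiv.swap_apply_of_ne_of_ne hj hj']
  · rw [Function.update_of_ne (by simp [hl]), Function.update_of_ne (by simp [hl]), permute,
      Pi.mulSingle_eq_of_ne hl]
    rfl

/-- The pure tensors as a bilinear function of two of their factors. -/
def twoFactors (v : ∀ a : (Σ k, Fin (nh.1 k)), V a.1) {a a' : Σ k, Fin (nh.1 k)} (h : a ≠ a') :
    V a.1 →ₗ[F] V a'.1 →ₗ[F] VHat F V nh :=
  LinearMap.mk₂ F
    (fun x y => PiTensorProduct.tprod F (Function.update (Function.update v a x) a' y))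
    (fun x x' y => by
      simp only [Function.update_comm h]
      rw [MultilinearMap.map_update_add])
    (fun d x y => by
      simp only [Function.update_comm h]
      rw [MultilinearMap.map_update_smul])
    (fun x y y' => by rw [MultilinearMap.map_update_add])
    (fun d x y => by rw [MultilinearMap.map_update_smul])

theorem labelAct_mulSingle_mul_mulSingle (v : ∀ a : (Σ k, Fin (nh.1 k)), V a.1)
    {a a' : Σ k, Fin (nh.1 k)} (h : a ≠ a') (x y : G) :
    labelAct ρ α (Pi.mulSingle (α a) x * Pi.mulSingle (α a') y) (PiTensorProduct.tprod F v) =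
      twoFactors v h (ρ a.1 x (v a)) (ρ a'.1 y (v a')) := by
  rw [labelAct_tprod, twoFactors, LinearMap.mk₂_apply]
  congr 1
  funext b
  rcases eq_or_ne b a' with rfl | ha'
  · simp [h.symm]
  rcases eq_or_ne b a with rfl | ha
  · simp [h]
  simp [ha, ha']

variable [Fintype G]

/-- The action of `t_{αa, αa'}` on `V(n̂)`. -/
def tAct (i i' : Fin n) : VHat F V nh →ₗ[F] VHat F V nh :=
  ∑ h : G, labelAct ρ α (Pi.mulSingle i h * Pi.mulSingle i' h⁻¹)

variable {ρ} {c : Fin r → F} (hρ : SchurOrthogonality ρ c) [∀ k, FiniteDimensional F (V k)]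

include hρ

theorem tAct_of_colour_ne {i i' : Fin n} (h : colour α i ≠ colour α i') : tAct ρ α i i' = 0 := by
  obtain ⟨a, rfl⟩ := α.surjective i
  obtain ⟨a', rfl⟩ := α.surjective i'
  rw [colour_apply, colour_apply] at h
  have hne : a ≠ a' := fun h' => h (congrArg _ h')
  refine PiTensorProduct.ext (MultilinearMap.ext fun v => ?_)
  simp only [tAct, LinearMap.compMultilinearMap_apply, LinearMap.sum_apply,
    labelAct_mulSingle_mul_mulSingle ρ α v hne]
  exact hρ.sum_bilinear_diff h _ _ _

theorem tAct_of_block (k : Fin r) {j j' : Fin (nh.1 k)} (h : j ≠ j') :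
    tAct ρ α (α ⟨k, j⟩) (α ⟨k, j'⟩) = c k • permV F V (Pi.mulSingle k (Equiv.swap j j')) := by
  have hne : (⟨k, j⟩ : Σ k, Fin (nh.1 k)) ≠ ⟨k, j'⟩ := fun h' => h (by simpa using h')
  refine PiTensorProduct.ext (MultilinearMap.ext fun v => ?_)
  simp only [tAct, LinearMap.compMultilinearMap_apply, LinearMap.sum_apply,
    labelAct_mulSingle_mul_mulSingle ρ α v hne, LinearMap.smul_apply, permV_tprod]
  refine (hρ.sum_bilinear_same (k := k) (twoFactors (a := ⟨k, j⟩) (a' := ⟨k, j'⟩) v hne)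
    (v ⟨k, j⟩) (v ⟨k, j'⟩)).trans ?_
  rw [permute_mulSingle_swap v k, twoFactors, LinearMap.mk₂_apply]

end TensorAction

section Presentation

variable {F : Type u} [Field F] {G : Type u} [Group G] [Fintype G] {n : ℕ}

theorem ofG_mul (g h : Fin n → G) : ofG F (g * h) = ofG F g * ofG F h := by
  simp only [ofG, ← map_mul]
  exact RingQuot.mkAlgHom_rel F (Rel.g_mul g h)

theorem ofG_one : ofG F (1 : Fin n → G) = 1 :=
  (RingQuot.mkAlgHom_rel F Rel.g_one).trans (map_one (toAffine F G n))

theorem x_comm (i j : Fin n) : x F G i * x F G j = x F G j * x F G i := by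
  simp only [x, ← map_mul]
  exact RingQuot.mkAlgHom_rel F (Rel.x_comm i j)

theorem x_mul_ofG (i : Fin n) (a : Fin n → G) : x F G i * ofG F a = ofG F a * x F G i := by
  simp only [x, ofG, ← map_mul]
  exact RingQuot.mkAlgHom_rel F (Rel.x_g i a)

theorem s_coxeter : CoxeterRelations (fun i : Fin (n - 1) => s F G i) where
  sq i := by
    simp only [s, ← map_mul]
    exact (RingQuot.mkAlgHom_rel F (Rel.s_sq i)).trans (map_one _)
  comm i j h := by
    simp only [s, ← map_mul]
    exact RingQuot.mkAlgHom_rel F (Rel.s_comm i j h)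
  braid i j h := by
    simp only [s, ← map_mul]
    exact RingQuot.mkAlgHom_rel F (Rel.braid i j h)

theorem s_mul_x_lo (i : Fin (n - 1)) : s F G i * x F G (lo i) = x F G (hi i) * s F G i -
    ∑ h : G, ofG F (Pi.mulSingle (lo i) h * Pi.mulSingle (hi i) h⁻¹) := by
  simp only [s, x, ofG, ← map_mul, ← map_sum, ← map_sub]
  exact RingQuot.mkAlgHom_rel F (Rel.s_x i)

theorem s_mul_x_far (i : Fin (n - 1)) (j : Fin n) (h₁ : j ≠ lo i) (h₂ : j ≠ hi i) :
    s F G i * x F G j = x F G j * s F G i := by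
  simp only [s, x, ← map_mul]
  exact RingQuot.mkAlgHom_rel F (Rel.s_x_far i j h₁ h₂)

theorem s_mul_ofG (i : Fin (n - 1)) (a : Fin n → G) :
    s F G i * ofG F a = ofG F (fun m => a (simpleSwap i m)) * s F G i := by
  simp only [s, ofG, ← map_mul]
  exact RingQuot.mkAlgHom_rel F (Rel.s_g i a)

theorem Affine.induction {P : Affine F G n → Prop} (algebraMap : ∀ d : F, P (algebraMap F _ d))
    (ofG : ∀ a, P (ofG F a)) (s : ∀ i, P (s F G i)) (x : ∀ i, P (x F G i))
    (mul : ∀ a b, P a → P b → P (a * b)) (add : ∀ a b, P a → P b → P (a + b))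
    (a : Affine F G n) : P a := by
  obtain ⟨a, rfl⟩ := RingQuot.mkAlgHom_surjective F (Rel F G n) a
  change P (toAffine F G n a)
  induction a using FreeAlgebra.induction with
  | grade0 d => rw [AlgHom.commutes]; exact algebraMap d
  | grade1 y =>
    cases y with
    | g a => exact ofG a
    | s i => exact s i
    | x i => exact x i
  | mul a b ha hb => rw [map_mul]; exact mul _ _ ha hb
  | add a b ha hb => rw [map_add]; exact add _ _ ha hb

variable {B : Type*} [Ring B] [Algebra F B]

/-- The defining relations of the wreath Hecke algebra, for elements of an arbitrary algebra. -/
structure AffineRelations (gB : (Fin n → G) → B) (sB : Fin (n - 1) → B) (xB : Fin n → B) :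
    Prop where
  g_one : gB 1 = 1
  g_mul (a b : Fin n → G) : gB (a * b) = gB a * gB b
  x_comm (i j : Fin n) : xB i * xB j = xB j * xB i
  x_g (i : Fin n) (a : Fin n → G) : xB i * gB a = gB a * xB i
  coxeter : CoxeterRelations sB
  s_x (i : Fin (n - 1)) : sB i * xB (lo i) = xB (hi i) * sB i -
    ∑ h : G, gB (Pi.mulSingle (lo i) h * Pi.mulSingle (hi i) h⁻¹)
  s_x_far (i : Fin (n - 1)) (j : Fin n) (h₁ : j ≠ lo i) (h₂ : j ≠ hi i) :
    sB i * xB j = xB j * sB i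
  s_g (i : Fin (n - 1)) (a : Fin n → G) : sB i * gB a = gB (fun m => a (simpleSwap i m)) * sB i

variable {gB : (Fin n → G) → B} {sB : Fin (n - 1) → B} {xB : Fin n → B}

/-- The function on the generators with the given values on the elements of `G^n`, the `s_i` and
the `x_i`. -/
def Gen.elim (gB : (Fin n → G) → B) (sB : Fin (n - 1) → B) (xB : Fin n → B) : Gen G n → B
  | .g a => gB a
  | .s i => sB i
  | .x i => xB i

variable (F) in
/-- The homomorphism from the wreath Hecke algebra given by elements which satisfy the defining
relations. -/
def liftAffine (h : AffineRelations gB sB xB) : Affine F G n →ₐ[F] B :=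
  RingQuot.liftAlgHom F ⟨FreeAlgebra.lift F (Gen.elim gB sB xB), by
    have hg : ∀ a, FreeAlgebra.lift F (Gen.elim gB sB xB) (fg F a) = gB a :=
      fun a => FreeAlgebra.lift_ι_apply _ _
    have hs : ∀ i, FreeAlgebra.lift F (Gen.elim gB sB xB) (fs F G i) = sB i :=
      fun i => FreeAlgebra.lift_ι_apply _ _
    have hx : ∀ i, FreeAlgebra.lift F (Gen.elim gB sB xB) (fx F G i) = xB i :=
      fun i => FreeAlgebra.lift_ι_apply _ _
    intro a b hab
    cases hab with
    | g_one => simp only [hg, map_one, h.g_one]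
    | g_mul a b => simp only [map_mul, hg, h.g_mul]
    | x_comm i j => simp only [map_mul, hx, h.x_comm i j]
    | x_g i a => simp only [map_mul, hx, hg, h.x_g i a]
    | s_sq i => simp only [map_mul, hs, map_one, h.coxeter.sq]
    | s_comm i j hij => simp only [map_mul, hs, h.coxeter.comm i j hij]
    | braid i j hij => simp only [map_mul, hs, h.coxeter.braid i j hij]
    | s_x i => simp only [map_mul, map_sub, ft, map_sum, hs, hx, hg, h.s_x]
    | s_x_far i j h₁ h₂ => simp only [map_mul, hs, hx, h.s_x_far i j h₁ h₂]
    | s_g i a =>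
      simp only [map_mul, hs, hg]
      exact h.s_g i a⟩

theorem liftAffine_toAffine (h : AffineRelations gB sB xB) (a : FreeAlgebra F (Gen G n)) :
    liftAffine F h (toAffine F G n a) = FreeAlgebra.lift F (Gen.elim gB sB xB) a :=
  RingQuot.liftAlgHom_mkAlgHom_apply _ _ _ _

@[simp] theorem liftAffine_ofG (h : AffineRelations gB sB xB) (a : Fin n → G) :
    liftAffine F h (ofG F a) = gB a :=
  (liftAffine_toAffine h _).trans (FreeAlgebra.lift_ι_apply _ _)

@[simp] theorem liftAffine_s (h : AffineRelations gB sB xB) (i : Fin (n - 1)) :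
    liftAffine F h (s F G i) = sB i :=
  (liftAffine_toAffine h _).trans (FreeAlgebra.lift_ι_apply _ _)

@[simp] theorem liftAffine_x (h : AffineRelations gB sB xB) (i : Fin n) :
    liftAffine F h (x F G i) = xB i :=
  (liftAffine_toAffine h _).trans (FreeAlgebra.lift_ι_apply _ _)

theorem Affine.commute_of_generators (f : Affine F G n →ₐ[F] B) {b : B}
    (hg : ∀ a, Commute (f (ofG F a)) b) (hs : ∀ i, Commute (f (s F G i)) b)
    (hx : ∀ i, Commute (f (x F G i)) b) (a : Affine F G n) : Commute (f a) b := by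
  induction a using Affine.induction with
  | algebraMap d => rw [AlgHom.commutes]; exact Algebra.commutes d b
  | ofG a => exact hg a
  | s i => exact hs i
  | x i => exact hx i
  | mul a b ha hb => rw [map_mul]; exact ha.mul_left hb
  | add a b ha hb => rw [map_add]; exact ha.add_left hb

theorem Affine.smul_comm_of_generators {M N : Type*} [AddCommGroup M] [AddCommGroup N]
    [Module F M] [Module F N] [Module (Affine F G n) M] [Module (Affine F G n) N]
    [IsScalarTower F (Affine F G n) M] [IsScalarTower F (Affine F G n) N] (f : M →ₗ[F] N)
    (hg : ∀ (a : Fin n → G) m, f (ofG F a • m) = ofG F a • f m)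
    (hs : ∀ (i : Fin (n - 1)) m, f (s F G i • m) = s F G i • f m)
    (hx : ∀ (i : Fin n) m, f (x F G i • m) = x F G i • f m) (a : Affine F G n) (m : M) :
    f (a • m) = a • f m := by
  induction a using Affine.induction generalizing m with
  | algebraMap d => rw [algebraMap_smul, algebraMap_smul, map_smul]
  | ofG a => exact hg a m
  | s i => exact hs i m
  | x i => exact hx i m
  | mul a b ha hb => rw [mul_smul, ha, hb, mul_smul]
  | add a b ha hb => rw [add_smul, map_add, ha, hb, add_smul]

end Presentation

section TensorLift

theorem prod_ofFn_mul {C : Type*} [Monoid C] {r : ℕ} (a b : Fin r → C)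
    (h : ∀ k l, k ≠ l → Commute (a k) (b l)) :
    (List.ofFn fun k => a k * b k).prod = (List.ofFn a).prod * (List.ofFn b).prod := by
  induction r with
  | zero => simp
  | succ r ih =>
    simp only [List.ofFn_succ, List.prod_cons]
    rw [ih _ _ fun k l hkl => h _ _ fun h' => hkl (Fin.succ_injective _ h')]
    have hcomm : Commute (b 0) (List.ofFn fun i => a (Fin.succ i)).prod := by
      refine Commute.list_prod_right _ _ fun y hy => ?_
      obtain ⟨i, rfl⟩ := (List.mem_ofFn' _ _).1 hy
      exact (h _ _ (Fin.succ_ne_zero i)).symm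
    rw [mul_assoc, mul_assoc, ← mul_assoc (b 0), hcomm.eq, mul_assoc]

theorem prod_ofFn_eq_of_forall_ne {C : Type*} [Monoid C] {r : ℕ} (a : Fin r → C) (k : Fin r)
    (h : ∀ l, l ≠ k → a l = 1) : (List.ofFn a).prod = a k := by
  induction r with
  | zero => exact k.elim0
  | succ r ih =>
    simp only [List.ofFn_succ, List.prod_cons]
    cases k using Fin.cases with
    | zero =>
      rw [List.prod_eq_one, mul_one]
      intro y hy
      obtain ⟨i, rfl⟩ := (List.mem_ofFn' _ _).1 hy
      exact h _ (Fin.succ_ne_zero i)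
    | succ k =>
      rw [h 0 (Fin.succ_ne_zero k).symm, one_mul,
        ih _ k fun l hl => h _ fun h' => hl (Fin.succ_injective _ h')]

variable {F : Type u} [Field F] {r : ℕ} {B : Fin r → Type u} [∀ k, Ring (B k)]
  [∀ k, Algebra F (B k)] {C : Type*} [Ring C] [Algebra F C]

/-- The homomorphism from a tensor product of algebras defined by homomorphisms of the factors
whose images commute. -/
def liftCommuting (f : ∀ k, B k →ₐ[F] C)
    (h : ∀ k l, k ≠ l → ∀ a b, Commute (f k a) (f l b)) : (⨂[F] k, B k) →ₐ[F] C :=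
  PiTensorProduct.liftAlgHom
    ((MultilinearMap.mkPiAlgebraFin F r C).compLinearMap fun k => (f k).toLinearMap)
    (by
      rw [MultilinearMap.compLinearMap_apply, MultilinearMap.mkPiAlgebraFin_apply]
      simp)
    (by
      intro a b
      simp only [MultilinearMap.compLinearMap_apply, MultilinearMap.mkPiAlgebraFin_apply,
        Pi.mul_apply, AlgHom.toLinearMap_apply, map_mul]
      exact prod_ofFn_mul _ _ fun k l hkl => h k l hkl _ _)

@[simp] theorem liftCommuting_single (f : ∀ k, B k →ₐ[F] C)
    (h : ∀ k l, k ≠ l → ∀ a b, Commute (f k a) (f l b)) (k : Fin r) (a : B k) :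
    liftCommuting f h (PiTensorProduct.singleAlgHom k a) = f k a := by
  rw [liftCommuting, PiTensorProduct.singleAlgHom_apply, PiTensorProduct.liftAlgHom_apply,
    PiTensorProduct.lift.tprod, MultilinearMap.compLinearMap_apply,
    MultilinearMap.mkPiAlgebraFin_apply, prod_ofFn_eq_of_forall_ne _ k]
  · simp
  · intro l hl
    simp [Pi.mulSingle_eq_of_ne hl]

theorem commute_single {k l : Fin r} (h : k ≠ l) (a : B k) (b : B l) :
    Commute (PiTensorProduct.singleAlgHom (R := F) (A := B) k a)
      (PiTensorProduct.singleAlgHom (R := F) (A := B) l b) := by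
  simp only [PiTensorProduct.singleAlgHom_apply]
  exact Commute.tprod (Pi.mulSingle_commute h a b)

end TensorLift

section MatrixUnits

variable {F : Type u} [Field F] {G : Type u} [Group G] {r n : ℕ} {V : Fin r → Type u}
  [∀ k, AddCommGroup (V k)] [∀ k, Module F (V k)]

variable (F V) in
/-- The index set of the standard basis of `V(n̂)`. -/
abbrev HatIndex (nh : Comp r n) : Type :=
  ∀ a : (Σ k, Fin (nh.1 k)), Fin (Module.finrank F (V a.1))

variable [∀ k, FiniteDimensional F (V k)]

variable (F V) in
/-- The basis of `V(n̂)` formed by the pure tensors of basis vectors. -/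
def hatBasis (nh : Comp r n) : Module.Basis (HatIndex F V nh) F (VHat F V nh) :=
  Basis.piTensorProduct fun a => Module.finBasis F (V a.1)

instance (nh : Comp r n) : Module.Finite F (VHat F V nh) :=
  Module.Finite.of_basis (hatBasis F V nh)

theorem hatBasis_apply (nh : Comp r n) (q : HatIndex F V nh) :
    hatBasis F V nh q = PiTensorProduct.tprod F fun a => Module.finBasis F (V a.1) (q a) :=
  Basis.piTensorProduct_apply _ _

theorem hatBasis_coord_tprod (nh : Comp r n) (q : HatIndex F V nh)
    (v : ∀ a : (Σ k, Fin (nh.1 k)), V a.1) :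
    (hatBasis F V nh).coord q (PiTensorProduct.tprod F v) =
      ∏ a, (Module.finBasis F (V a.1)).coord (q a) (v a) := by
  simp [hatBasis]

variable (ρ : ∀ k, Representation F G (V k)) {nh nh' : Comp r n}
  (α : (Σ k, Fin (nh.1 k)) ≃ Fin n) (β : (Σ k, Fin (nh'.1 k)) ≃ Fin n)

theorem trace_labelAct (g : Fin n → G) :
    LinearMap.trace F _ (labelAct ρ α g) =
      ∏ a, LinearMap.trace F _ (ρ (Sigma.fst a) (g (α a))) := by
  classical
  simp only [LinearMap.trace_eq_matrix_trace F (hatBasis F V nh),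
    LinearMap.trace_eq_matrix_trace F (Module.finBasis F (V _)), Matrix.trace, Matrix.diag_apply,
    LinearMap.toMatrix_apply, ← Module.Basis.coord_apply]
  rw [Fintype.prod_sum]
  simp only [hatBasis_apply, labelAct_tprod, hatBasis_coord_tprod]

theorem sum_coord_labelAct_hatBasis (g : Fin n → G) :
    ∑ q, (hatBasis F V nh).coord q (labelAct ρ α g (hatBasis F V nh q)) =
      LinearMap.trace F _ (labelAct ρ α g) := by
  classical
  simp only [LinearMap.trace_eq_matrix_trace F (hatBasis F V nh), Matrix.trace,
    Matrix.diag_apply, LinearMap.toMatrix_apply, Module.Basis.coord_apply]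

section Orthogonality

variable [Fintype G]

theorem sum_coord_smul_labelAct_tprod (q : HatIndex F V nh)
    (v : ∀ a : (Σ k, Fin (nh.1 k)), V a.1) (u : ∀ a : (Σ k, Fin (nh'.1 k)), V a.1) :
    ∑ g : Fin n → G, (hatBasis F V nh).coord q (labelAct ρ α g⁻¹ (PiTensorProduct.tprod F v)) •
        labelAct ρ β g (PiTensorProduct.tprod F u) =
      PiTensorProduct.tprod F fun b => ∑ h : G,
        (Module.finBasis F (V (α.symm (β b)).1)).coord (q (α.symm (β b)))
          (ρ (α.symm (β b)).1 h⁻¹ (v (α.symm (β b)))) • ρ b.1 h (u b) := by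
  classical
  rw [MultilinearMap.map_sum]
  refine Fintype.sum_equiv (Equiv.arrowCongr β.symm (Equiv.refl G)) _ _ fun g => ?_
  rw [MultilinearMap.map_smul_univ, labelAct_tprod, labelAct_tprod, hatBasis_coord_tprod]
  congr 1
  let ξ : (Σ k, Fin (nh.1 k)) → G → F := fun a h =>
    (Module.finBasis F (V a.1)).coord (q a) (ρ a.1 h⁻¹ (v a))
  refine Fintype.prod_equiv (α.trans β.symm) _ _ fun a => ?_
  change ξ a (g (α a)) = ξ (α.symm (β (β.symm (α a)))) (g (β (β.symm (α a))))
  rw [Equiv.apply_symm_apply, Equiv.symm_apply_apply]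

theorem sum_coord_smul_labelAct_eq (q : HatIndex F V nh)
    (L : VHat F V nh →ₗ[F] VHat F V nh' →ₗ[F] VHat F V nh')
    (hL : ∀ v u, ∑ g : Fin n → G,
      (hatBasis F V nh).coord q (labelAct ρ α g⁻¹ (PiTensorProduct.tprod F v)) •
        labelAct ρ β g (PiTensorProduct.tprod F u) =
        L (PiTensorProduct.tprod F v) (PiTensorProduct.tprod F u))
    (v : VHat F V nh) (u : VHat F V nh') :
    ∑ g : Fin n → G, (hatBasis F V nh).coord q (labelAct ρ α g⁻¹ v) • labelAct ρ β g u =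
      L v u := by
  have heq : ∑ g : Fin n → G,
      ((hatBasis F V nh).coord q ∘ₗ labelAct ρ α g⁻¹).smulRight (labelAct ρ β g) = L := by
    refine PiTensorProduct.ext (MultilinearMap.ext fun v =>
      PiTensorProduct.ext (MultilinearMap.ext fun u => ?_))
    simpa [LinearMap.sum_apply] using hL v u
  simp [← heq, LinearMap.sum_apply]

variable {ρ} {c : Fin r → F} (hρ : SchurOrthogonality ρ c)

include hρ

theorem sum_coord_smul_labelAct_same (q : HatIndex F V nh) (v u : VHat F V nh) :
    ∑ g : Fin n → G, (hatBasis F V nh).coord q (labelAct ρ α g⁻¹ v) • labelAct ρ α g u =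
      (∏ a : (Σ k, Fin (nh.1 k)), c a.1) • (hatBasis F V nh).coord q u • v := by
  refine sum_coord_smul_labelAct_eq ρ α α q ((∏ a : (Σ k, Fin (nh.1 k)), c a.1) •
    ((LinearMap.lsmul F (VHat F V nh)).comp ((hatBasis F V nh).coord q)).flip) (fun v u => ?_) v u
  have hfactor : ∀ b a : Σ k, Fin (nh.1 k), a = b → ∑ h : G,
      (Module.finBasis F (V a.1)).coord (q a) (ρ a.1 h⁻¹ (v a)) • ρ b.1 h (u b) =
        c b.1 • (Module.finBasis F (V b.1)).coord (q b) (u b) • v b := by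
    rintro b _ rfl
    exact hρ.same _ _ _ _
  rw [sum_coord_smul_labelAct_tprod,
    funext fun b => hfactor b _ (α.symm_apply_apply b),
    MultilinearMap.map_smul_univ, MultilinearMap.map_smul_univ, ← hatBasis_coord_tprod]
  rfl

theorem sum_coord_smul_labelAct_of_colour_ne (h : colour α ≠ colour β) (q : HatIndex F V nh)
    (v : VHat F V nh) (u : VHat F V nh') :
    ∑ g : Fin n → G, (hatBasis F V nh).coord q (labelAct ρ α g⁻¹ v) • labelAct ρ β g u = 0 := by
  refine sum_coord_smul_labelAct_eq ρ α β q 0 (fun v u => ?_) v u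
  obtain ⟨i, hi⟩ := Function.ne_iff.1 h
  rw [sum_coord_smul_labelAct_tprod]
  refine MultilinearMap.map_coord_zero _ (β.symm i) (hρ.diff _ _ (fun hk => hi ?_) _ _ _)
  rw [colour, colour, hk, Equiv.apply_symm_apply]

end Orthogonality

variable [Fintype G]

variable (c : Fin r → F)

/-- The element of the group algebra of `G^n`, inside the wreath Hecke algebra, that acts on
`V(n̂)`, labelled by `α`, as the rank one operator `u ↦ u_q • v`; it is given by the inversion
formula for the matrix coefficients of `V(n̂)`. -/
def matUnit (q : HatIndex F V nh) : VHat F V nh →ₗ[F] Affine F G n :=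
  (∏ a : (Σ k, Fin (nh.1 k)), c a.1)⁻¹ •
    ∑ g : Fin n → G, ((hatBasis F V nh).coord q ∘ₗ labelAct ρ α g⁻¹).smulRight (ofG F g)

theorem matUnit_apply (q : HatIndex F V nh) (v : VHat F V nh) :
    matUnit ρ α c q v = (∏ a : (Σ k, Fin (nh.1 k)), c a.1)⁻¹ •
      ∑ g : Fin n → G, (hatBasis F V nh).coord q (labelAct ρ α g⁻¹ v) • ofG F g := by
  simp [matUnit, LinearMap.sum_apply]

theorem ofG_mul_matUnit (h : Fin n → G) (q : HatIndex F V nh) (v : VHat F V nh) :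
    ofG F h * matUnit ρ α c q v = matUnit ρ α c q (labelAct ρ α h v) := by
  rw [matUnit_apply, matUnit_apply, mul_smul_comm, Finset.mul_sum]
  congr 1
  refine Fintype.sum_equiv (Equiv.mulLeft h) _ _ fun g => ?_
  rw [mul_smul_comm, ← ofG_mul, Equiv.coe_mulLeft, mul_inv_rev, labelAct_mul,
    Module.End.mul_apply, ← Module.End.mul_apply (labelAct ρ α h⁻¹), ← labelAct_mul,
    inv_mul_cancel, labelAct_one, Module.End.one_apply]

theorem sum_matUnit_hatBasis :
    ∑ q : HatIndex F V nh, matUnit ρ α c q (hatBasis F V nh q) =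
      ∑ g : Fin n → G, (∏ i, (c (colour α i))⁻¹ *
        LinearMap.trace F _ (ρ (colour α i) (g i)⁻¹)) • ofG F g := by
  have htrace : ∀ g : Fin n → G, (∏ a : (Σ k, Fin (nh.1 k)), c a.1)⁻¹ *
      LinearMap.trace F _ (labelAct ρ α g⁻¹) =
      ∏ i, (c (colour α i))⁻¹ * LinearMap.trace F _ (ρ (colour α i) (g i)⁻¹) := fun g => by
    rw [trace_labelAct, ← Finset.prod_inv_distrib, ← Finset.prod_mul_distrib]
    refine Fintype.prod_equiv α _ _ fun a => ?_
    rw [colour_apply, Pi.inv_apply]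
  simp only [matUnit_apply, ← Finset.smul_sum]
  rw [Finset.sum_comm, Finset.smul_sum]
  refine Finset.sum_congr rfl fun g _ => ?_
  rw [← Finset.sum_smul, sum_coord_labelAct_hatBasis, smul_smul, htrace]

variable {ρ c} (hρ : SchurRelations ρ c)

include hρ

omit [∀ k, FiniteDimensional F (V k)] in
theorem sum_prod_trace [DecidableEq G] (g : Fin n → G) :
    ∑ f : Fin n → Fin r, ∏ i, (c (f i))⁻¹ * LinearMap.trace F _ (ρ (f i) (g i)⁻¹) =
      if g = 1 then 1 else 0 := by
  rw [← Fintype.prod_sum fun i k => (c k)⁻¹ * LinearMap.trace F _ (ρ k (g i)⁻¹)]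
  simp only [hρ.regular, inv_eq_one]
  rw [Fintype.prod_ite_zero]
  simp [funext_iff]

/-- The traces over all labels add up to the coefficient of `1` in the regular character. -/
theorem sum_matUnit_eq_one :
    ∑ x : Label r n, ∑ q : HatIndex F V x.1, matUnit ρ x.2.1 c q (hatBasis F V x.1 q) = 1 := by
  classical
  have hlabel : ∀ g : Fin n → G, ∑ x : Label r n, ∏ i, (c (colour x.2.1 i))⁻¹ *
      LinearMap.trace F _ (ρ (colour x.2.1 i) (g i)⁻¹) = if g = 1 then 1 else 0 := fun g =>
    (Fintype.sum_equiv labelEquiv _ (fun f => ∏ i, (c (f i))⁻¹ *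
      LinearMap.trace F _ (ρ (f i) (g i)⁻¹)) fun _ => rfl).trans (sum_prod_trace hρ g)
  simp only [sum_matUnit_hatBasis]
  rw [Finset.sum_comm]
  simp only [← Finset.sum_smul, hlabel, ite_smul, one_smul, zero_smul, Finset.sum_ite_eq',
    Finset.mem_univ, if_true, ofG_one]

end MatrixUnits

section Equivariant

variable {F : Type u} [Field F] {G : Type u} [Group G] [Fintype G] {r n : ℕ}
  {V : Fin r → Type u} [∀ k, AddCommGroup (V k)] [∀ k, Module F (V k)]
  (ρ : ∀ k, Representation F G (V k)) {nh nh' : Comp r n} {α : (Σ k, Fin (nh.1 k)) ≃ Fin n}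
  {β : (Σ k, Fin (nh'.1 k)) ≃ Fin n}
  {M : Type u} [AddCommGroup M] [Module F M] [Module (Affine F G n) M]

/-- The linear map `φ : V(n̂) → M` is `G^n`-equivariant when the factors of `G^n` act on `V(n̂)`
through the labelling `α`. The labelling `place` gives the maps of the functor; the others arise
from these by the action of `S_n` on `M`. -/
def LabelEquivariant (α : (Σ k, Fin (nh.1 k)) ≃ Fin n)
    (φ : VHat F V nh →ₗ[F] M) : Prop :=
  ∀ (g : Fin n → G) (v : VHat F V nh), φ (labelAct ρ α g v) = ofG F g • φ v

variable [IsScalarTower F (Affine F G n) M]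

variable (F G M n) in
/-- The operator by which an element of the wreath Hecke algebra acts. -/
abbrev actOn : Affine F G n →ₐ[F] Module.End F M := Algebra.lsmul F F M


section

variable {ρ} {φ : VHat F V nh →ₗ[F] M} (hφ : LabelEquivariant ρ α φ)

include hφ

theorem LabelEquivariant.s_smul (i : Fin (n - 1)) :
    LabelEquivariant ρ (α.trans (simpleSwap i)) (actOn F G n M (s F G i) ∘ₗ φ) := fun g v => by
  rw [labelAct_trans]
  change s F G i • φ _ = ofG F g • s F G i • φ v
  rw [hφ, ← mul_smul, s_mul_ofG, mul_smul]
  simp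

theorem LabelEquivariant.x_smul (i : Fin n) :
    LabelEquivariant ρ α (actOn F G n M (x F G i) ∘ₗ φ) := fun g v => by
  change x F G i • φ _ = ofG F g • x F G i • φ v
  rw [hφ, ← mul_smul, x_mul_ofG, mul_smul]

omit [IsScalarTower F (Affine F G n) M] in
theorem LabelEquivariant.t_smul (i i' : Fin n) (v : VHat F V nh) :
    (∑ h : G, ofG F (Pi.mulSingle i h * Pi.mulSingle i' h⁻¹ : Fin n → G)) • φ v =
        φ (tAct ρ α i i' v) := by
  rw [Finset.sum_smul, tAct, LinearMap.sum_apply, map_sum]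
  exact Finset.sum_congr rfl fun h _ => (hφ _ _).symm

end

variable [∀ k, FiniteDimensional F (V k)] (c : Fin r → F)

/-- The equivariant map `V(n̂) → M` obtained from the vector `m` by the matrix units with
coordinate `q`. -/
def matUnitHom (α : (Σ k, Fin (nh.1 k)) ≃ Fin n) (q : HatIndex F V nh) (m : M) :
    VHat F V nh →ₗ[F] M :=
  { toFun := fun v => matUnit ρ α c q v • m
    map_add' := fun v w => by rw [map_add, add_smul]
    map_smul' := fun d v => by rw [map_smul, RingHom.id_apply, smul_assoc] }

theorem matUnitHom_equivariant (q : HatIndex F V nh) (m : M) :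
    LabelEquivariant ρ α (matUnitHom ρ c α q m) := fun g v => by
  change matUnit ρ α c q _ • m = ofG F g • matUnit ρ α c q v • m
  rw [← mul_smul, ofG_mul_matUnit]

variable {ρ c} (hρ : SchurOrthogonality ρ c)

include hρ

theorem matUnit_smul_same {φ : VHat F V nh →ₗ[F] M} (hφ : LabelEquivariant ρ α φ)
    (q : HatIndex F V nh) (v u : VHat F V nh) :
    matUnit ρ α c q v • φ u = (hatBasis F V nh).coord q u • φ v := by
  have hprod : (∏ a : (Σ k, Fin (nh.1 k)), c a.1) ≠ 0 :=
    Finset.prod_ne_zero_iff.2 fun a _ => hρ.ne_zero a.1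
  have hsum := congrArg φ (sum_coord_smul_labelAct_same α hρ q v u)
  rw [map_sum, map_smul, map_smul] at hsum
  rw [matUnit_apply, smul_assoc, Finset.sum_smul, inv_smul_eq_iff₀ hprod, ← hsum]
  refine Finset.sum_congr rfl fun g _ => ?_
  rw [map_smul, hφ, smul_assoc]

theorem matUnit_smul_of_colour_ne {φ : VHat F V nh' →ₗ[F] M} (hφ : LabelEquivariant ρ β φ)
    (h : colour α ≠ colour β) (q : HatIndex F V nh) (v : VHat F V nh) (u : VHat F V nh') :
    matUnit ρ α c q v • φ u = 0 := by
  have hsum := congrArg φ (sum_coord_smul_labelAct_of_colour_ne α β hρ h q v u)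
  rw [map_sum, map_zero] at hsum
  rw [matUnit_apply, smul_assoc, Finset.sum_smul]
  refine (congrArg _ ?_).trans (smul_zero _)
  rw [← hsum]
  refine Finset.sum_congr rfl fun g _ => ?_
  rw [map_smul, hφ, smul_assoc]

omit [IsScalarTower F (Affine F G n) M] in
theorem LabelEquivariant.s_smul_x_lo_smul {φ : VHat F V nh →ₗ[F] M}
    (hφ : LabelEquivariant ρ α φ) {i : Fin (n - 1)} (hm : Mixed α i) (v : VHat F V nh) :
    s F G i • x F G (lo i) • φ v = x F G (hi i) • s F G i • φ v := by
  rw [← mul_smul, s_mul_x_lo, sub_smul, hφ.t_smul, tAct_of_colour_ne α hρ hm, mul_smul,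
    LinearMap.zero_apply, map_zero, sub_zero]

theorem LabelEquivariant.s_smul_x_hi_smul {φ : VHat F V nh →ₗ[F] M}
    (hφ : LabelEquivariant ρ α φ) {i : Fin (n - 1)} (hm : Mixed α i) (v : VHat F V nh) :
    s F G i • x F G (hi i) • φ v = x F G (lo i) • s F G i • φ v := by
  have hs : ∀ m : M, s F G i • s F G i • m = m := fun m => by
    rw [← mul_smul, s_coxeter.sq, one_smul]
  have hlo : s F G i • x F G (lo i) • s F G i • φ v =
      x F G (hi i) • s F G i • s F G i • φ v := (hφ.s_smul i).s_smul_x_lo_smul hρ (mixed_swap hm) v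
  rw [hs] at hlo
  rw [← hlo, hs]

theorem LabelEquivariant.s_smul_x_smul {φ : VHat F V nh →ₗ[F] M} (hφ : LabelEquivariant ρ α φ)
    {i : Fin (n - 1)} (hm : Mixed α i) (b : Fin n) (v : VHat F V nh) :
    s F G i • x F G b • φ v = x F G (simpleSwap i b) • s F G i • φ v := by
  rcases eq_or_ne b (lo i) with rfl | hlo
  · rw [simpleSwap_lo, hφ.s_smul_x_lo_smul hρ hm]
  rcases eq_or_ne b (hi i) with rfl | hhi
  · rw [simpleSwap_hi, hφ.s_smul_x_hi_smul hρ hm]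
  rw [simpleSwap_of_ne hlo hhi, ← mul_smul, s_mul_x_far i b hlo hhi, mul_smul]

theorem LabelEquivariant.injective_or_eq_zero {φ : VHat F V nh →ₗ[F] M}
    (hφ : LabelEquivariant ρ α φ) : Function.Injective φ ∨ φ = 0 := by
  refine or_iff_not_imp_left.2 fun h => ?_
  rw [← LinearMap.ker_eq_bot, Submodule.eq_bot_iff] at h
  push Not at h
  obtain ⟨w, hw, hw0⟩ := h
  obtain ⟨q, hq⟩ : ∃ q, (hatBasis F V nh).coord q w ≠ 0 := by
    by_contra! hcoord
    exact hw0 ((hatBasis F V nh).forall_coord_eq_zero_iff.1 hcoord)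
  refine LinearMap.ext fun v => ?_
  have hv := matUnit_smul_same hρ hφ q v w
  rw [LinearMap.mem_ker.1 hw, smul_zero] at hv
  exact (smul_eq_zero.1 hv.symm).resolve_left hq

/-- `V(n̂)` is simple, so the condition on the image in the definition of the functor is
automatic. -/
theorem mem_homHat_iff (φ : VHat F V nh →ₗ[F] M) :
    φ ∈ HomHat ρ M nh ↔ LabelEquivariant ρ (place nh) φ := by
  refine ⟨fun h => h.1, fun h => ⟨h, fun v => ?_⟩⟩
  rcases h.injective_or_eq_zero hρ with hinj | rfl
  · have hrange : LinearMap.range φ ≤ isotypical ρ M nh := le_sSup ⟨φ, h, hinj, rfl⟩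
    exact hrange (LinearMap.mem_range_self φ v)
  · exact Submodule.zero_mem _

end Equivariant

section Places

variable {r n : ℕ} (nh : Comp r n)

theorem place_val (k : Fin r) (j : Fin (nh.1 k)) :
    (place nh ⟨k, j⟩ : ℕ) = (∑ i : Fin k, nh.1 (Fin.castLE k.2.le i)) + j := by
  simp [place, finSigmaFinEquiv_apply]

theorem simplePlace_far {k : Fin r} {j j' : Fin (nh.1 k - 1)}
    (h : j.1 + 1 < j'.1 ∨ j'.1 + 1 < j.1) :
    (simplePlace nh k j).1 + 1 < (simplePlace nh k j').1 ∨
      (simplePlace nh k j').1 + 1 < (simplePlace nh k j).1 := by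
  simp only [simplePlace, place_val, lo]
  omega

theorem simplePlace_succ {k : Fin r} {j j' : Fin (nh.1 k - 1)} (h : j.1 + 1 = j'.1) :
    (simplePlace nh k j).1 + 1 = (simplePlace nh k j').1 := by
  simp only [simplePlace, place_val, lo]
  omega

theorem place_ne_of_ne {k k' : Fin r} (h : k ≠ k') (j : Fin (nh.1 k)) (j' : Fin (nh.1 k')) :
    place nh ⟨k, j⟩ ≠ place nh ⟨k', j'⟩ := fun e =>
  h (congrArg Sigma.fst ((place nh).injective e))

theorem simplePlace_far_of_ne {k k' : Fin r} (h : k ≠ k') (j : Fin (nh.1 k - 1))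
    (j' : Fin (nh.1 k' - 1)) :
    (simplePlace nh k j).1 + 1 < (simplePlace nh k' j').1 ∨
      (simplePlace nh k' j').1 + 1 < (simplePlace nh k j).1 := by
  have hne : ∀ a b, (place nh ⟨k, a⟩).1 ≠ (place nh ⟨k', b⟩).1 := fun a b =>
    Fin.val_ne_of_ne (place_ne_of_ne nh h a b)
  have hlo := hne (lo j) (lo j')
  have hhilo := hne (hi j) (lo j')
  have hlohi := hne (lo j) (hi j')
  rw [place_hi] at hhilo hlohi
  simp only [simplePlace]
  omega

end Places

section YoungAction

variable {F : Type u} [Field F] {r n : ℕ} {V : Fin r → Type u} [∀ k, AddCommGroup (V k)]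
  [∀ k, Module F (V k)] (nh : Comp r n)

theorem blockSwap_mul (k : Fin r) (j j' : Fin (nh.1 k - 1)) :
    blockSwap nh k j * blockSwap nh k j' =
      Pi.mulSingle (M := fun k => Equiv.Perm (Fin (nh.1 k))) k (simpleSwap j * simpleSwap j') :=
  (Pi.mulSingle_mul (f := fun k => Equiv.Perm (Fin (nh.1 k))) k _ _).symm

theorem permV_coxeter (k : Fin r) :
    CoxeterRelations fun j : Fin (nh.1 k - 1) => permV F V (blockSwap nh k j) where
  sq j := by
    rw [permV_mul, blockSwap_mul, simpleSwap_mul_self, Pi.mulSingle_one, permV_one]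
  comm i j h := by
    rw [permV_mul, permV_mul, blockSwap_mul, blockSwap_mul, simpleSwap_mul_comm h]
  braid i j h := by
    simp only [permV_mul, blockSwap]
    simp only [← Pi.mulSingle_mul, ← mul_assoc]
    rw [simpleSwap_braid h]

theorem permV_comm_of_ne {k k' : Fin r} (h : k ≠ k') (j : Fin (nh.1 k - 1))
    (j' : Fin (nh.1 k' - 1)) : permV F V (blockSwap nh k j) * permV F V (blockSwap nh k' j') =
      permV F V (blockSwap nh k' j') * permV F V (blockSwap nh k j) := by
  rw [permV_mul, permV_mul]
  exact congrArg _ (Pi.mulSingle_commute (f := fun k => Equiv.Perm (Fin (nh.1 k))) h.symm _ _)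

end YoungAction

section BlockAction

variable {F : Type u} [Field F] {G : Type u} [Group G] [Fintype G] {r n : ℕ}
  {V : Fin r → Type u} [∀ k, AddCommGroup (V k)] [∀ k, Module F (V k)]
  [∀ k, FiniteDimensional F (V k)]
  {ρ : ∀ k, Representation F G (V k)} {c : Fin r → F} (hρ : SchurOrthogonality ρ c)
  (M : Type u) [AddCommGroup M] [Module F M] [Module (Affine F G n) M]
  [IsScalarTower F (Affine F G n) M] (nh : Comp r n)

omit [∀ k, FiniteDimensional F (V k)] in
theorem LabelEquivariant.s_smul_permV {φ : VHat F V nh →ₗ[F] M}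
    (hφ : LabelEquivariant ρ (place nh) φ) (k : Fin r) (j : Fin (nh.1 k - 1)) :
    LabelEquivariant ρ (place nh)
      (actOn F G n M (s F G (simplePlace nh k j)) ∘ₗ φ ∘ₗ permV F V (blockSwap nh k j)) := by
  intro g v
  rw [← LinearMap.comp_assoc, LinearMap.comp_apply _ (permV F V _), LinearMap.comp_apply _
    (permV F V _), permV_labelAct,
    sigmaCongrRight_blockSwap_trans (place nh) (place_lo_eq nh k j) (place_hi_eq nh k j)]
  exact hφ.s_smul _ g _

/-- The action `φ ↦ s φ(s ·)` of the simple transpositions of the Young subgroup on the space of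
homomorphisms. -/
def homS (k : Fin r) (j : Fin (nh.1 k - 1)) : Module.End F (HomHat ρ M nh) :=
  LinearMap.restrict
    (LinearMap.compRight F (actOn F G n M (s F G (simplePlace nh k j))) ∘ₗ
      LinearMap.lcomp F M (permV F V (blockSwap nh k j)))
    fun φ hφ => (mem_homHat_iff hρ _).2
      (((mem_homHat_iff hρ φ).1 hφ).s_smul_permV M nh k j)

theorem homS_apply (k : Fin r) (j : Fin (nh.1 k - 1)) (φ : HomHat ρ M nh) (v : VHat F V nh) :
    (homS hρ M nh k j φ).1 v =
      s F G (simplePlace nh k j) • φ.1 (permV F V (blockSwap nh k j) v) := rfl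

/-- The action `φ ↦ c_k⁻¹ x φ` of the polynomial generators on the space of homomorphisms. -/
def homY (k : Fin r) (j : Fin (nh.1 k)) : Module.End F (HomHat ρ M nh) :=
  (c k)⁻¹ • LinearMap.restrict
    (LinearMap.compRight F (actOn F G n M (x F G (place nh ⟨k, j⟩))))
    fun φ hφ => (mem_homHat_iff hρ _).2 (((mem_homHat_iff hρ φ).1 hφ).x_smul _)

theorem homY_apply (k : Fin r) (j : Fin (nh.1 k)) (φ : HomHat ρ M nh) (v : VHat F V nh) :
    (homY hρ M nh k j φ).1 v = (c k)⁻¹ • x F G (place nh ⟨k, j⟩) • φ.1 v := rfl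

theorem homS_coxeter (k : Fin r) : CoxeterRelations (homS hρ M nh k) where
  sq j := by
    refine LinearMap.ext fun φ => Subtype.ext (LinearMap.ext fun v => ?_)
    simp only [Module.End.mul_apply, homS_apply, Module.End.one_apply]
    rw [← Module.End.mul_apply (permV F V _), (permV_coxeter nh k).sq, ← mul_smul, s_coxeter.sq,
      one_smul, Module.End.one_apply]
  comm i j h := by
    refine LinearMap.ext fun φ => Subtype.ext (LinearMap.ext fun v => ?_)
    simp only [Module.End.mul_apply, homS_apply]
    rw [← Module.End.mul_apply (permV F V _), (permV_coxeter nh k).comm _ _ h.symm, ← mul_smul,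
      s_coxeter.comm _ _ (simplePlace_far nh h), mul_smul, Module.End.mul_apply]
  braid i j h := by
    refine LinearMap.ext fun φ => Subtype.ext (LinearMap.ext fun v => ?_)
    simp only [Module.End.mul_apply, homS_apply]
    have hbraid := LinearMap.congr_fun ((permV_coxeter (F := F) (V := V) nh k).braid i j h) v
    simp only [Module.End.mul_apply] at hbraid
    rw [hbraid]
    simp only [← mul_smul, ← mul_assoc]
    rw [s_coxeter.braid _ _ (simplePlace_succ nh h)]

theorem homY_comm (k k' : Fin r) (j : Fin (nh.1 k)) (j' : Fin (nh.1 k')) :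
    homY hρ M nh k j * homY hρ M nh k' j' = homY hρ M nh k' j' * homY hρ M nh k j := by
  refine LinearMap.ext fun φ => Subtype.ext (LinearMap.ext fun v => ?_)
  simp only [Module.End.mul_apply, homY_apply]
  rw [smul_comm (x F G _) (c k')⁻¹, smul_comm (x F G _) (c k)⁻¹, smul_comm (c k)⁻¹,
    ← mul_smul (x F G _), x_comm, mul_smul]

theorem homS_homY_far {k k' : Fin r} (j : Fin (nh.1 k - 1)) (j' : Fin (nh.1 k'))
    (hlo : place nh ⟨k', j'⟩ ≠ place nh ⟨k, lo j⟩)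
    (hhi : place nh ⟨k', j'⟩ ≠ place nh ⟨k, hi j⟩) :
    homS hρ M nh k j * homY hρ M nh k' j' = homY hρ M nh k' j' * homS hρ M nh k j := by
  rw [place_lo_eq] at hlo
  rw [place_hi_eq] at hhi
  refine LinearMap.ext fun φ => Subtype.ext (LinearMap.ext fun v => ?_)
  simp only [Module.End.mul_apply, homY_apply, homS_apply]
  rw [smul_comm (s F G _) (c k')⁻¹, ← mul_smul (s F G _), s_mul_x_far _ _ hlo hhi, mul_smul]

theorem homS_homY_lo (k : Fin r) (j : Fin (nh.1 k - 1)) :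
    homS hρ M nh k j * homY hρ M nh k (lo j) =
      homY hρ M nh k (hi j) * homS hρ M nh k j - 1 := by
  refine LinearMap.ext fun φ => Subtype.ext (LinearMap.ext fun v => ?_)
  have hφ := (mem_homHat_iff hρ φ.1).1 φ.2
  have ht := hφ.t_smul (lo (simplePlace nh k j)) (hi (simplePlace nh k j))
    (permV F V (blockSwap nh k j) v)
  rw [← place_lo_eq, ← place_hi_eq, tAct_of_block (place nh) hρ k (lo_ne_hi j)] at ht
  have hs : permV F V (Pi.mulSingle k (Equiv.swap (lo j) (hi j)))
      (permV F V (blockSwap nh k j) v) = v := by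
    change permV F V (blockSwap nh k j) (permV F V (blockSwap nh k j) v) = v
    rw [← Module.End.mul_apply, (permV_coxeter nh k).sq, Module.End.one_apply]
  rw [LinearMap.smul_apply, hs, map_smul] at ht
  change (homS hρ M nh k j (homY hρ M nh k (lo j) φ)).1 v =
    (homY hρ M nh k (hi j) (homS hρ M nh k j φ)).1 v - φ.1 v
  simp only [homY_apply, homS_apply]
  rw [smul_comm (s F G _) (c k)⁻¹, ← mul_smul (s F G _), place_lo_eq, s_mul_x_lo, sub_smul,
    ← place_lo_eq, ← place_hi_eq, ht, smul_sub, inv_smul_smul₀ (hρ.ne_zero k), mul_smul]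

/-- The action of a degenerate affine Hecke algebra on the space of homomorphisms. -/
def homBlock (k : Fin r) : DegAffine F (nh.1 k) →ₐ[F] Module.End F (HomHat ρ M nh) :=
  liftAffine F (G := PUnit.{u + 1}) (n := nh.1 k) (gB := fun _ => 1) (sB := homS hρ M nh k)
    (xB := homY hρ M nh k)
    { g_one := rfl
      g_mul := fun _ _ => (mul_one _).symm
      x_comm := homY_comm hρ M nh k k
      x_g := fun _ _ => by rw [mul_one, one_mul]
      coxeter := homS_coxeter hρ M nh k
      s_x := fun j => by simp [homS_homY_lo]
      s_x_far := fun j j' h₁ h₂ => homS_homY_far hρ M nh j j'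
        (fun h => h₁ (by simpa using h)) (fun h => h₂ (by simpa using h))
      s_g := fun _ _ => by rw [mul_one, one_mul] }

theorem homS_comm_of_ne {k k' : Fin r} (h : k ≠ k') (j : Fin (nh.1 k - 1))
    (j' : Fin (nh.1 k' - 1)) : Commute (homS hρ M nh k j) (homS hρ M nh k' j') := by
  refine LinearMap.ext fun φ => Subtype.ext (LinearMap.ext fun v => ?_)
  simp only [Module.End.mul_apply, homS_apply]
  rw [← Module.End.mul_apply (permV F V _), permV_comm_of_ne nh h.symm, ← mul_smul,
    s_coxeter.comm _ _ (simplePlace_far_of_ne nh h _ _), mul_smul, Module.End.mul_apply]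

theorem homBlock_commute {k k' : Fin r} (h : k ≠ k') (a : DegAffine F (nh.1 k))
    (b : DegAffine F (nh.1 k')) :
    Commute (homBlock hρ M nh k a) (homBlock hρ M nh k' b) := by
  have hsy : ∀ {k k' : Fin r}, k ≠ k' → ∀ j j',
      Commute (homS hρ M nh k j) (homY hρ M nh k' j') := fun h _ _ =>
    homS_homY_far hρ M nh _ _ (place_ne_of_ne nh h.symm _ _) (place_ne_of_ne nh h.symm _ _)
  refine Affine.commute_of_generators (B := Module.End F (HomHat ρ M nh)) (homBlock hρ M nh k)
    (fun _ => ?_) (fun j => ?_) (fun j => ?_) a <;>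
  refine (Affine.commute_of_generators (B := Module.End F (HomHat ρ M nh)) (homBlock hρ M nh k')
    (fun _ => ?_) (fun j' => ?_) (fun j' => ?_) b).symm <;>
  simp only [homBlock, liftAffine_ofG, liftAffine_s, liftAffine_x, Commute.one_left,
    Commute.one_right]
  · exact (homS_comm_of_ne hρ M nh h j j').symm
  · exact (hsy h j j').symm
  · exact hsy h.symm j' j
  · exact homY_comm hρ M nh _ _ _ _

/-- The action of `A_{n̂,r}` on the space of homomorphisms. -/
def homAct : AHat F nh →ₐ[F] Module.End F (HomHat ρ M nh) :=
  liftCommuting (F := F) (B := fun k => DegAffine F (nh.1 k))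
    (C := Module.End F (HomHat ρ M nh)) (homBlock hρ M nh) fun _ _ h => homBlock_commute hρ M nh h

theorem homAct_s (k : Fin r) (j : Fin (nh.1 k - 1)) :
    homAct hρ M nh (PiTensorProduct.singleAlgHom k (s F PUnit.{u + 1} j)) =
      homS hρ M nh k j := by
  rw [homAct, liftCommuting_single]
  simp [homBlock]

theorem homAct_y (k : Fin r) (j : Fin (nh.1 k)) :
    homAct hρ M nh (PiTensorProduct.singleAlgHom k (x F PUnit.{u + 1} j)) =
      homY hρ M nh k j := by
  rw [homAct, liftCommuting_single]
  simp [homBlock]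

end BlockAction

section TensorInduction

variable {F : Type u} [Field F] {r : ℕ} {B : Fin r → Type u} [∀ k, Ring (B k)]
  [∀ k, Algebra F (B k)]

theorem tprod_eq_prod_single (a : ∀ k, B k) :
    PiTensorProduct.tprod F a =
      (List.ofFn fun k => PiTensorProduct.singleAlgHom (R := F) (A := B) k (a k)).prod := by
  have hid : liftCommuting (F := F) (B := B) (C := ⨂[F] k, B k)
      (fun k => PiTensorProduct.singleAlgHom k) (fun k l h a b => commute_single h a b) =
      AlgHom.id F _ := by
    refine PiTensorProduct.algHom_ext fun k => AlgHom.ext fun a => ?_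
    rw [AlgHom.comp_apply, liftCommuting_single]
    rfl
  have happly := DFunLike.congr_fun hid (PiTensorProduct.tprod F a)
  rw [liftCommuting, PiTensorProduct.liftAlgHom_apply, PiTensorProduct.lift.tprod,
    MultilinearMap.compLinearMap_apply, MultilinearMap.mkPiAlgebraFin_apply] at happly
  exact happly.symm

theorem tensor_induction {P : (⨂[F] k, B k) → Prop}
    (single : ∀ k a, P (PiTensorProduct.singleAlgHom k a)) (smul : ∀ (d : F) a, P a → P (d • a))
    (one : P 1) (mul : ∀ a b, P a → P b → P (a * b)) (add : ∀ a b, P a → P b → P (a + b))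
    (a : ⨂[F] k, B k) : P a := by
  induction a using PiTensorProduct.induction_on with
  | smul_tprod d a =>
    refine smul d _ ?_
    rw [tprod_eq_prod_single]
    refine List.prod_induction P mul one fun y hy => ?_
    obtain ⟨k, rfl⟩ := (List.mem_ofFn' _ _).1 hy
    exact single k _
  | add a b ha hb => exact add a b ha hb

theorem ofG_punit {n : ℕ} (a : Fin n → PUnit.{u + 1}) : ofG F a = 1 :=
  ofG_one

theorem AHat.map_apply_of_generators {r n : ℕ} {nh : Comp r n} {X Y : Type*}
    [AddCommGroup X] [Module F X] [AddCommGroup Y] [Module F Y] (τ : AHat F nh →ₐ[F] Module.End F X)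
    (τ' : AHat F nh →ₐ[F] Module.End F Y) (f : X →ₗ[F] Y)
    (hs : ∀ k j w, f (τ (PiTensorProduct.singleAlgHom k (s F PUnit.{u + 1} j)) w) =
      τ' (PiTensorProduct.singleAlgHom k (s F PUnit.{u + 1} j)) (f w))
    (hy : ∀ k j w, f (τ (PiTensorProduct.singleAlgHom k (x F PUnit.{u + 1} j)) w) =
      τ' (PiTensorProduct.singleAlgHom k (x F PUnit.{u + 1} j)) (f w))
    (a : AHat F nh) (w : X) : f (τ a w) = τ' a (f w) := by
  induction a using tensor_induction generalizing w with
  | single k a =>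
    induction a using Affine.induction generalizing w with
    | algebraMap d => simp only [AlgHom.commutes, Module.algebraMap_end_apply, map_smul]
    | ofG a => simp only [ofG_punit, map_one, Module.End.one_apply]
    | s i => exact hs k i w
    | x i => exact hy k i w
    | mul a b ha hb => simp only [map_mul, Module.End.mul_apply, ha, hb]
    | add a b ha hb => simp only [map_add, LinearMap.add_apply, ha, hb]
  | smul d a ha => simp only [map_smul, LinearMap.smul_apply, ha]
  | one => simp only [map_one, Module.End.one_apply]
  | mul a b ha hb => simp only [map_mul, Module.End.mul_apply, ha, hb]
  | add a b ha hb => simp only [map_add, LinearMap.add_apply, ha, hb]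

end TensorInduction

section Functor

variable {F : Type u} [Field F] {G : Type u} [Group G] [Fintype G] {r n : ℕ}
  {V : Fin r → Type u} [∀ k, AddCommGroup (V k)] [∀ k, Module F (V k)]
  [∀ k, FiniteDimensional F (V k)]
  {ρ : ∀ k, Representation F G (V k)} {c : Fin r → F} (hρ : SchurOrthogonality ρ c)

section

variable (M : Type u) [AddCommGroup M] [Module F M] [Module (Affine F G n) M]
  [IsScalarTower F (Affine F G n) M]

variable (n ρ) in
/-- The sum over all `n̂` of the spaces of homomorphisms `V(n̂) → M`, on which `A_{n,r}` acts. The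
type carries the orthogonality relations because the action is constructed from them. -/
@[nolint unusedArguments]
def HomSpace (_ : SchurOrthogonality ρ c) : Type u := ∀ nh : Comp r n, HomHat ρ M nh

instance : AddCommGroup (HomSpace n ρ M hρ) :=
  inferInstanceAs (AddCommGroup (∀ nh : Comp r n, HomHat ρ M nh))

instance : Module F (HomSpace n ρ M hρ) :=
  inferInstanceAs (Module F (∀ nh : Comp r n, HomHat ρ M nh))

instance [Module.Finite F M] : Module.Finite F (HomSpace n ρ M hρ) :=
  inferInstanceAs (Module.Finite F (∀ nh : Comp r n, HomHat ρ M nh))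

instance : Module (A F r n) (HomSpace n ρ M hρ) where
  smul a u := fun nh => homAct hρ M nh (a nh) (u nh)
  one_smul u := funext fun nh => by
    change homAct hρ M nh 1 (u nh) = u nh
    rw [map_one, Module.End.one_apply]
  mul_smul a b u := funext fun nh => by
    change homAct hρ M nh (a nh * b nh) (u nh) = _
    rw [map_mul]; rfl
  smul_zero a := funext fun nh => map_zero _
  smul_add a u w := funext fun nh => map_add _ _ _
  add_smul a b u := funext fun nh => by
    change homAct hρ M nh (a nh + b nh) (u nh) = _
    rw [map_add]; rfl
  zero_smul u := funext fun nh => by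
    change homAct hρ M nh 0 (u nh) = _
    rw [map_zero]; rfl

theorem homSpace_smul_apply (a : A F r n) (u : HomSpace n ρ M hρ) (nh : Comp r n) :
    (a • u) nh = homAct hρ M nh (a nh) (u nh) := rfl

instance : IsScalarTower F (A F r n) (HomSpace n ρ M hρ) :=
  IsScalarTower.of_algebraMap_smul fun d u => funext fun nh => by
    rw [homSpace_smul_apply]
    change homAct hρ M nh (algebraMap F _ d) (u nh) = _
    rw [AlgHom.commutes]; rfl

end

section

variable {M N : Type u} [AddCommGroup M] [Module F M] [Module (Affine F G n) M]
  [IsScalarTower F (Affine F G n) M] [AddCommGroup N] [Module F N] [Module (Affine F G n) N]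
  [IsScalarTower F (Affine F G n) N]

/-- Composition with a homomorphism of modules over the wreath Hecke algebra, on the homomorphisms
out of one `V(n̂)`. -/
def homHatMap (f : M →ₗ[Affine F G n] N) (nh : Comp r n) : HomHat ρ M nh →ₗ[F] HomHat ρ N nh :=
  LinearMap.restrict (LinearMap.compRight F (f.restrictScalars F)) fun φ hφ =>
    (mem_homHat_iff hρ _).2 fun g v => by
      change f (φ _) = ofG F g • f (φ v)
      rw [(mem_homHat_iff hρ _).1 hφ, map_smul]

theorem homHatMap_apply (f : M →ₗ[Affine F G n] N) (nh : Comp r n) (φ : HomHat ρ M nh)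
    (v : VHat F V nh) : (homHatMap hρ f nh φ).1 v = f (φ.1 v) := rfl

theorem homHatMap_homAct (f : M →ₗ[Affine F G n] N) (nh : Comp r n) (a : AHat F nh)
    (φ : HomHat ρ M nh) :
    homHatMap hρ f nh (homAct hρ M nh a φ) = homAct hρ N nh a (homHatMap hρ f nh φ) := by
  refine AHat.map_apply_of_generators _ _ _ (fun k j φ => ?_) (fun k j φ => ?_) a φ
  · rw [homAct_s, homAct_s]
    refine Subtype.ext (LinearMap.ext fun v => ?_)
    rw [homHatMap_apply, homS_apply, homS_apply, map_smul, homHatMap_apply]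
  · rw [homAct_y, homAct_y]
    refine Subtype.ext (LinearMap.ext fun v => ?_)
    rw [homHatMap_apply, homY_apply, homY_apply, LinearMap.map_smul_of_tower, map_smul,
      homHatMap_apply]

/-- Composition with a homomorphism, as a homomorphism of `A_{n,r}`-modules. -/
def homSpaceMap (f : M →ₗ[Affine F G n] N) : HomSpace n ρ M hρ →ₗ[A F r n] HomSpace n ρ N hρ where
  toFun u := fun nh => homHatMap hρ f nh (u nh)
  map_add' _ _ := funext fun _ => map_add _ _ _
  map_smul' a u := funext fun nh => homHatMap_homAct hρ f nh (a nh) (u nh)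

theorem homSpaceMap_apply (f : M →ₗ[Affine F G n] N) (u : HomSpace n ρ M hρ) (nh : Comp r n)
    (v : VHat F V nh) : (homSpaceMap hρ f u nh).1 v = f ((u nh).1 v) := rfl

end

/-- An isomorphism with an object of `ModuleCat B`, as an isomorphism for the `F`-module structure
obtained through `B`. -/
def restrictEquiv {B : Type u} [Ring B] [Algebra F B] {X : Type u} [AddCommGroup X]
    [Module F X] [Module B X] [IsScalarTower F B X] {M : ModuleCat.{u} B} (e : X ≃ₗ[B] M) :
    X ≃ₗ[F] M :=
  e.restrictScalars F

theorem finite_of_equiv {B : Type u} [Ring B] [Algebra F B] {X : Type u} [AddCommGroup X]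
    [Module F X] [Module B X] [IsScalarTower F B X] [Module.Finite F X] {M : ModuleCat.{u} B}
    (e : X ≃ₗ[B] M) : Module.Finite F M :=
  Module.Finite.equiv (restrictEquiv e)

/-- A type with compatible structures of an `F`-module and of a `B`-module, as a finite dimensional
`B`-module; the resulting second `F`-module structure agrees with the given one. -/
abbrev FDMod.of (B : Type u) [Ring B] [Algebra F B] (X : Type u) [AddCommGroup X] [Module F X]
    [Module B X] [IsScalarTower F B X] [Module.Finite F X] : FDMod F B :=
  ⟨ModuleCat.of B X, finite_of_equiv (F := F) (M := ModuleCat.of B X) (LinearEquiv.refl B X)⟩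

/-- The functor `M ↦ ⨁_{n̂} Hom_{FG^n}(V(n̂), I_{n̂} M)`. -/
def homFunctor : FDMod F (Affine F G n) ⥤ FDMod F (A F r n) where
  obj M :=
    haveI := M.property
    FDMod.of _ (HomSpace n ρ M.obj hρ)
  map f := ObjectProperty.homMk (ModuleCat.ofHom (homSpaceMap hρ f.hom.hom))
  map_id _ := rfl
  map_comp _ _ := rfl

/-- The data identifying `homFunctor` with the functor of the theorem. -/
def homFunctorIsHomFunctor (p : ℕ) [Fact p.Prime] [CharP F p]
    (hc : ∀ k, c k = ZMod.castHom (dvd_refl p) F (cScalar F p G V k)) :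
    IsHomFunctor ρ p (homFunctor (n := n) hρ) where
  act M nh := homAct hρ M.obj nh
  act_s M nh k j φ v := by
    rw [homAct_s, homS_apply, permV_tprod]
    rfl
  act_y M nh k j φ v := by
    rw [homAct_y, homY_apply, hc]
  iso M := (restrictEquiv (F := F) (X := HomSpace n ρ M.obj hρ)
    (M := ((homFunctor hρ).obj M).obj) (LinearEquiv.refl (A F r n) (HomSpace n ρ M.obj hρ))).symm
  iso_smul M a u nh := rfl
  iso_map f u nh v := rfl

end Functor

section PermElt

variable {F : Type u} [Field F] {G : Type u} [Group G] [Fintype G] {r n : ℕ}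

variable (F G) in
/-- The image of a permutation in the wreath Hecke algebra. -/
def permElt (w : Equiv.Perm (Fin n)) : Affine F G n := coxeterHom s_coxeter w

theorem permElt_one : permElt F G (1 : Equiv.Perm (Fin n)) = 1 := map_one _

theorem permElt_mul (w w' : Equiv.Perm (Fin n)) :
    permElt F G (w * w') = permElt F G w * permElt F G w' := map_mul _ _ _

theorem permElt_simpleSwap (i : Fin (n - 1)) : permElt F G (simpleSwap i) = s F G i :=
  coxeterHom_simpleSwap _ i

variable {M : Type u} [AddCommGroup M] [Module (Affine F G n) M]

@[simp] theorem permElt_inv_smul (w : Equiv.Perm (Fin n)) (m : M) :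
    permElt F G w⁻¹ • permElt F G w • m = m := by
  rw [← mul_smul, ← permElt_mul, inv_mul_cancel, permElt_one, one_smul]

@[simp] theorem permElt_smul_inv (w : Equiv.Perm (Fin n)) (m : M) :
    permElt F G w • permElt F G w⁻¹ • m = m := by
  rw [← mul_smul, ← permElt_mul, mul_inv_cancel, permElt_one, one_smul]

theorem permElt_smul_injective (w : Equiv.Perm (Fin n)) :
    Function.Injective fun m : M => permElt F G w • m :=
  Function.LeftInverse.injective (g := fun m => permElt F G w⁻¹ • m) (permElt_inv_smul w)

variable {nh : Comp r n}

theorem place_trans_labelPerm (α : (Σ k, Fin (nh.1 k)) ≃ Fin n) :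
    (place nh).trans (labelPerm α) = α := by
  ext1 a
  exact labelPerm_apply α a

theorem trans_labelPerm_inv (α : (Σ k, Fin (nh.1 k)) ≃ Fin n) :
    α.trans (labelPerm α)⁻¹ = place nh := by
  ext1 a
  rw [Equiv.trans_apply, ← labelPerm_apply α a]
  exact Equiv.symm_apply_apply _ _

variable {V : Fin r → Type u} [∀ k, AddCommGroup (V k)] [∀ k, Module F (V k)]
  {ρ : ∀ k, Representation F G (V k)} [Module F M] [IsScalarTower F (Affine F G n) M]

theorem LabelEquivariant.permElt_smul {β : (Σ k, Fin (nh.1 k)) ≃ Fin n} {φ : VHat F V nh →ₗ[F] M}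
    (hφ : LabelEquivariant ρ β φ) (w : Equiv.Perm (Fin n)) :
    LabelEquivariant ρ (β.trans w) (actOn F G n M (permElt F G w) ∘ₗ φ) := by
  induction w using perm_induction with
  | one => rw [permElt_one, map_one]; exact hφ
  | step w i _ ih =>
    have hβ := ih.s_smul i
    rw [← LinearMap.comp_assoc, ← Module.End.mul_eq_comp, ← map_mul, ← permElt_simpleSwap,
      ← permElt_mul, simpleSwap_mul_cancel] at hβ
    have htrans : (β.trans (simpleSwap i * w)).trans (simpleSwap i) =
        β.trans (simpleSwap i * (simpleSwap i * w)) := rfl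
    rwa [htrans, simpleSwap_mul_cancel] at hβ

theorem LabelEquivariant.permElt_labelPerm_smul {φ : VHat F V nh →ₗ[F] M}
    (hφ : LabelEquivariant ρ (place nh) φ) (α : (Σ k, Fin (nh.1 k)) ≃ Fin n) :
    LabelEquivariant ρ α (actOn F G n M (permElt F G (labelPerm α)) ∘ₗ φ) := by
  have hα := hφ.permElt_smul (labelPerm α)
  rwa [place_trans_labelPerm] at hα

end PermElt

section Decomposition

variable {F : Type u} [Field F] {G : Type u} [Group G] [Fintype G] {r n : ℕ}
  {V : Fin r → Type u} [∀ k, AddCommGroup (V k)] [∀ k, Module F (V k)]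
  [∀ k, FiniteDimensional F (V k)] {ρ : ∀ k, Representation F G (V k)} {c : Fin r → F}
  (hρ : SchurOrthogonality ρ c) {M : Type u} [AddCommGroup M] [Module F M]
  [Module (Affine F G n) M] [IsScalarTower F (Affine F G n) M] {nh : Comp r n}

include hρ

theorem x_smul_permElt_place {φ : VHat F V nh →ₗ[F] M} (hφ : LabelEquivariant ρ (place nh) φ)
    (α : Shuffle nh) (a : Σ k, Fin (nh.1 k)) (v : VHat F V nh) :
    x F G (α.1 a) • permElt F G (labelPerm α.1) • φ v =
      permElt F G (labelPerm α.1) • x F G (place nh a) • φ v := by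
  generalize hw : labelPerm α.1 = w
  induction w using perm_induction generalizing α with
  | one =>
    rw [← labelPerm_apply, hw, permElt_one, one_smul, one_smul]
    rfl
  | step w i hdesc ih =>
    subst hw
    have hm := mixed_of_descent α i hdesc
    have hβ := hφ.permElt_labelPerm_smul (α.swap i hm).1
    have hβx := ih (α.swap i hm) rfl
    have hs : s F G i • x F G ((α.swap i hm).1 a) • permElt F G (simpleSwap i * labelPerm α.1) •
        φ v = x F G (simpleSwap i ((α.swap i hm).1 a)) • s F G i •
          permElt F G (simpleSwap i * labelPerm α.1) • φ v :=
      hβ.s_smul_x_smul hρ (mixed_swap hm) ((α.swap i hm).1 a) v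
    have ha : simpleSwap i ((α.swap i hm).1 a) = α.1 a := simpleSwap_apply_self i (α.1 a)
    rw [ha, hβx] at hs
    simpa only [← permElt_simpleSwap, ← mul_smul, ← mul_assoc, ← permElt_mul,
      simpleSwap_mul_self, one_mul] using hs.symm

/-- The coordinate of a vector of `M` at the basis vector `q` of the copy of `V(n̂)` labelled by
`α`, transported to the standard labelling: a homomorphism `V(n̂) → M`. -/
def coordHom (α : (Σ k, Fin (nh.1 k)) ≃ Fin n) (q : HatIndex F V nh) : M →ₗ[F] HomHat ρ M nh where
  toFun m := ⟨actOn F G n M (permElt F G (labelPerm α)⁻¹) ∘ₗ matUnitHom ρ c α q m, by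
    rw [mem_homHat_iff hρ]
    have hα := (matUnitHom_equivariant (α := α) ρ c q m).permElt_smul (labelPerm α)⁻¹
    rwa [trans_labelPerm_inv] at hα⟩
  map_add' m m' := Subtype.ext (LinearMap.ext fun v => by
    change permElt F G (labelPerm α)⁻¹ • matUnit ρ α c q v • (m + m') =
      permElt F G (labelPerm α)⁻¹ • matUnit ρ α c q v • m +
        permElt F G (labelPerm α)⁻¹ • matUnit ρ α c q v • m'
    rw [smul_add, smul_add])
  map_smul' d m := Subtype.ext (LinearMap.ext fun v => by
    change permElt F G (labelPerm α)⁻¹ • matUnit ρ α c q v • d • m =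
      d • permElt F G (labelPerm α)⁻¹ • matUnit ρ α c q v • m
    rw [smul_comm (matUnit ρ α c q v) d m, smul_comm (permElt F G (labelPerm α)⁻¹) d])

theorem coordHom_apply (α : (Σ k, Fin (nh.1 k)) ≃ Fin n) (q : HatIndex F V nh) (m : M)
    (v : VHat F V nh) : (coordHom hρ α q m).1 v =
      permElt F G (labelPerm α)⁻¹ • matUnit ρ α c q v • m := rfl

theorem coordHom_same (α : (Σ k, Fin (nh.1 k)) ≃ Fin n) (q : HatIndex F V nh)
    (φ : HomHat ρ M nh) (v : VHat F V nh) :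
    coordHom hρ α q (permElt F G (labelPerm α) • φ.1 v) = (hatBasis F V nh).coord q v • φ := by
  refine Subtype.ext (LinearMap.ext fun u => ?_)
  have hu := matUnit_smul_same hρ (((mem_homHat_iff hρ _).1 φ.2).permElt_labelPerm_smul α) q u v
  rw [coordHom_apply]
  refine (congrArg (fun m : M => permElt F G (labelPerm α)⁻¹ • m) hu).trans ?_
  rw [smul_comm]
  change _ • permElt F G (labelPerm α)⁻¹ • permElt F G (labelPerm α) • φ.1 u = _
  rw [permElt_inv_smul]
  rfl

theorem coordHom_of_colour_ne {nh' : Comp r n} (α : (Σ k, Fin (nh.1 k)) ≃ Fin n)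
    (β : (Σ k, Fin (nh'.1 k)) ≃ Fin n) (h : colour α ≠ colour β) (q : HatIndex F V nh)
    (φ : HomHat ρ M nh') (v : VHat F V nh') :
    coordHom hρ α q (permElt F G (labelPerm β) • φ.1 v) = 0 := by
  refine Subtype.ext (LinearMap.ext fun u => ?_)
  have hφ := (mem_homHat_iff hρ _).1 φ.2
  have hu := matUnit_smul_of_colour_ne hρ (hφ.permElt_labelPerm_smul β) h q u v
  rw [coordHom_apply]
  exact (congrArg (fun m : M => permElt F G (labelPerm α)⁻¹ • m) hu).trans (smul_zero _)

theorem ofG_smul_permElt (α : Shuffle nh) (g : Fin n → G) (φ : HomHat ρ M nh) (v : VHat F V nh) :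
    ofG F g • permElt F G (labelPerm α.1) • φ.1 v =
      permElt F G (labelPerm α.1) • φ.1 (labelAct ρ α.1 g v) :=
  ((((mem_homHat_iff hρ _).1 φ.2).permElt_labelPerm_smul α.1) g v).symm

omit hρ [∀ k, FiniteDimensional F (V k)] in
theorem s_smul_permElt_of_mixed (α : Shuffle nh) (i : Fin (n - 1)) (h : Mixed α.1 i)
    (φ : HomHat ρ M nh) (v : VHat F V nh) :
    s F G i • permElt F G (labelPerm α.1) • φ.1 v =
      permElt F G (labelPerm (α.swap i h).1) • φ.1 v := by
  rw [← mul_smul, ← permElt_simpleSwap, ← permElt_mul]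
  rfl

theorem s_smul_permElt_of_block {α : Shuffle nh} {i : Fin (n - 1)} {k : Fin r}
    {j : Fin (nh.1 k - 1)} (hlo : α.1 ⟨k, lo j⟩ = lo i) (hhi : α.1 ⟨k, hi j⟩ = hi i)
    (φ : HomHat ρ M nh) (v : VHat F V nh) :
    s F G i • permElt F G (labelPerm α.1) • φ.1 v =
      permElt F G (labelPerm α.1) •
        (homS hρ M nh k j φ).1 (permV F V (blockSwap nh k j) v) := by
  rw [homS_apply, ← Module.End.mul_apply (permV F V _), (permV_coxeter nh k).sq,
    Module.End.one_apply, ← mul_smul, ← mul_smul, ← permElt_simpleSwap, ← permElt_simpleSwap,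
    ← permElt_mul, ← permElt_mul, simpleSwap_mul_labelPerm hlo hhi]

theorem x_smul_permElt (α : Shuffle nh) (k : Fin r) (j : Fin (nh.1 k)) (φ : HomHat ρ M nh)
    (v : VHat F V nh) :
    x F G (α.1 ⟨k, j⟩) • permElt F G (labelPerm α.1) • φ.1 v =
      permElt F G (labelPerm α.1) • (c k • homY hρ M nh k j φ).1 v := by
  rw [x_smul_permElt_place hρ ((mem_homHat_iff hρ _).1 φ.2)]
  congr 1
  change _ = c k • (homY hρ M nh k j φ).1 v
  rw [homY_apply, smul_inv_smul₀ (hρ.ne_zero k)]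

end Decomposition

section Spanning

variable {F : Type u} [Field F] {G : Type u} [Group G] [Fintype G] {r n : ℕ}
  {V : Fin r → Type u} [∀ k, AddCommGroup (V k)] [∀ k, Module F (V k)]
  [∀ k, FiniteDimensional F (V k)] {ρ : ∀ k, Representation F G (V k)} {c : Fin r → F}
  (hρ : SchurRelations ρ c) {M : Type u} [AddCommGroup M] [Module F M]
  [Module (Affine F G n) M] [IsScalarTower F (Affine F G n) M]

include hρ

theorem sum_coordHom (m : M) : ∑ x : Label r n, ∑ q : HatIndex F V x.1,
    permElt F G (labelPerm x.2.1) •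
      (coordHom hρ.toSchurOrthogonality x.2.1 q m).1 (hatBasis F V x.1 q) = m := by
  simp only [coordHom_apply, permElt_smul_inv, ← Finset.sum_smul]
  rw [sum_matUnit_eq_one hρ, one_smul]

theorem linearMap_ext_permElt_smul {N : Type*} [AddCommGroup N] [Module F N] {f f' : M →ₗ[F] N}
    (h : ∀ (nh : Comp r n) (α : Shuffle nh) (φ : HomHat ρ M nh) (v : VHat F V nh),
      f (permElt F G (labelPerm α.1) • φ.1 v) = f' (permElt F G (labelPerm α.1) • φ.1 v)) :
    f = f' := by
  ext m
  rw [← sum_coordHom (n := n) hρ m]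
  simp only [map_sum, h]

end Spanning

section Extension

variable {F : Type u} [Field F] {G : Type u} [Group G] [Fintype G] {r n : ℕ}
  {V : Fin r → Type u} [∀ k, AddCommGroup (V k)] [∀ k, Module F (V k)]
  [∀ k, FiniteDimensional F (V k)] {ρ : ∀ k, Representation F G (V k)} {c : Fin r → F}
  {M N : Type u} [AddCommGroup M] [Module F M] [Module (Affine F G n) M]
  [IsScalarTower F (Affine F G n) M] [AddCommGroup N] [Module F N] [Module (Affine F G n) N]
  [IsScalarTower F (Affine F G n) N]

omit [∀ k, FiniteDimensional F (V k)] in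
theorem homHat_eq_permElt_smul {nh : Comp r n} (φ : HomHat ρ M nh) (v : VHat F V nh) :
    φ.1 v = permElt F G (labelPerm (placeShuffle nh).1) • φ.1 v := by
  change φ.1 v = permElt F G (labelPerm (place nh)) • φ.1 v
  rw [labelPerm_place, permElt_one, one_smul]

section

variable (hρ : SchurOrthogonality ρ c)

/-- The linear map `M → N` determined by linear maps `Hom(V(n̂), M) → Hom(V(n̂), N)`, which are
applied to the coordinates of a vector of `M`. -/
def extendHom (ψ : ∀ nh : Comp r n, HomHat ρ M nh →ₗ[F] HomHat ρ N nh) : M →ₗ[F] N :=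
  ∑ x : Label r n, ∑ q : HatIndex F V x.1,
    actOn F G n N (permElt F G (labelPerm x.2.1)) ∘ₗ
      LinearMap.applyₗ (hatBasis F V x.1 q) ∘ₗ (HomHat ρ N x.1).subtype ∘ₗ ψ x.1 ∘ₗ
        coordHom hρ x.2.1 q

theorem extendHom_permElt_smul (ψ : ∀ nh : Comp r n, HomHat ρ M nh →ₗ[F] HomHat ρ N nh)
    {nh : Comp r n} (α : Shuffle nh) (φ : HomHat ρ M nh) (v : VHat F V nh) :
    extendHom hρ ψ (permElt F G (labelPerm α.1) • φ.1 v) =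
      permElt F G (labelPerm α.1) • (ψ nh φ).1 v := by
  have hext : ∀ m : M, extendHom hρ ψ m = ∑ x : Label r n, ∑ q : HatIndex F V x.1,
      permElt F G (labelPerm x.2.1) • (ψ x.1 (coordHom hρ x.2.1 q m)).1
        (hatBasis F V x.1 q) := fun m => by
    simp only [extendHom, LinearMap.sum_apply]
    rfl
  rw [hext, Finset.sum_eq_single ⟨nh, α⟩]
  · simp only [coordHom_same, map_smul]
    conv_rhs => rw [← (hatBasis F V nh).sum_repr v, map_sum, Finset.smul_sum]
    refine Finset.sum_congr rfl fun q _ => ?_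
    rw [map_smul]
    rfl
  · intro y _ hy
    refine Finset.sum_eq_zero fun q _ => ?_
    rw [coordHom_of_colour_ne hρ y.2.1 α.1 fun h => hy (Label.ext_colour (y := ⟨nh, α⟩) h),
      map_zero]
    exact smul_zero _
  · exact fun h => absurd (Finset.mem_univ _) h

end

variable (hρ : SchurRelations ρ c)
  {ψ : ∀ nh : Comp r n, HomHat ρ M nh →ₗ[F] HomHat ρ N nh}

theorem extendHom_ofG_smul (g : Fin n → G) (m : M) :
    extendHom hρ.toSchurOrthogonality ψ (ofG F g • m) =
      ofG F g • extendHom hρ.toSchurOrthogonality ψ m := by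
  refine LinearMap.congr_fun (linearMap_ext_permElt_smul (n := n) hρ
    (f := extendHom hρ.toSchurOrthogonality ψ ∘ₗ actOn F G n M (ofG F g))
    (f' := actOn F G n N (ofG F g) ∘ₗ extendHom hρ.toSchurOrthogonality ψ)
    fun nh α φ v => ?_) m
  change extendHom _ ψ (ofG F g • _) = ofG F g • extendHom _ ψ _
  rw [ofG_smul_permElt hρ.toSchurOrthogonality, extendHom_permElt_smul, extendHom_permElt_smul,
    ofG_smul_permElt hρ.toSchurOrthogonality]

theorem extendHom_s_smul
    (hs : ∀ nh k j φ, ψ nh (homS hρ.toSchurOrthogonality M nh k j φ) =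
      homS hρ.toSchurOrthogonality N nh k j (ψ nh φ)) (i : Fin (n - 1)) (m : M) :
    extendHom hρ.toSchurOrthogonality ψ (s F G i • m) =
      s F G i • extendHom hρ.toSchurOrthogonality ψ m := by
  refine LinearMap.congr_fun (linearMap_ext_permElt_smul (n := n) hρ
    (f := extendHom hρ.toSchurOrthogonality ψ ∘ₗ actOn F G n M (s F G i))
    (f' := actOn F G n N (s F G i) ∘ₗ extendHom hρ.toSchurOrthogonality ψ)
    fun nh α φ v => ?_) m
  change extendHom _ ψ (s F G i • _) = s F G i • extendHom _ ψ _
  by_cases hmixed : Mixed α.1 i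
  · rw [s_smul_permElt_of_mixed α i hmixed, extendHom_permElt_smul, extendHom_permElt_smul,
      s_smul_permElt_of_mixed α i hmixed]
  · obtain ⟨k, j, hlo, hhi⟩ := exists_of_not_mixed α i hmixed
    rw [s_smul_permElt_of_block hρ.toSchurOrthogonality hlo hhi, extendHom_permElt_smul,
      extendHom_permElt_smul, hs, s_smul_permElt_of_block hρ.toSchurOrthogonality hlo hhi]

theorem extendHom_x_smul
    (hy : ∀ nh k j φ, ψ nh (homY hρ.toSchurOrthogonality M nh k j φ) =
      homY hρ.toSchurOrthogonality N nh k j (ψ nh φ)) (i : Fin n) (m : M) :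
    extendHom hρ.toSchurOrthogonality ψ (x F G i • m) =
      x F G i • extendHom hρ.toSchurOrthogonality ψ m := by
  refine LinearMap.congr_fun (linearMap_ext_permElt_smul (n := n) hρ
    (f := extendHom hρ.toSchurOrthogonality ψ ∘ₗ actOn F G n M (x F G i))
    (f' := actOn F G n N (x F G i) ∘ₗ extendHom hρ.toSchurOrthogonality ψ)
    fun nh α φ v => ?_) m
  change extendHom _ ψ (x F G i • _) = x F G i • extendHom _ ψ _
  obtain ⟨⟨k, j⟩, rfl⟩ := α.1.surjective i
  rw [x_smul_permElt hρ.toSchurOrthogonality, extendHom_permElt_smul, extendHom_permElt_smul,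
    map_smul, hy, x_smul_permElt hρ.toSchurOrthogonality]

/-- The homomorphism of modules over the wreath Hecke algebra determined by linear maps
`Hom(V(n̂), M) → Hom(V(n̂), N)` which commute with the generators of `A_{n̂,r}`. -/
def extendLinear (ψ : ∀ nh : Comp r n, HomHat ρ M nh →ₗ[F] HomHat ρ N nh)
    (hs : ∀ nh k j φ, ψ nh (homS hρ.toSchurOrthogonality M nh k j φ) =
      homS hρ.toSchurOrthogonality N nh k j (ψ nh φ))
    (hy : ∀ nh k j φ, ψ nh (homY hρ.toSchurOrthogonality M nh k j φ) =
      homY hρ.toSchurOrthogonality N nh k j (ψ nh φ)) :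
    M →ₗ[Affine F G n] N where
  toFun := extendHom hρ.toSchurOrthogonality ψ
  map_add' := map_add _
  map_smul' := Affine.smul_comm_of_generators _ (extendHom_ofG_smul hρ) (extendHom_s_smul hρ hs)
    (extendHom_x_smul hρ hy)

theorem extendLinear_apply_homHat
    (hs : ∀ nh k j φ, ψ nh (homS hρ.toSchurOrthogonality M nh k j φ) =
      homS hρ.toSchurOrthogonality N nh k j (ψ nh φ))
    (hy : ∀ nh k j φ, ψ nh (homY hρ.toSchurOrthogonality M nh k j φ) =
      homY hρ.toSchurOrthogonality N nh k j (ψ nh φ)) {nh : Comp r n} (φ : HomHat ρ M nh)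
    (v : VHat F V nh) : extendLinear hρ ψ hs hy (φ.1 v) = (ψ nh φ).1 v := by
  change extendHom _ ψ (φ.1 v) = _
  rw [homHat_eq_permElt_smul, extendHom_permElt_smul, ← homHat_eq_permElt_smul]

end Extension

section HomSpaceSummands

variable {F : Type u} [Field F] {G : Type u} [Group G] [Fintype G] {r n : ℕ}
  {V : Fin r → Type u} [∀ k, AddCommGroup (V k)] [∀ k, Module F (V k)]
  [∀ k, FiniteDimensional F (V k)] {ρ : ∀ k, Representation F G (V k)} {c : Fin r → F}
  (hρ : SchurOrthogonality ρ c)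
  {M N : Type u} [AddCommGroup M] [Module F M] [Module (Affine F G n) M]
  [IsScalarTower F (Affine F G n) M] [AddCommGroup N] [Module F N] [Module (Affine F G n) N]
  [IsScalarTower F (Affine F G n) N]

variable (M) in
/-- The inclusion of a summand of the direct sum of the spaces of homomorphisms. -/
def homSingle (nh : Comp r n) : HomHat ρ M nh →ₗ[F] HomSpace n ρ M hρ :=
  open Classical in LinearMap.single F (fun nh : Comp r n => HomHat ρ M nh) nh

omit [∀ k, FiniteDimensional F (V k)] in
theorem homSingle_apply_same (nh : Comp r n) (φ : HomHat ρ M nh) : homSingle hρ M nh φ nh = φ := by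
  classical
  exact Pi.single_eq_same (M := fun nh : Comp r n => HomHat ρ M nh) nh φ

omit [∀ k, FiniteDimensional F (V k)] in
theorem homSingle_apply_of_ne {nh mh : Comp r n} (h : mh ≠ nh) (φ : HomHat ρ M nh) :
    homSingle hρ M nh φ mh = 0 := by
  classical
  exact Pi.single_eq_of_ne (M := fun nh : Comp r n => HomHat ρ M nh) h φ

omit [∀ k, FiniteDimensional F (V k)] in
theorem sum_homSingle (u : HomSpace n ρ M hρ) : ∑ nh, homSingle hρ M nh (u nh) = u := by
  classical
  exact Finset.univ_sum_single (M := fun nh : Comp r n => HomHat ρ M nh) u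

open Classical in
theorem piSingle_smul_homSingle (nh : Comp r n) (a : AHat F nh) (φ : HomHat ρ M nh) :
    (Pi.single (M := fun nh : Comp r n => AHat F nh) nh a : A F r n) • homSingle hρ M nh φ =
      homSingle hρ M nh (homAct hρ M nh a φ) := by
  refine funext fun mh => ?_
  rw [homSpace_smul_apply]
  rcases eq_or_ne mh nh with rfl | h
  · rw [Pi.single_eq_same, homSingle_apply_same, homSingle_apply_same]
  · rw [homSingle_apply_of_ne hρ h, homSingle_apply_of_ne hρ h, map_zero]

variable {hρ} (ψ : HomSpace n ρ M hρ →ₗ[A F r n] HomSpace n ρ N hρ)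

theorem map_homSingle_apply_of_ne {nh mh : Comp r n} (h : mh ≠ nh) (φ : HomHat ρ M nh) :
    ψ (homSingle hρ M nh φ) mh = 0 := by
  classical
  have hone := piSingle_smul_homSingle hρ nh 1 φ
  rw [map_one, Module.End.one_apply] at hone
  rw [← hone, map_smul, homSpace_smul_apply, Pi.single_eq_of_ne h, map_zero, LinearMap.zero_apply]

/-- The component at `n̂` of a homomorphism between the direct sums of spaces of homomorphisms;
since it commutes with the idempotents of `A_{n,r}`, it is determined by these components. -/
def homComponent (nh : Comp r n) : HomHat ρ M nh →ₗ[F] HomHat ρ N nh :=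
  LinearMap.proj (φ := fun nh : Comp r n => HomHat ρ N nh) nh ∘ₗ
    (ψ.restrictScalars F : HomSpace n ρ M hρ →ₗ[F] HomSpace n ρ N hρ) ∘ₗ homSingle hρ M nh

theorem homComponent_apply (nh : Comp r n) (φ : HomHat ρ M nh) :
    homComponent ψ nh φ = ψ (homSingle hρ M nh φ) nh := rfl

theorem homComponent_homAct (nh : Comp r n) (a : AHat F nh) (φ : HomHat ρ M nh) :
    homComponent ψ nh (homAct hρ M nh a φ) = homAct hρ N nh a (homComponent ψ nh φ) := by
  classical
  rw [homComponent_apply, ← piSingle_smul_homSingle, map_smul, homSpace_smul_apply,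
    Pi.single_eq_same, homComponent_apply]

theorem apply_eq_homComponent (u : HomSpace n ρ M hρ) (nh : Comp r n) :
    ψ u nh = homComponent ψ nh (u nh) := by
  conv_lhs => rw [← sum_homSingle hρ u, map_sum]
  refine (Finset.sum_apply nh _ _).trans ?_
  rw [Finset.sum_eq_single nh]
  · rfl
  · exact fun mh _ h => map_homSingle_apply_of_ne ψ h.symm _
  · exact fun h => absurd (Finset.mem_univ _) h

end HomSpaceSummands

section FullyFaithful

variable {F : Type u} [Field F] {G : Type u} [Group G] [Fintype G] {r n : ℕ}
  {V : Fin r → Type u} [∀ k, AddCommGroup (V k)] [∀ k, Module F (V k)]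
  [∀ k, FiniteDimensional F (V k)] {ρ : ∀ k, Representation F G (V k)} {c : Fin r → F}
  (hρ : SchurRelations ρ c)

section

variable {M N : Type u} [AddCommGroup M] [Module F M] [Module (Affine F G n) M]
  [IsScalarTower F (Affine F G n) M] [AddCommGroup N] [Module F N] [Module (Affine F G n) N]
  [IsScalarTower F (Affine F G n) N]

theorem homSpaceMap_injective : Function.Injective
    (homSpaceMap (n := n) hρ.toSchurOrthogonality (M := M) (N := N)) := by
  intro f f' h
  refine LinearMap.restrictScalars_injective F (linearMap_ext_permElt_smul (n := n) hρ
    fun nh α φ v => ?_)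
  have hφ := congrArg (fun u : HomSpace n ρ N hρ.toSchurOrthogonality => (u nh).1 v)
    (LinearMap.congr_fun h (homSingle hρ.toSchurOrthogonality M nh φ))
  simp only [homSpaceMap_apply, homSingle_apply_same] at hφ
  rw [LinearMap.restrictScalars_apply, LinearMap.restrictScalars_apply, map_smul, map_smul, hφ]

theorem homSpaceMap_surjective : Function.Surjective
    (homSpaceMap (n := n) hρ.toSchurOrthogonality (M := M) (N := N)) := by
  intro ψ
  refine ⟨extendLinear hρ (homComponent ψ) (fun nh k j φ => ?_) (fun nh k j φ => ?_), ?_⟩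
  · rw [← homAct_s, homComponent_homAct, homAct_s]
  · rw [← homAct_y, homComponent_homAct, homAct_y]
  · refine LinearMap.ext fun u => funext fun nh => Subtype.ext (LinearMap.ext fun v => ?_)
    rw [homSpaceMap_apply, apply_eq_homComponent, extendLinear_apply_homHat]

end

theorem homFunctor_faithful : (homFunctor (n := n) hρ.toSchurOrthogonality).Faithful where
  map_injective h :=
    ObjectProperty.hom_ext _ (ModuleCat.hom_ext (homSpaceMap_injective hρ
      (congrArg (fun g => g.hom.hom) h)))

theorem homFunctor_full : (homFunctor (n := n) hρ.toSchurOrthogonality).Full where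
  map_surjective {M N} g := by
    obtain ⟨f, hf⟩ := homSpaceMap_surjective hρ (M := M.obj) (N := N.obj) g.hom.hom
    exact ⟨ObjectProperty.homMk (ModuleCat.ofHom f),
      ObjectProperty.hom_ext _ (ModuleCat.hom_ext hf)⟩

end FullyFaithful

section ShuffleSwap

variable {r n : ℕ} {i j : Fin (n - 1)}

theorem simpleSwap_simpleSwap_lo (h : i.1 + 1 = j.1 ∨ j.1 + 1 = i.1) :
    simpleSwap j (simpleSwap i (lo j)) = lo i := by
  rcases h with h | h
  · rw [← hi_eq_lo h, simpleSwap_hi,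
      simpleSwap_of_ne (hi_eq_lo h ▸ lo_ne_hi i) (lo_ne_hi_of_adjacent h)]
  · rw [simpleSwap_of_ne (b := lo j) (hi_eq_lo h ▸ lo_ne_hi j) (lo_ne_hi_of_adjacent h),
      simpleSwap_lo, hi_eq_lo h]

theorem simpleSwap_simpleSwap_hi (h : i.1 + 1 = j.1 ∨ j.1 + 1 = i.1) :
    simpleSwap j (simpleSwap i (hi j)) = hi i := by
  rcases h with h | h
  · rw [simpleSwap_of_ne (b := hi j) (lo_ne_hi_of_adjacent h).symm
      (hi_eq_lo h ▸ (lo_ne_hi j).symm), simpleSwap_hi, hi_eq_lo h]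
  · rw [hi_eq_lo h, simpleSwap_lo, simpleSwap_of_ne (lo_ne_hi_of_adjacent h).symm
      (hi_eq_lo h ▸ (lo_ne_hi i).symm)]

variable {nh : Comp r n} (α : Shuffle nh)

theorem Shuffle.swap_apply (h : Mixed α.1 i) (a : Σ k, Fin (nh.1 k)) :
    (α.swap i h).1 a = simpleSwap i (α.1 a) := rfl

theorem Shuffle.swap_symm_apply (h : Mixed α.1 i) (b : Fin n) :
    (α.swap i h).1.symm b = α.1.symm (simpleSwap i b) := by
  rw [Equiv.symm_apply_eq, α.swap_apply, Equiv.apply_symm_apply, simpleSwap_apply_self]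

theorem Shuffle.colour_swap (h : Mixed α.1 i) (b : Fin n) :
    colour (α.swap i h).1 b = colour α.1 (simpleSwap i b) := WreathHecke.colour_swap _ _ _

theorem Shuffle.swap_swap (h : Mixed α.1 i) : (α.swap i h).swap i (mixed_swap h) = α :=
  Subtype.ext (Equiv.ext fun a => simpleSwap_apply_self i (α.1 a))

variable {α}

theorem mixed_swap_of_far (h : i.1 + 1 < j.1 ∨ j.1 + 1 < i.1) {hm : Mixed α.1 i} :
    Mixed (α.swap i hm).1 j ↔ Mixed α.1 j := by
  rw [Mixed, α.colour_swap, α.colour_swap, simpleSwap_lo_of_far h, simpleSwap_hi_of_far h]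

theorem mixed_swap_swap (h : i.1 + 1 = j.1 ∨ j.1 + 1 = i.1) (hm : Mixed α.1 i)
    (hm' : Mixed (α.swap i hm).1 j) :
    Mixed ((α.swap i hm).swap j hm').1 i ↔ Mixed α.1 j := by
  rw [Mixed, Shuffle.colour_swap, Shuffle.colour_swap, Shuffle.colour_swap, Shuffle.colour_swap,
    simpleSwap_simpleSwap_lo h.symm, simpleSwap_simpleSwap_hi h.symm]

theorem mixed_swap_of_adjacent (h : i.1 + 1 = j.1 ∨ j.1 + 1 = i.1) (hm : Mixed α.1 i)
    (hm' : ¬ Mixed α.1 j) : Mixed (α.swap i hm).1 j := by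
  rw [not_not] at hm'
  rw [Mixed, α.colour_swap, α.colour_swap]
  rcases h with h | h
  · rwa [← hi_eq_lo h, simpleSwap_hi, simpleSwap_of_ne (b := hi j)
      (lo_ne_hi_of_adjacent h).symm (hi_eq_lo h ▸ (lo_ne_hi j).symm), ← hm', ← hi_eq_lo h]
  · rwa [hi_eq_lo h, simpleSwap_lo, simpleSwap_of_ne (b := lo j)
      (hi_eq_lo h ▸ lo_ne_hi j) (lo_ne_hi_of_adjacent h), hm', hi_eq_lo h]

end ShuffleSwap

section Induced

variable {F : Type u} [Field F] {r n : ℕ}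
  {V : Fin r → Type u} [∀ k, AddCommGroup (V k)] [∀ k, Module F (V k)] (c : Fin r → F)
  {nh : Comp r n} {Y : Type u} [AddCommGroup Y] [Module F Y] (τ : AHat F nh →ₐ[F] Module.End F Y)

variable (V) in
/-- The simple transposition `s_j` of the `k`-th block, acting on both factors of `V(n̂) ⊗ Y`. -/
def blockS (k : Fin r) (j : Fin (nh.1 k - 1)) : Module.End F (VHat F V nh ⊗[F] Y) :=
  TensorProduct.map (permV F V (blockSwap nh k j))
    (τ (PiTensorProduct.singleAlgHom k (s F PUnit.{u + 1} j)))

variable (V) in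
/-- A polynomial generator acting on `V(n̂) ⊗ Y` as `1 ⊗ c_k y_j`. -/
def blockX (a : Σ k, Fin (nh.1 k)) : Module.End F (VHat F V nh ⊗[F] Y) :=
  TensorProduct.map 1 (c a.1 • τ (PiTensorProduct.singleAlgHom a.1 (x F PUnit.{u + 1} a.2)))

theorem blockS_coxeter (k : Fin r) : CoxeterRelations (blockS V τ k) where
  sq j := by
    simp only [blockS]
    rw [← TensorProduct.map_mul, (permV_coxeter nh k).sq, ← map_mul, ← map_mul, s_coxeter.sq,
      map_one, map_one, TensorProduct.map_one]
  comm i j h := by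
    simp only [blockS]
    rw [← TensorProduct.map_mul, ← TensorProduct.map_mul, (permV_coxeter nh k).comm _ _ h,
      ← map_mul, ← map_mul, ← map_mul, ← map_mul, s_coxeter.comm _ _ h]
  braid i j h := by
    simp only [blockS]
    simp only [← TensorProduct.map_mul, ← map_mul]
    rw [(permV_coxeter nh k).braid _ _ h, s_coxeter.braid _ _ h]

theorem blockS_comm_of_ne {k k' : Fin r} (h : k ≠ k') (j : Fin (nh.1 k - 1))
    (j' : Fin (nh.1 k' - 1)) :
    blockS V τ k j * blockS V τ k' j' = blockS V τ k' j' * blockS V τ k j := by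
  simp only [blockS]
  rw [← TensorProduct.map_mul, ← TensorProduct.map_mul, permV_comm_of_ne nh h, ← map_mul,
    ← map_mul, (commute_single h _ _).eq]

theorem single_x_comm (a b : Σ k, Fin (nh.1 k)) :
    Commute (PiTensorProduct.singleAlgHom (R := F) (A := fun k => DegAffine F (nh.1 k)) a.1
        (x F PUnit.{u + 1} a.2))
      (PiTensorProduct.singleAlgHom (R := F) (A := fun k => DegAffine F (nh.1 k)) b.1
        (x F PUnit.{u + 1} b.2)) := by
  obtain ⟨k, j⟩ := a
  obtain ⟨k', j'⟩ := b
  rcases eq_or_ne k k' with rfl | h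
  · rw [Commute, SemiconjBy, ← map_mul, ← map_mul, x_comm]
  · exact commute_single h _ _

theorem blockX_comm (a b : Σ k, Fin (nh.1 k)) :
    blockX V c τ a * blockX V c τ b = blockX V c τ b * blockX V c τ a := by
  simp only [blockX]
  rw [← TensorProduct.map_mul, ← TensorProduct.map_mul, smul_mul_smul_comm, smul_mul_smul_comm,
    ← map_mul, ← map_mul, (single_x_comm a b).eq, mul_comm (c a.1)]

theorem blockS_mul_blockX_lo (k : Fin r) (j : Fin (nh.1 k - 1)) :
    blockS V τ k j * blockX V c τ ⟨k, lo j⟩ = blockX V c τ ⟨k, hi j⟩ * blockS V τ k j -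
      TensorProduct.map (c k • permV F V (blockSwap nh k j)) 1 := by
  have hs : s F PUnit.{u + 1} j * x F PUnit.{u + 1} (lo j) =
      x F PUnit.{u + 1} (hi j) * s F PUnit.{u + 1} j - 1 := by
    rw [s_mul_x_lo]
    simp [ofG_punit]
  simp only [blockS, blockX]
  rw [← TensorProduct.map_mul, ← TensorProduct.map_mul, mul_smul_comm, smul_mul_assoc,
    ← map_mul, ← map_mul, ← map_mul, ← map_mul, hs, map_sub, map_sub, map_one, map_one, smul_sub,
    mul_one, one_mul, TensorProduct.map_smul_left, ← TensorProduct.map_smul_right]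
  refine @eq_sub_of_add_eq (VHat F V nh ⊗[F] Y →ₗ[F] VHat F V nh ⊗[F] Y) _ _ _ _ ?_
  rw [← TensorProduct.map_add_right, sub_add_cancel]

theorem blockS_mul_blockX_far (k : Fin r) (j : Fin (nh.1 k - 1)) {a : Σ k, Fin (nh.1 k)}
    (hlo : a ≠ ⟨k, lo j⟩) (hhi : a ≠ ⟨k, hi j⟩) :
    blockS V τ k j * blockX V c τ a = blockX V c τ a * blockS V τ k j := by
  obtain ⟨k', j'⟩ := a
  simp only [blockS, blockX]
  rw [← TensorProduct.map_mul, ← TensorProduct.map_mul, mul_smul_comm, smul_mul_assoc,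
    ← map_mul, ← map_mul, mul_one, one_mul]
  rcases eq_or_ne k k' with rfl | h
  · rw [← map_mul, ← map_mul, s_mul_x_far j j' (fun h => hlo (by rw [h])) fun h => hhi (by rw [h])]
  · rw [(commute_single h _ _).eq]

variable (F V Y nh) in
/-- The space of the module over the wreath Hecke algebra induced from `V(n̂) ⊗ Y`. -/
abbrev Induced : Type u := Shuffle nh → VHat F V nh ⊗[F] Y

variable (V) in
open Classical in
/-- The action of the simple transpositions on the induced module. The label of the block which
contains the positions `i` and `i + 1` is unique, see `indS_block`. -/
def indS (i : Fin (n - 1)) : Module.End F (Induced F V nh Y) :=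
  LinearMap.pi fun α =>
    if h : Mixed α.1 i then LinearMap.proj (α.swap i h)
    else blockS V τ (exists_of_not_mixed α i h).choose
      (exists_of_not_mixed α i h).choose_spec.choose ∘ₗ LinearMap.proj α

variable (V) in
/-- The action of the polynomial generators on the induced module. -/
def indX (b : Fin n) : Module.End F (Induced F V nh Y) :=
  LinearMap.pi fun α => blockX V c τ (α.1.symm b) ∘ₗ LinearMap.proj α

theorem indX_apply (b : Fin n) (f : Induced F V nh Y) (α : Shuffle nh) :
    indX V c τ b f α = blockX V c τ (α.1.symm b) (f α) := rfl

theorem indS_mixed {i : Fin (n - 1)} {α : Shuffle nh} (h : Mixed α.1 i) (f : Induced F V nh Y) :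
    indS V τ i f α = f (α.swap i h) := by
  simp only [indS, LinearMap.pi_apply, dif_pos h, LinearMap.proj_apply]

theorem indS_block {i : Fin (n - 1)} {α : Shuffle nh} {k : Fin r} {j : Fin (nh.1 k - 1)}
    (hlo : α.1 ⟨k, lo j⟩ = lo i) (hhi : α.1 ⟨k, hi j⟩ = hi i) (f : Induced F V nh Y) :
    indS V τ i f α = blockS V τ k j (f α) := by
  have hnot := not_mixed_of_same_block hlo hhi
  simp only [indS, LinearMap.pi_apply, dif_neg hnot, LinearMap.coe_comp, Function.comp_apply,
    LinearMap.proj_apply]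
  have hchoice := (exists_of_not_mixed α i hnot).choose_spec.choose_spec.1
  generalize (exists_of_not_mixed α i hnot).choose_spec.choose = j' at hchoice ⊢
  revert j'
  generalize (exists_of_not_mixed α i hnot).choose = k'
  intro j' hchoice
  have hsame := α.1.injective (hchoice.trans hlo.symm)
  obtain rfl : k' = k := congrArg Sigma.fst hsame
  have hloj : lo j' = lo j := by simpa using hsame
  obtain rfl : j' = j := Fin.ext (by simpa [lo] using hloj)
  rfl

theorem indS_sq (i : Fin (n - 1)) : indS V τ i * indS V τ i = 1 := by
  refine LinearMap.ext fun f => funext fun α => ?_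
  rw [Module.End.mul_apply, Module.End.one_apply]
  by_cases hm : Mixed α.1 i
  · rw [indS_mixed τ hm, indS_mixed τ (mixed_swap hm), α.swap_swap]
  · obtain ⟨k, j, hlo, hhi⟩ := exists_of_not_mixed α i hm
    rw [indS_block τ hlo hhi, indS_block τ hlo hhi, ← Module.End.mul_apply,
      (blockS_coxeter τ k).sq, Module.End.one_apply]

section Commutation

variable {i i' : Fin (n - 1)} (h : i.1 + 1 < i'.1 ∨ i'.1 + 1 < i.1) {α : Shuffle nh}
  (f : Induced F V nh Y)

include h

theorem indS_comm_of_mixed (hm : Mixed α.1 i) :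
    indS V τ i (indS V τ i' f) α = indS V τ i' (indS V τ i f) α := by
  rw [indS_mixed τ hm]
  by_cases hm' : Mixed α.1 i'
  · rw [indS_mixed τ hm', indS_mixed τ ((mixed_swap_of_far h.symm).2 hm),
      indS_mixed τ ((mixed_swap_of_far h).2 hm')]
    congr 1
    exact Subtype.ext (Equiv.ext fun a => (Equiv.congr_fun (simpleSwap_mul_comm h) (α.1 a)).symm)
  · obtain ⟨k, j, hlo, hhi⟩ := exists_of_not_mixed α i' hm'
    rw [indS_block τ hlo hhi, indS_mixed τ hm, indS_block τ (α := α.swap i hm) (k := k) (j := j)]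
    · rw [α.swap_apply, hlo, simpleSwap_lo_of_far h]
    · rw [α.swap_apply, hhi, simpleSwap_hi_of_far h]

theorem indS_comm_of_not_mixed (hm : ¬ Mixed α.1 i) (hm' : ¬ Mixed α.1 i') :
    indS V τ i (indS V τ i' f) α = indS V τ i' (indS V τ i f) α := by
  obtain ⟨k, j, hlo, hhi⟩ := exists_of_not_mixed α i hm
  obtain ⟨k', j', hlo', hhi'⟩ := exists_of_not_mixed α i' hm'
  rw [indS_block τ hlo hhi, indS_block τ hlo' hhi' f, indS_block τ hlo' hhi',
    indS_block τ hlo hhi, ← Module.End.mul_apply, ← Module.End.mul_apply]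
  congr 1
  rcases eq_or_ne k k' with rfl | hk
  · refine (blockS_coxeter τ k).comm _ _ ?_
    have hne {a b : Fin (nh.1 k)} (hab : (α.1 ⟨k, a⟩ : ℕ) ≠ α.1 ⟨k, b⟩) : a.1 ≠ b.1 :=
      fun e => hab (by rw [Fin.ext e])
    have hlolo := @hne (lo j) (lo j') (by rw [hlo, hlo']; simp only [lo]; omega)
    have hhilo := @hne (hi j) (lo j') (by rw [hhi, hlo']; simp only [lo, hi]; omega)
    have hlohi := @hne (lo j) (hi j') (by rw [hlo, hhi']; simp only [lo, hi]; omega)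
    simp only [lo, hi] at hlolo hhilo hlohi
    omega
  · exact blockS_comm_of_ne τ hk _ _

theorem indS_comm : indS V τ i * indS V τ i' = indS V τ i' * indS V τ i := by
  refine LinearMap.ext fun f => funext fun α => ?_
  rw [Module.End.mul_apply, Module.End.mul_apply]
  by_cases hm : Mixed α.1 i
  · exact indS_comm_of_mixed τ h f hm
  by_cases hm' : Mixed α.1 i'
  · exact (indS_comm_of_mixed τ h.symm f hm').symm
  · exact indS_comm_of_not_mixed τ h f hm hm'

end Commutation

section Braid

variable {i j : Fin (n - 1)} {α : Shuffle nh} (f : Induced F V nh Y)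

theorem indS_braid_of_mixed_of_not_mixed (h : i.1 + 1 = j.1 ∨ j.1 + 1 = i.1)
    (hm : Mixed α.1 i) (hm' : ¬ Mixed α.1 j) :
    indS V τ i (indS V τ j (indS V τ i f)) α = indS V τ j (indS V τ i (indS V τ j f)) α := by
  obtain ⟨k, m, hlo, hhi⟩ := exists_of_not_mixed α j hm'
  have hm₂ : Mixed (α.swap i hm).1 j := mixed_swap_of_adjacent h hm hm'
  rw [indS_mixed τ hm, indS_mixed τ hm₂, indS_block τ hlo hhi, indS_mixed τ hm,
    indS_mixed τ hm₂, indS_block τ (α := (α.swap i hm).swap j hm₂) (k := k) (j := m)]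
  · rw [Shuffle.swap_apply, Shuffle.swap_apply, hlo, simpleSwap_simpleSwap_lo h]
  · rw [Shuffle.swap_apply, Shuffle.swap_apply, hhi, simpleSwap_simpleSwap_hi h]

/-- Here `α` has the colours `a, b, a` in the positions concerned; exchanging the first two gives
`b, a, a`, the case of `indS_braid_of_mixed_of_not_mixed`. -/
theorem indS_braid_of_mixed_of_not_mixed_swap (h : i.1 + 1 = j.1 ∨ j.1 + 1 = i.1)
    (hm : Mixed α.1 i) (hm' : ¬ Mixed (α.swap i hm).1 j) :
    indS V τ i (indS V τ j (indS V τ i f)) α = indS V τ j (indS V τ i (indS V τ j f)) α := by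
  have hsq (i : Fin (n - 1)) (f : Induced F V nh Y) : indS V τ i (indS V τ i f) = f :=
    LinearMap.congr_fun (indS_sq τ i) f
  have hswap (f : Induced F V nh Y) : indS V τ i f (α.swap i hm) = f α := by
    rw [indS_mixed τ (mixed_swap hm), α.swap_swap]
  rw [indS_mixed τ hm, ← hswap (indS V τ j _),
    indS_braid_of_mixed_of_not_mixed τ _ h (mixed_swap hm) hm', hsq]

theorem indS_braid_of_mixed (h : i.1 + 1 = j.1) (hm : Mixed α.1 i) (hm' : Mixed α.1 j) :
    indS V τ i (indS V τ j (indS V τ i f)) α = indS V τ j (indS V τ i (indS V τ j f)) α := by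
  by_cases hm₂ : Mixed (α.swap i hm).1 j
  swap
  · exact indS_braid_of_mixed_of_not_mixed_swap τ f (.inl h) hm hm₂
  by_cases hm₂' : Mixed (α.swap j hm').1 i
  swap
  · exact (indS_braid_of_mixed_of_not_mixed_swap τ f (.inr h) hm' hm₂').symm
  rw [indS_mixed τ hm, indS_mixed τ hm', indS_mixed τ hm₂, indS_mixed τ hm₂',
    indS_mixed τ ((mixed_swap_swap (.inl h) hm hm₂).2 hm'),
    indS_mixed τ ((mixed_swap_swap (.inr h) hm' hm₂').2 hm)]
  congr 1
  exact Subtype.ext (Equiv.ext fun a => Equiv.congr_fun (simpleSwap_braid h) (α.1 a))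

theorem indS_braid_of_not_mixed (h : i.1 + 1 = j.1) (hm : ¬ Mixed α.1 i) (hm' : ¬ Mixed α.1 j) :
    indS V τ i (indS V τ j (indS V τ i f)) α = indS V τ j (indS V τ i (indS V τ j f)) α := by
  obtain ⟨k, m, hlo, hhi⟩ := exists_of_not_mixed α i hm
  obtain ⟨k', m', hlo', hhi'⟩ := exists_of_not_mixed α j hm'
  have hmid := α.1.injective ((hhi.trans (hi_eq_lo h)).trans hlo'.symm)
  obtain rfl : k = k' := congrArg Sigma.fst hmid
  have hsucc : hi m = lo m' := by simpa using hmid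
  have hbraid := LinearMap.congr_fun
    ((blockS_coxeter (V := V) τ k).braid m m' (congrArg Fin.val hsucc)) (f α)
  simp only [Module.End.mul_apply] at hbraid
  rw [indS_block τ hlo hhi, indS_block τ hlo' hhi', indS_block τ hlo hhi, hbraid,
    indS_block τ hlo' hhi', indS_block τ hlo hhi, indS_block τ hlo' hhi']

theorem indS_braid (h : i.1 + 1 = j.1) :
    indS V τ i * indS V τ j * indS V τ i = indS V τ j * indS V τ i * indS V τ j := by
  refine LinearMap.ext fun f => funext fun α => ?_
  simp only [Module.End.mul_apply]
  by_cases hm : Mixed α.1 i <;> by_cases hm' : Mixed α.1 j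
  · exact indS_braid_of_mixed τ f h hm hm'
  · exact indS_braid_of_mixed_of_not_mixed τ f (.inl h) hm hm'
  · exact (indS_braid_of_mixed_of_not_mixed τ f (.inr h) hm' hm).symm
  · exact indS_braid_of_not_mixed τ f h hm hm'

end Braid

theorem indS_coxeter : CoxeterRelations (indS (n := n) V τ) where
  sq := indS_sq τ
  comm _ _ h := indS_comm τ h
  braid _ _ h := indS_braid τ h

theorem indS_mul_indX_far (i : Fin (n - 1)) (b : Fin n) (hlo : b ≠ lo i) (hhi : b ≠ hi i) :
    indS V τ i * indX V c τ b = indX V c τ b * indS V τ i := by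
  refine LinearMap.ext fun f => funext fun α => ?_
  rw [Module.End.mul_apply, Module.End.mul_apply, indX_apply]
  by_cases hm : Mixed α.1 i
  · rw [indS_mixed τ hm, indS_mixed τ hm, indX_apply, α.swap_symm_apply, simpleSwap_of_ne hlo hhi]
  · obtain ⟨k, j, hloj, hhij⟩ := exists_of_not_mixed α i hm
    rw [indS_block τ hloj hhij, indS_block τ hloj hhij, indX_apply, ← Module.End.mul_apply,
      blockS_mul_blockX_far]
    · rfl
    · rw [ne_eq, Equiv.symm_apply_eq, hloj]
      exact hlo
    · rw [ne_eq, Equiv.symm_apply_eq, hhij]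
      exact hhi

variable {G : Type u} [Group G] (ρ : ∀ k, Representation F G (V k))

variable (Y) in
/-- The action of `G^n` on the induced module. -/
def indG (g : Fin n → G) : Module.End F (Induced F V nh Y) :=
  LinearMap.pi fun α => TensorProduct.map (labelAct ρ α.1 g) 1 ∘ₗ LinearMap.proj α

theorem indG_apply (g : Fin n → G) (f : Induced F V nh Y) (α : Shuffle nh) :
    indG Y ρ g f α = TensorProduct.map (labelAct ρ α.1 g) 1 (f α) := rfl

theorem indS_mul_indG (i : Fin (n - 1)) (g : Fin n → G) :
    indS V τ i * indG Y ρ g = indG Y ρ (fun m => g (simpleSwap i m)) * indS V τ i := by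
  refine LinearMap.ext fun f => funext fun α => ?_
  rw [Module.End.mul_apply, Module.End.mul_apply, indG_apply]
  by_cases hm : Mixed α.1 i
  · rw [indS_mixed τ hm, indS_mixed τ hm]
    rfl
  · obtain ⟨k, j, hlo, hhi⟩ := exists_of_not_mixed α i hm
    rw [indS_block τ hlo hhi, indS_block τ hlo hhi, indG_apply, ← Module.End.mul_apply,
      ← Module.End.mul_apply, blockS, ← TensorProduct.map_mul, ← TensorProduct.map_mul, mul_one,
      one_mul]
    congr 2
    refine LinearMap.ext fun v => ?_
    rw [Module.End.mul_apply, permV_labelAct, sigmaCongrRight_blockSwap_trans α.1 hlo hhi]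
    rfl

variable [Fintype G] {ρ}

variable (Y) in
theorem sum_indG_apply (i i' : Fin n) (f : Induced F V nh Y) (α : Shuffle nh) :
    (∑ h : G, indG Y ρ (Pi.mulSingle i h * Pi.mulSingle i' h⁻¹)) f α =
      TensorProduct.map (tAct ρ α.1 i i') 1 (f α) := by
  have hsum := map_sum (LinearMap.rTensorHom (R := F) Y) (fun h : G => labelAct ρ α.1
    (Pi.mulSingle i h * Pi.mulSingle i' h⁻¹)) Finset.univ
  refine Eq.trans ?_ (LinearMap.congr_fun hsum (f α)).symm
  rw [LinearMap.sum_apply, Finset.sum_apply, LinearMap.sum_apply]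
  rfl

variable {c} [∀ k, FiniteDimensional F (V k)] (hρ : SchurOrthogonality ρ c)

include hρ in
theorem indS_mul_indX (i : Fin (n - 1)) :
    indS V τ i * indX V c τ (lo i) = indX V c τ (hi i) * indS V τ i -
      ∑ h : G, indG Y ρ (Pi.mulSingle (lo i) h * Pi.mulSingle (hi i) h⁻¹) := by
  refine LinearMap.ext fun f => funext fun α => ?_
  rw [LinearMap.sub_apply, Pi.sub_apply, sum_indG_apply, Module.End.mul_apply,
    Module.End.mul_apply, indX_apply]
  by_cases hm : Mixed α.1 i
  · rw [indS_mixed τ hm, indS_mixed τ hm, indX_apply, α.swap_symm_apply, simpleSwap_lo,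
      tAct_of_colour_ne α.1 hρ hm, TensorProduct.map_zero_left, LinearMap.zero_apply, sub_zero]
  · obtain ⟨k, j, hlo, hhi⟩ := exists_of_not_mixed α i hm
    rw [indS_block τ hlo hhi, indS_block τ hlo hhi, indX_apply, ← hlo, ← hhi,
      Equiv.symm_apply_apply, Equiv.symm_apply_apply, tAct_of_block α.1 hρ k (lo_ne_hi j),
      ← Module.End.mul_apply, blockS_mul_blockX_lo, LinearMap.sub_apply]
    rfl

include hρ in
theorem affineRelations_induced :
    AffineRelations (G := G) (n := n) (B := Module.End F (Induced F V nh Y)) (indG Y ρ)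
      (indS V τ) (indX V c τ) where
  g_one := by
    refine LinearMap.ext fun f => funext fun α => ?_
    rw [indG_apply, labelAct_one, TensorProduct.map_one]
    rfl
  g_mul g g' := by
    refine LinearMap.ext fun f => funext fun α => ?_
    rw [Module.End.mul_apply, indG_apply, indG_apply, indG_apply, labelAct_mul,
      ← Module.End.mul_apply, ← TensorProduct.map_mul, mul_one]
  x_comm i j := by
    refine LinearMap.ext fun f => funext fun α => ?_
    rw [Module.End.mul_apply, Module.End.mul_apply, indX_apply, indX_apply, indX_apply, indX_apply,
      ← Module.End.mul_apply, blockX_comm]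
    rfl
  x_g i g := by
    refine LinearMap.ext fun f => funext fun α => ?_
    rw [Module.End.mul_apply, Module.End.mul_apply, indX_apply, indG_apply,
        indG_apply ρ g (indX V c τ i f), indX_apply,
      ← Module.End.mul_apply, ← Module.End.mul_apply, blockX, ← TensorProduct.map_mul,
      ← TensorProduct.map_mul, one_mul, one_mul, mul_one, mul_one]
  coxeter := indS_coxeter τ
  s_x := indS_mul_indX τ hρ
  s_x_far := indS_mul_indX_far c τ
  s_g := indS_mul_indG τ ρ

/-- The action of the wreath Hecke algebra on the induced module. -/
def inducedAct : Affine F G n →ₐ[F] Module.End F (Induced F V nh Y) :=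
  liftAffine F (affineRelations_induced τ hρ)

end Induced

section InducedModule

variable {F : Type u} [Field F] {G : Type u} [Group G] [Fintype G] {r n : ℕ}
  {V : Fin r → Type u} [∀ k, AddCommGroup (V k)] [∀ k, Module F (V k)]
  {ρ : ∀ k, Representation F G (V k)} {c : Fin r → F} (hρ : SchurOrthogonality ρ c)
  {Y : Comp r n → Type u} [∀ nh, AddCommGroup (Y nh)] [∀ nh, Module F (Y nh)]
  (τ : ∀ nh, AHat F nh →ₐ[F] Module.End F (Y nh))

/-- The module over the wreath Hecke algebra induced from a family of modules over the algebras
`A_{n̂,r}`. The Schur relations and the actions occur as parameters of the type because the module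
structure depends on them. -/
@[nolint unusedArguments]
def InducedModule (_ : SchurOrthogonality ρ c) (_ : ∀ nh, AHat F nh →ₐ[F] Module.End F (Y nh)) :
    Type u := ∀ nh, Induced F V nh (Y nh)

instance : AddCommGroup (InducedModule hρ τ) :=
  inferInstanceAs (AddCommGroup (∀ nh, Induced F V nh (Y nh)))

instance : Module F (InducedModule hρ τ) :=
  inferInstanceAs (Module F (∀ nh, Induced F V nh (Y nh)))

open Classical in
/-- The inclusion of a summand of the induced module. -/
def incl (nh : Comp r n) (α : Shuffle nh) : VHat F V nh ⊗[F] Y nh →ₗ[F] InducedModule hρ τ :=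
  LinearMap.single F (fun nh => Induced F V nh (Y nh)) nh ∘ₗ
    LinearMap.single F (fun _ : Shuffle nh => VHat F V nh ⊗[F] Y nh) α

theorem incl_same (nh : Comp r n) (α : Shuffle nh) (w : VHat F V nh ⊗[F] Y nh) :
    incl hρ τ nh α w nh α = w := by
  classical
  refine (congrFun (Pi.single_eq_same (M := fun nh => Induced F V nh (Y nh)) nh _) α).trans ?_
  exact Pi.single_eq_same (M := fun _ : Shuffle nh => VHat F V nh ⊗[F] Y nh) α w

theorem incl_of_ne {nh : Comp r n} {α β : Shuffle nh} (h : β ≠ α) (w : VHat F V nh ⊗[F] Y nh) :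
    incl hρ τ nh α w nh β = 0 := by
  classical
  refine (congrFun (Pi.single_eq_same (M := fun nh => Induced F V nh (Y nh)) nh _) β).trans ?_
  exact Pi.single_eq_of_ne (M := fun _ : Shuffle nh => VHat F V nh ⊗[F] Y nh) h w

theorem incl_of_comp_ne {nh mh : Comp r n} (h : mh ≠ nh) (α : Shuffle nh)
    (w : VHat F V nh ⊗[F] Y nh) : incl hρ τ nh α w mh = 0 := by
  classical
  exact Pi.single_eq_of_ne (M := fun nh => Induced F V nh (Y nh)) h _

variable {hρ τ} in
theorem eq_incl {u : InducedModule hρ τ} {nh : Comp r n} {α : Shuffle nh}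
    {w : VHat F V nh ⊗[F] Y nh} (hα : u nh α = w) (hβ : ∀ β, β ≠ α → u nh β = 0)
    (hmh : ∀ mh, mh ≠ nh → u mh = 0) : u = incl hρ τ nh α w := by
  refine funext fun mh => ?_
  rcases eq_or_ne mh nh with rfl | h
  · refine funext fun β => ?_
    rcases eq_or_ne β α with rfl | h
    · rw [hα, incl_same]
    · rw [hβ β h, incl_of_ne hρ τ h]
  · rw [hmh mh h, incl_of_comp_ne hρ τ h]

theorem sum_incl (u : InducedModule hρ τ) :
    ∑ x : Label r n, incl hρ τ x.1 x.2 (u x.1 x.2) = u := by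
  refine funext fun mh => funext fun β => ?_
  have hsum : (∑ x : Label r n, incl hρ τ x.1 x.2 (u x.1 x.2)) mh β =
      ∑ x : Label r n, incl hρ τ x.1 x.2 (u x.1 x.2) mh β :=
    (congrFun (Finset.sum_apply mh _ _) β).trans (Finset.sum_apply β _ _)
  rw [hsum, Finset.sum_eq_single ⟨mh, β⟩]
  · exact incl_same hρ τ mh β _
  · rintro ⟨nh, α⟩ _ hne
    rcases eq_or_ne mh nh with rfl | h
    · exact incl_of_ne hρ τ (fun h => hne (by rw [h])) _
    · rw [incl_of_comp_ne hρ τ h]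
      rfl
  · exact fun h => absurd (Finset.mem_univ _) h

/-- The equivariant map `v ↦ v ⊗ y` into a summand of the induced module. -/
def inclHom (nh : Comp r n) (α : Shuffle nh) (y : Y nh) :
    VHat F V nh →ₗ[F] InducedModule hρ τ :=
  incl hρ τ nh α ∘ₗ (TensorProduct.mk F (VHat F V nh) (Y nh)).flip y

theorem inclHom_apply (nh : Comp r n) (α : Shuffle nh) (y : Y nh) (v : VHat F V nh) :
    inclHom hρ τ nh α y v = incl hρ τ nh α (v ⊗ₜ y) := rfl

variable [∀ k, FiniteDimensional F (V k)]

instance [∀ nh, Module.Finite F (Y nh)] : Module.Finite F (InducedModule hρ τ) :=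
  haveI : ∀ nh : Comp r n, Finite (Shuffle nh) := fun nh =>
    Finite.of_injective (fun α => (⟨nh, α⟩ : Label r n)) fun _ _ h => by simpa using h
  inferInstanceAs (Module.Finite F (∀ nh, Induced F V nh (Y nh)))

instance : Module (Affine F G n) (InducedModule hρ τ) where
  smul a u := fun nh => inducedAct (τ nh) hρ a (u nh)
  one_smul u := funext fun nh => by
    change inducedAct (τ nh) hρ 1 (u nh) = u nh
    rw [map_one, Module.End.one_apply]
  mul_smul a b u := funext fun nh => by
    change inducedAct (τ nh) hρ (a * b) (u nh) = _
    rw [map_mul]; rfl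
  smul_zero _ := funext fun _ => map_zero _
  smul_add _ _ _ := funext fun _ => map_add _ _ _
  add_smul a b u := funext fun nh => by
    change inducedAct (τ nh) hρ (a + b) (u nh) = _
    rw [map_add]; rfl
  zero_smul u := funext fun nh => by
    change inducedAct (τ nh) hρ 0 (u nh) = _
    rw [map_zero]; rfl

theorem InducedModule.smul_apply (a : Affine F G n) (u : InducedModule hρ τ) (nh : Comp r n) :
    (a • u) nh = inducedAct (τ nh) hρ a (u nh) := rfl

instance : IsScalarTower F (Affine F G n) (InducedModule hρ τ) :=
  IsScalarTower.of_algebraMap_smul fun d u => funext fun nh => by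
    rw [InducedModule.smul_apply, AlgHom.commutes]; rfl

theorem ofG_smul_incl (g : Fin n → G) (nh : Comp r n) (α : Shuffle nh)
    (w : VHat F V nh ⊗[F] Y nh) : ofG F g • incl hρ τ nh α w =
      incl hρ τ nh α (TensorProduct.map (labelAct ρ α.1 g) 1 w) := by
  refine eq_incl ?_ (fun β h => ?_) (fun mh h => ?_)
  · rw [InducedModule.smul_apply, inducedAct, liftAffine_ofG, indG_apply, incl_same]
  · rw [InducedModule.smul_apply, inducedAct, liftAffine_ofG, indG_apply, incl_of_ne hρ τ h,
      map_zero]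
  · rw [InducedModule.smul_apply, incl_of_comp_ne hρ τ h, map_zero]

theorem x_smul_incl (nh : Comp r n) (α : Shuffle nh) (a : Σ k, Fin (nh.1 k))
    (w : VHat F V nh ⊗[F] Y nh) : x F G (α.1 a) • incl hρ τ nh α w =
      incl hρ τ nh α (blockX V c (τ nh) a w) := by
  refine eq_incl ?_ (fun β h => ?_) (fun mh h => ?_)
  · rw [InducedModule.smul_apply, inducedAct, liftAffine_x, indX_apply, incl_same,
      Equiv.symm_apply_apply]
  · rw [InducedModule.smul_apply, inducedAct, liftAffine_x, indX_apply, incl_of_ne hρ τ h, map_zero]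
  · rw [InducedModule.smul_apply, incl_of_comp_ne hρ τ h, map_zero]

theorem s_smul_incl {nh : Comp r n} {α : Shuffle nh} {i : Fin (n - 1)} {k : Fin r}
    {j : Fin (nh.1 k - 1)} (hlo : α.1 ⟨k, lo j⟩ = lo i) (hhi : α.1 ⟨k, hi j⟩ = hi i)
    (w : VHat F V nh ⊗[F] Y nh) :
    s F G i • incl hρ τ nh α w = incl hρ τ nh α (blockS V (τ nh) k j w) := by
  refine eq_incl ?_ (fun β h => ?_) (fun mh h => ?_)
  · rw [InducedModule.smul_apply, inducedAct, liftAffine_s, indS_block _ hlo hhi, incl_same]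
  · rw [InducedModule.smul_apply, inducedAct, liftAffine_s]
    by_cases hm : Mixed β.1 i
    · rw [indS_mixed _ hm, incl_of_ne hρ τ]
      rintro rfl
      exact not_mixed_of_same_block hlo hhi (mixed_swap hm)
    · obtain ⟨k', j', hlo', hhi'⟩ := exists_of_not_mixed β i hm
      rw [indS_block _ hlo' hhi', incl_of_ne hρ τ h, map_zero]
  · rw [InducedModule.smul_apply, incl_of_comp_ne hρ τ h, map_zero]

theorem inclHom_equivariant (nh : Comp r n) (α : Shuffle nh) (y : Y nh) :
    LabelEquivariant ρ α.1 (inclHom hρ τ nh α y) := fun g v => by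
  rw [inclHom_apply, inclHom_apply, ofG_smul_incl]
  rfl

variable (F V) in
/-- Contraction of the first factor of `V(n̂) ⊗ X` by a coordinate functional. -/
def contract {nh : Comp r n} (q : HatIndex F V nh) (X : Type u) [AddCommGroup X] [Module F X] :
    VHat F V nh ⊗[F] X →ₗ[F] X :=
  TensorProduct.lift ((LinearMap.lsmul F X) ∘ₗ (hatBasis F V nh).coord q)

theorem contract_tmul {nh : Comp r n} (q : HatIndex F V nh) {X : Type u} [AddCommGroup X]
    [Module F X] (v : VHat F V nh) (y : X) :
    contract F V q X (v ⊗ₜ y) = (hatBasis F V nh).coord q v • y := rfl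

theorem matUnit_smul_incl_same (nh : Comp r n) (α : Shuffle nh) (q : HatIndex F V nh)
    (v : VHat F V nh) (w : VHat F V nh ⊗[F] Y nh) :
    matUnit ρ α.1 c q v • incl hρ τ nh α w = incl hρ τ nh α (v ⊗ₜ contract F V q (Y nh) w) := by
  induction w using TensorProduct.induction_on with
  | zero => simp only [map_zero, smul_zero, TensorProduct.tmul_zero]
  | tmul u y =>
    rw [contract_tmul, TensorProduct.tmul_smul, map_smul]
    exact matUnit_smul_same hρ (inclHom_equivariant hρ τ nh α y) q v u
  | add w w' h h' => rw [map_add, smul_add, h, h', map_add, TensorProduct.tmul_add, map_add]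

theorem matUnit_smul_incl_of_colour_ne {nh mh : Comp r n} (α : Shuffle nh) (β : Shuffle mh)
    (hne : colour α.1 ≠ colour β.1) (q : HatIndex F V nh)
    (v : VHat F V nh) (w : VHat F V mh ⊗[F] Y mh) :
    matUnit ρ α.1 c q v • incl hρ τ mh β w = 0 := by
  induction w using TensorProduct.induction_on with
  | zero => simp only [map_zero, smul_zero]
  | tmul u y => exact matUnit_smul_of_colour_ne hρ (inclHom_equivariant hρ τ mh β y) hne q v u
  | add w w' h h' => rw [map_add, smul_add, h, h', add_zero]

theorem matUnit_smul_induced (nh : Comp r n) (α : Shuffle nh) (q : HatIndex F V nh)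
    (v : VHat F V nh) (u : InducedModule hρ τ) :
    matUnit ρ α.1 c q v • u = incl hρ τ nh α (v ⊗ₜ contract F V q (Y nh) (u nh α)) := by
  conv_lhs => rw [← sum_incl hρ τ u, Finset.smul_sum]
  rw [Finset.sum_eq_single ⟨nh, α⟩]
  · exact matUnit_smul_incl_same hρ τ nh α q v _
  · rintro y _ hne
    exact matUnit_smul_incl_of_colour_ne hρ τ α y.2
      (fun h => hne (Label.ext_colour (x := y) (y := ⟨nh, α⟩) h.symm)) q v _
  · exact fun h => absurd (Finset.mem_univ _) h

variable (F V) in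
theorem nonempty_hatIndex [∀ k, Nontrivial (V k)] (nh : Comp r n) : Nonempty (HatIndex F V nh) :=
  ⟨fun _ => ⟨0, Module.finrank_pos⟩⟩

/-- The unit of the induction: the vectors of `Y n̂` as homomorphisms into the induced module. -/
def unitHom (nh : Comp r n) : Y nh →ₗ[F] HomHat ρ (InducedModule hρ τ) nh where
  toFun y := ⟨inclHom hρ τ nh (placeShuffle nh) y,
    (mem_homHat_iff hρ _).2 (inclHom_equivariant hρ τ nh (placeShuffle nh) y)⟩
  map_add' y y' := Subtype.ext (LinearMap.ext fun v => by
    change incl hρ τ nh _ (v ⊗ₜ (y + y')) = incl hρ τ nh _ (v ⊗ₜ y) + incl hρ τ nh _ (v ⊗ₜ y')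
    rw [TensorProduct.tmul_add, map_add])
  map_smul' d y := Subtype.ext (LinearMap.ext fun v => by
    change incl hρ τ nh _ (v ⊗ₜ (d • y)) = d • incl hρ τ nh _ (v ⊗ₜ y)
    rw [TensorProduct.tmul_smul, map_smul])

theorem unitHom_apply (nh : Comp r n) (y : Y nh) (v : VHat F V nh) :
    (unitHom hρ τ nh y).1 v = incl hρ τ nh (placeShuffle nh) (v ⊗ₜ y) := rfl

theorem unitHom_bijective [∀ k, Nontrivial (V k)] (nh : Comp r n) :
    Function.Bijective (unitHom hρ τ nh) := by
  obtain ⟨q⟩ := nonempty_hatIndex F V nh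
  have hq : (hatBasis F V nh).coord q (hatBasis F V nh q) = 1 := by simp
  constructor
  · refine (injective_iff_map_eq_zero _).2 fun y hy => ?_
    have hcontract := congrArg (fun φ : HomHat ρ (InducedModule hρ τ) nh =>
      contract F V q (Y nh) (φ.1 (hatBasis F V nh q) nh (placeShuffle nh))) hy
    simp only [unitHom_apply, incl_same] at hcontract
    rw [contract_tmul, hq, one_smul] at hcontract
    exact hcontract.trans (map_zero _)
  · intro φ
    refine ⟨contract F V q (Y nh) (φ.1 (hatBasis F V nh q) nh (placeShuffle nh)),
      Subtype.ext (LinearMap.ext fun v => ?_)⟩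
    rw [unitHom_apply, ← matUnit_smul_induced]
    have hunit := matUnit_smul_same hρ ((mem_homHat_iff hρ _).1 φ.2) q v (hatBasis F V nh q)
    rw [hq, one_smul] at hunit
    exact hunit

theorem unitHom_apply_act (nh : Comp r n) (a : AHat F nh) (y : Y nh) :
    unitHom hρ τ nh (τ nh a y) = homAct hρ _ nh a (unitHom hρ τ nh y) := by
  refine AHat.map_apply_of_generators _ _ _ (fun k j y => ?_) (fun k j y => ?_) a y
  · rw [homAct_s]
    refine Subtype.ext (LinearMap.ext fun v => ?_)
    rw [homS_apply, unitHom_apply, unitHom_apply, s_smul_incl hρ τ (place_lo_eq nh k j)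
      (place_hi_eq nh k j), blockS, TensorProduct.map_tmul, ← Module.End.mul_apply (permV F V _),
      (permV_coxeter nh k).sq, Module.End.one_apply]
  · rw [homAct_y]
    refine Subtype.ext (LinearMap.ext fun v => ?_)
    rw [homY_apply, unitHom_apply, unitHom_apply]
    refine Eq.trans ?_ (congrArg _ (x_smul_incl hρ τ nh (placeShuffle nh) ⟨k, j⟩ _)).symm
    rw [blockX, TensorProduct.map_tmul, LinearMap.smul_apply, TensorProduct.tmul_smul, map_smul,
      inv_smul_smul₀ (hρ.ne_zero k), Module.End.one_apply]

end InducedModule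

section Summands

variable {F : Type u} [Field F] {r n : ℕ}

open Classical in
variable (F) in
/-- The element of `A_{n,r}` whose only non-zero component is `a`, at `n̂`; for `a = 1` it is the
central idempotent that cuts out the factor at `n̂`. -/
def factor (nh : Comp r n) (a : AHat F nh) : A F r n :=
  Pi.single (M := fun nh : Comp r n => AHat F nh) nh a

theorem factor_mul (nh : Comp r n) (a b : AHat F nh) :
    factor F nh (a * b) = factor F nh a * factor F nh b := Pi.single_mul _ _ _

theorem factor_mul_eq_factor (nh : Comp r n) (b : AHat F nh) (a : A F r n) :
    factor F nh b * a = factor F nh (b * a nh) := (Pi.single_mul_left _).symm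

theorem factor_mul_of_ne {nh mh : Comp r n} (h : nh ≠ mh) (a : AHat F nh) (b : AHat F mh) :
    factor F nh a * factor F mh b = 0 := by
  rw [factor_mul_eq_factor, factor, factor, Pi.single_eq_of_ne h, mul_zero, Pi.single_zero]

theorem sum_factor : ∑ nh : Comp r n, factor F nh 1 = (1 : A F r n) := by
  classical
  exact Finset.univ_sum_single (M := fun nh : Comp r n => AHat F nh) (1 : A F r n)

variable (F) (N : Type u) [AddCommGroup N] [Module F N] [Module (A F r n) N]
  [IsScalarTower F (A F r n) N]

/-- The summand of a module over `A_{n,r}` that belongs to a factor. -/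
def summand (nh : Comp r n) : Submodule F N :=
  LinearMap.range (Algebra.lsmul F F N (factor F nh 1))

theorem mem_summand {nh : Comp r n} {u : N} : u ∈ summand F N nh ↔ factor F nh 1 • u = u := by
  constructor
  · rintro ⟨w, rfl⟩
    change factor F nh 1 • factor F nh 1 • w = factor F nh 1 • w
    rw [← mul_smul, ← factor_mul, mul_one]
  · exact fun h => ⟨u, h⟩

theorem factor_smul_mem (nh : Comp r n) (a : AHat F nh) (u : N) :
    factor F nh a • u ∈ summand F N nh := by
  rw [mem_summand, ← mul_smul, ← factor_mul, one_mul]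

/-- The action of a factor of `A_{n,r}` on its summand. -/
def summandAct (nh : Comp r n) : AHat F nh →ₐ[F] Module.End F (summand F N nh) :=
  AlgHom.ofLinearMap
    { toFun := fun a => LinearMap.restrict (Algebra.lsmul F F N (factor F nh a))
        fun u _ => factor_smul_mem F N nh a u
      map_add' := fun a b => LinearMap.ext fun u => Subtype.ext (by
        change factor F nh (a + b) • u.1 = factor F nh a • u.1 + factor F nh b • u.1
        rw [factor, Pi.single_add, add_smul]; rfl)
      map_smul' := fun d a => LinearMap.ext fun u => Subtype.ext (by
        change factor F nh (d • a) • u.1 = d • factor F nh a • u.1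
        rw [factor, Pi.single_smul, smul_assoc]; rfl) }
    (LinearMap.ext fun u => Subtype.ext ((mem_summand F N).1 u.2))
    (fun a b => LinearMap.ext fun u => Subtype.ext (by
      change factor F nh (a * b) • u.1 = factor F nh a • factor F nh b • u.1
      rw [factor_mul, mul_smul]))

theorem summandAct_apply (nh : Comp r n) (a : AHat F nh) (u : summand F N nh) :
    (summandAct F N nh a u).1 = factor F nh a • u.1 := rfl

/-- The projection onto a summand. -/
def summandProj (nh : Comp r n) : N →ₗ[F] summand F N nh :=
  (Algebra.lsmul F F N (factor F nh 1)).codRestrict _ fun u => factor_smul_mem F N nh 1 u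

theorem summandProj_apply (nh : Comp r n) (u : N) :
    (summandProj F N nh u).1 = factor F nh 1 • u := rfl

theorem summandProj_smul (nh : Comp r n) (a : A F r n) (u : N) :
    summandProj F N nh (a • u) = summandAct F N nh (a nh) (summandProj F N nh u) :=
  Subtype.ext (by
    rw [summandProj_apply, summandAct_apply, summandProj_apply, ← mul_smul, ← mul_smul,
      factor_mul_eq_factor, ← factor_mul, one_mul, mul_one])

theorem summandProj_bijective :
    Function.Bijective (LinearMap.pi (summandProj F (r := r) (n := n) N)) := by
  constructor
  · refine (injective_iff_map_eq_zero _).2 fun u hu => ?_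
    rw [← one_smul (A F r n) u, ← sum_factor, Finset.sum_smul]
    exact Finset.sum_eq_zero fun nh _ => congrArg Subtype.val (congrFun hu nh)
  · intro y
    refine ⟨∑ nh, (y nh).1, funext fun nh => Subtype.ext ?_⟩
    rw [LinearMap.pi_apply, summandProj_apply, Finset.smul_sum, Finset.sum_eq_single nh]
    · exact (mem_summand F N).1 (y nh).2
    · intro mh _ h
      rw [← (mem_summand F N).1 (y mh).2, ← mul_smul, factor_mul_of_ne h.symm, zero_smul]
    · exact fun h => absurd (Finset.mem_univ _) h

end Summands

section EssSurj

variable {F : Type u} [Field F] {G : Type u} [Group G] [Fintype G] {r n : ℕ}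
  {V : Fin r → Type u} [∀ k, AddCommGroup (V k)] [∀ k, Module F (V k)]
  [∀ k, FiniteDimensional F (V k)]
  {ρ : ∀ k, Representation F G (V k)} {c : Fin r → F}

section

variable (hρ : SchurOrthogonality ρ c)

section

variable (n) (N : Type u) [AddCommGroup N] [Module F N]
  [Module (A F r n) N] [IsScalarTower F (A F r n) N]

/-- The module over the wreath Hecke algebra which corresponds to a module over `A_{n,r}`. -/
abbrev InducedFrom : Type u := InducedModule hρ fun nh : Comp r n => summandAct F N nh

/-- The vectors of a module over `A_{n,r}` as families of homomorphisms. -/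
def unitLinear : N →ₗ[A F r n] HomSpace n ρ (InducedFrom n hρ N) hρ where
  toFun u := fun nh => unitHom hρ (fun nh : Comp r n => summandAct F N nh) nh
    (summandProj F N nh u)
  map_add' u w := funext fun nh => by
    rw [map_add, map_add]; rfl
  map_smul' a u := funext fun nh => by
    rw [summandProj_smul, unitHom_apply_act]; rfl

theorem unitLinear_bijective [∀ k, Nontrivial (V k)] : Function.Bijective (unitLinear n hρ N) :=
  (Function.Bijective.piMap fun nh =>
    unitHom_bijective hρ (fun nh : Comp r n => summandAct F N nh) nh).comp
      (summandProj_bijective F N)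

end

/-- Isomorphic modules have isomorphic spaces of homomorphisms. -/
def homSpaceEquiv {M N : Type u} [AddCommGroup M] [Module F M] [Module (Affine F G n) M]
    [IsScalarTower F (Affine F G n) M] [AddCommGroup N] [Module F N] [Module (Affine F G n) N]
    [IsScalarTower F (Affine F G n) N] (e : M ≃ₗ[Affine F G n] N) :
    HomSpace n ρ M hρ ≃ₗ[A F r n] HomSpace n ρ N hρ :=
  LinearEquiv.ofLinearMap (homSpaceMap hρ e.toLinearMap) (homSpaceMap hρ e.symm.toLinearMap)
    (LinearMap.ext fun u => funext fun nh => Subtype.ext (LinearMap.ext fun v =>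
      e.apply_symm_apply ((u nh).1 v)))
    (LinearMap.ext fun u => funext fun nh => Subtype.ext (LinearMap.ext fun v =>
      e.symm_apply_apply ((u nh).1 v)))

theorem homFunctor_essImage {M : Type u} [AddCommGroup M] [Module F M] [Module (Affine F G n) M]
    [IsScalarTower F (Affine F G n) M] {N : FDMod F (A F r n)} {X : FDMod F (Affine F G n)}
    (e : M ≃ₗ[Affine F G n] X.obj) (e' : N.obj ≃ₗ[A F r n] HomSpace n ρ M hρ) :
    (homFunctor (n := n) hρ).essImage N :=
  ⟨X, ⟨ObjectProperty.isoMk _ (e'.trans (homSpaceEquiv hρ e)).symm.toModuleIso⟩⟩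

end

variable (hρ : SchurRelations ρ c)

theorem homFunctor_essSurj : (homFunctor (n := n) hρ.toSchurOrthogonality).EssSurj where
  mem_essImage N := by
    have := N.property
    have := hρ.nontrivial
    exact homFunctor_essImage hρ.toSchurOrthogonality
      (X := FDMod.of (Affine F G n) (InducedFrom n hρ.toSchurOrthogonality N.obj))
      (LinearEquiv.refl _ _) (LinearEquiv.ofBijective _ (unitLinear_bijective n _ N.obj))

theorem homFunctor_isEquivalence :
    (homFunctor (n := n) hρ.toSchurOrthogonality).IsEquivalence where
  faithful := homFunctor_faithful hρ
  full := homFunctor_full hρ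
  essSurj := homFunctor_essSurj hρ

end EssSurj

section Category

universe v₁ v₂ v₃ v₄ u₁ u₂ u₃ u₄

variable {C : Type u₁} [Category.{v₁} C] {D : Type u₂} [Category.{v₂} D] {C' : Type u₃}
  [Category.{v₃} C'] {D' : Type u₄} [Category.{v₄} D']

theorem exists_equivalence_of_essImage (T : C ⥤ D) [T.IsEquivalence] (I : C' ⥤ C) [I.Full]
    [I.Faithful] (J : D' ⥤ D) [J.Full] [J.Faithful]
    (h : ∀ X : C, I.essImage X ↔ J.essImage (T.obj X)) :
    ∃ T' : C' ≌ D', Nonempty (T'.functor ⋙ J ≅ I ⋙ T) := by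
  have hJ : ∀ X : C', J.essImage ((I ⋙ T).obj X) := fun X => (h _).1 (I.obj_mem_essImage X)
  let S : C' ⥤ D' := Functor.essImage.liftFunctor (I ⋙ T) J hJ
  let e : S ⋙ J ≅ I ⋙ T := Functor.essImage.liftFunctorCompIso (I ⋙ T) J hJ
  have : S.Faithful := Functor.Faithful.of_comp_iso e
  have : S.Full := Functor.Full.of_comp_faithful_iso e
  have : S.EssSurj := ⟨fun Y => by
    let i := T.objObjPreimageIso (J.obj Y)
    obtain ⟨X, ⟨a⟩⟩ := (h (T.objPreimage (J.obj Y))).2 ((J.obj_mem_essImage Y).ofIso i.symm)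
    exact ⟨X, ⟨J.preimageIso (e.app X ≪≫ T.mapIso a ≪≫ i)⟩⟩⟩
  have : S.IsEquivalence := { }
  exact ⟨S.asEquivalence, ⟨e⟩⟩

end Category

section Inflation

variable {F : Type u} [Field F] {B C : Type u} [Ring B] [Algebra F B] [Ring C] [Algebra F C]
  (f : B →ₐ[F] C)

instance : (inflation F f).Faithful where
  map_injective {X Y} g g' h := by
    refine ObjectProperty.hom_ext _ (ModuleCat.hom_ext (LinearMap.ext fun u => ?_))
    exact congrArg (fun k : (inflation F f).obj X ⟶ (inflation F f).obj Y => k.hom.hom u) h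

variable {f}

theorem inflation_full (hf : Function.Surjective f) : (inflation F f).Full where
  map_surjective {X Y} g := by
    let g' : X.obj →ₗ[C] Y.obj :=
      { toFun := fun u => g.hom.hom u
        map_add' := fun u w => g.hom.hom.map_add u w
        map_smul' := fun c u => by
          obtain ⟨b, rfl⟩ := hf c
          exact g.hom.hom.map_smul b u }
    exact ⟨ObjectProperty.homMk (ModuleCat.ofHom g'), rfl⟩

theorem smul_eq_zero_of_mem_essImage_inflation {N : FDMod F B} (hN : (inflation F f).essImage N)
    {b : B} (hb : f b = 0) (u : N.obj) : b • u = 0 := by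
  obtain ⟨X, ⟨e⟩⟩ := hN
  let i : ((inflation F f).obj X).obj ≅ N.obj := (ObjectProperty.ι _).mapIso e
  have hzero (w : ((inflation F f).obj X).obj) : b • w = 0 := by
    change f b • (show X.obj from w) = 0
    rw [hb, zero_smul]
  rw [← i.toLinearEquiv.apply_symm_apply u, ← map_smul, hzero, map_zero]

section Descent

variable (hf : Function.Surjective f) {N : FDMod F B} (h : ∀ b, f b = 0 → ∀ u : N.obj, b • u = 0)

include h in
theorem ker_le_ker_toAddMonoidEnd :
    RingHom.ker f.toRingHom ≤ RingHom.ker (Module.toAddMonoidEnd B N.obj) := fun b hb =>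
  AddMonoidHom.ext fun u => h b hb u

/-- The action of `C` on a `B`-module that is annihilated by the kernel of `f : B → C`. -/
def descent : C →+* AddMonoid.End N.obj :=
  f.toRingHom.liftOfSurjective hf ⟨_, ker_le_ker_toAddMonoidEnd h⟩

theorem descent_apply (b : B) (u : N.obj) : descent hf h (f b) u = b • u :=
  DFunLike.congr_fun (f.toRingHom.liftOfRightInverse_comp_apply _
    (Function.rightInverse_surjInv hf) ⟨_, ker_le_ker_toAddMonoidEnd h⟩ b) u

/-- A `B`-module that is annihilated by the kernel of `f : B → C`, as a `C`-module. -/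
def descentModule : FDMod F C where
  obj := @ModuleCat.of C _ N.obj _ (Module.compHom N.obj (descent hf h))
  property := by
    have := N.property
    let toDescent : N.obj →ₗ[F] @ModuleCat.of C _ N.obj _ (Module.compHom N.obj (descent hf h)) :=
      { toFun := fun u => u
        map_add' := fun _ _ => rfl
        map_smul' := fun d u => by
          change algebraMap F B d • u = descent hf h (algebraMap F C d) u
          rw [← f.commutes, descent_apply] }
    exact Module.Finite.of_surjective toDescent fun u => ⟨u, rfl⟩

/-- Inflation undoes descent. -/
def inflationDescentEquiv : ((inflation F f).obj (descentModule hf h)).obj ≃ₗ[B] N.obj where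
  toFun u := u
  invFun u := u
  left_inv _ := rfl
  right_inv _ := rfl
  map_add' _ _ := rfl
  map_smul' b u := descent_apply hf h b u

end Descent

theorem inflation_essImage_iff (hf : Function.Surjective f) (N : FDMod F B) :
    (inflation F f).essImage N ↔ ∀ b, f b = 0 → ∀ u : N.obj, b • u = 0 :=
  ⟨fun hN _ hb u => smul_eq_zero_of_mem_essImage_inflation hN hb u, fun h =>
    ⟨descentModule hf h, ⟨ObjectProperty.isoMk _ (inflationDescentEquiv hf h).toModuleIso⟩⟩⟩

end Inflation

section TensorMap

variable {F : Type u} [Field F] {ι : Type} {B C : ι → Type u} [∀ i, Ring (B i)]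
  [∀ i, Algebra F (B i)] [∀ i, Ring (C i)] [∀ i, Algebra F (C i)] (f : ∀ i, B i →ₐ[F] C i)

theorem tensorMap_tprod (b : ∀ i, B i) :
    tensorMap F f (PiTensorProduct.tprod F b) = PiTensorProduct.tprod F fun i => f i (b i) := by
  rw [tensorMap, PiTensorProduct.liftAlgHom_apply, PiTensorProduct.lift.tprod,
    MultilinearMap.compLinearMap_apply]
  rfl

variable {f} in
theorem tensorMap_surjective (hf : ∀ i, Function.Surjective (f i)) :
    Function.Surjective (tensorMap F f) := fun c => by
  induction c using PiTensorProduct.induction_on with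
  | smul_tprod d c =>
    choose b hb using fun i => hf i (c i)
    exact ⟨d • PiTensorProduct.tprod F b, by rw [map_smul, tensorMap_tprod, funext hb]⟩
  | add c c' h h' =>
    obtain ⟨b, rfl⟩ := h
    obtain ⟨b', rfl⟩ := h'
    exact ⟨b + b', map_add _ _ _⟩

theorem tensorMap_single [DecidableEq ι] (i : ι) (b : B i) :
    tensorMap F f (PiTensorProduct.singleAlgHom i b) =
      PiTensorProduct.singleAlgHom i (f i b) := by
  rw [PiTensorProduct.singleAlgHom_apply, PiTensorProduct.singleAlgHom_apply, tensorMap_tprod]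
  exact congrArg _ (funext fun j =>
    Pi.apply_mulSingle (fun j => f j) (fun j => map_one (f j)) i b j)

end TensorMap

section Quotients

variable (F : Type u) [Field F] (p : ℕ) [Fact p.Prime] [CharP F p] (G : Type u) [Group G]
  [Fintype G]

theorem toCyc_surjective (n : ℕ) (lam : ZMod p → ℕ) : Function.Surjective (toCyc F p G n lam) :=
  RingQuot.mkAlgHom_surjective F _

theorem toACyc_surjective (r n : ℕ) (mu : Fin r → ZMod p → ℕ) :
    Function.Surjective (toACyc F r n p mu) := fun c => by
  choose b hb using fun nh : Comp r n => tensorMap_surjective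
    (fun k => toCyc_surjective F p PUnit.{u + 1} (nh.1 k) (mu k)) (c nh)
  exact ⟨b, funext hb⟩

variable {F p G}

/-- A homomorphism from the wreath Hecke algebra which respects the cyclotomic relation. -/
def liftCyc {n : ℕ} {lam : ZMod p → ℕ} {B : Type*} [Ring B] [Algebra F B]
    (f : Affine F G n →ₐ[F] B)
    (h : ∀ i : Fin n, i.1 = 0 → f (aeval (x F G i) (cycPoly F p lam)) = 0) :
    Cyc F p G n lam →ₐ[F] B :=
  RingQuot.liftAlgHom F ⟨f, by
    rintro _ _ ⟨i, hi⟩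
    rw [h i hi, map_zero]⟩

theorem liftCyc_toCyc {n : ℕ} {lam : ZMod p → ℕ} {B : Type*} [Ring B] [Algebra F B]
    (f : Affine F G n →ₐ[F] B)
    (h : ∀ i : Fin n, i.1 = 0 → f (aeval (x F G i) (cycPoly F p lam)) = 0)
    (a : Affine F G n) : liftCyc f h (toCyc F p G n lam a) = f a :=
  RingQuot.liftAlgHom_mkAlgHom_apply _ _ _ _

theorem toCyc_cycPoly {n : ℕ} (lam : ZMod p → ℕ) (i : Fin n) (h : i.1 = 0) :
    toCyc F p G n lam (aeval (x F G i) (cycPoly F p lam)) = 0 :=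
  (RingQuot.mkAlgHom_rel F (CycRel.g_lam i h)).trans (map_zero _)

theorem inflation_cyc_essImage_iff {n : ℕ} (lam : ZMod p → ℕ) (M : FDMod F (Affine F G n)) :
    (inflation F (toCyc F p G n lam)).essImage M ↔ ∀ i : Fin n, i.1 = 0 → ∀ m : M.obj,
      aeval (x F G i) (cycPoly F p lam) • m = 0 := by
  rw [inflation_essImage_iff (toCyc_surjective F p G n lam)]
  refine ⟨fun h i hi => h _ (toCyc_cycPoly lam i hi), fun h b hb m => ?_⟩
  have hlift := liftCyc_toCyc (lam := lam) (Algebra.lsmul F F M.obj)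
    (fun i hi => LinearMap.ext fun m => h i hi m) b
  rw [hb, map_zero] at hlift
  exact (LinearMap.congr_fun hlift m).symm

theorem eq_zero_of_tensorMap_eq_zero {r n : ℕ} {mu : Fin r → ZMod p → ℕ} {nh : Comp r n}
    {B : Type*} [Ring B] [Algebra F B] (τ : AHat F nh →ₐ[F] B)
    (h : ∀ (k : Fin r) (j : Fin (nh.1 k)), j.1 = 0 → τ (PiTensorProduct.singleAlgHom k
      (aeval (x F PUnit.{u + 1} j) (cycPoly F p (mu k)))) = 0)
    {b : AHat F nh}
    (hb : tensorMap F (fun k => toCyc F p PUnit.{u + 1} (nh.1 k) (mu k)) b = 0) : τ b = 0 := by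
  let f : ∀ k, DegCyc F p (nh.1 k) (mu k) →ₐ[F] B := fun k =>
    liftCyc (τ.comp (PiTensorProduct.singleAlgHom (A := fun k => DegAffine F (nh.1 k)) k)) (h k)
  have hf (k) (a) : f k (toCyc F p PUnit.{u + 1} (nh.1 k) (mu k) a) =
      τ (PiTensorProduct.singleAlgHom k a) := liftCyc_toCyc _ _ a
  have hcomm : ∀ k l, k ≠ l → ∀ a b, Commute (f k a) (f l b) := fun k l hkl a b => by
    obtain ⟨a, rfl⟩ := toCyc_surjective F p _ _ _ a
    obtain ⟨b, rfl⟩ := toCyc_surjective F p _ _ _ b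
    rw [hf, hf]
    exact (commute_single hkl a b).map τ
  have hlift : (liftCommuting f hcomm).comp
      (tensorMap F fun k => toCyc F p PUnit.{u + 1} (nh.1 k) (mu k)) = τ := by
    refine PiTensorProduct.algHom_ext fun k => AlgHom.ext fun a => ?_
    rw [AlgHom.comp_apply, AlgHom.comp_apply, tensorMap_single, liftCommuting_single, hf]
    rfl
  rw [← hlift, AlgHom.comp_apply, hb, map_zero]

theorem inflation_aCyc_essImage_iff {r n : ℕ} (mu : Fin r → ZMod p → ℕ) (N : FDMod F (A F r n)) :
    (inflation F (toACyc F r n p mu)).essImage N ↔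
      ∀ (nh : Comp r n) (k : Fin r) (j : Fin (nh.1 k)), j.1 = 0 → ∀ u : N.obj,
        factor F nh (PiTensorProduct.singleAlgHom k
          (aeval (x F PUnit.{u + 1} j) (cycPoly F p (mu k)))) • u = 0 := by
  rw [inflation_essImage_iff (toACyc_surjective F p r n mu)]
  constructor
  · intro h nh k j hj
    refine h _ (funext fun mh => ?_)
    change tensorMap F _ (factor F nh _ mh) = 0
    rcases eq_or_ne mh nh with rfl | h
    · rw [factor, Pi.single_eq_same, tensorMap_single, toCyc_cycPoly _ _ hj, map_zero]
    · rw [factor, Pi.single_eq_of_ne h, map_zero]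
  · intro h b hb u
    have hact (nh : Comp r n) : summandAct F N.obj nh (b nh) = 0 :=
      eq_zero_of_tensorMap_eq_zero _
        (fun k j hj => LinearMap.ext fun u => Subtype.ext (h nh k j hj u.1)) (congrFun hb nh)
    refine (summandProj_bijective F (r := r) (n := n) N.obj).1 (funext fun nh => ?_)
    rw [LinearMap.pi_apply, summandProj_smul, hact, LinearMap.zero_apply, map_zero]
    rfl

end Quotients

section Polynomials

variable {F : Type u} [Field F] {p : ℕ} [Fact p.Prime] [CharP F p]

theorem cycPoly_eq_comp (lam : ZMod p → ℕ) {d : ZMod p} (hd : d ≠ 0) :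
    cycPoly F p lam = C (ZMod.castHom (dvd_refl p) F d ^ ∑ i, lam (i * d)) *
      (cycPoly F p fun i => lam (i * d)).comp (C (ZMod.castHom (dvd_refl p) F d)⁻¹ * X) := by
  have hd0 : ZMod.castHom (dvd_refl p) F d ≠ 0 := (_root_.map_ne_zero _).2 hd
  rw [cycPoly, cycPoly, Polynomial.prod_comp, ← Finset.prod_pow_eq_pow_sum, map_prod,
      ← Finset.prod_mul_distrib]
  refine (Fintype.prod_equiv (Equiv.mulRight₀ d hd) _ _ fun i => ?_).symm
  rw [Equiv.mulRight₀_apply, pow_comp, sub_comp, X_comp, C_comp, map_pow, ← mul_pow, mul_sub,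
    ← mul_assoc, ← C_mul, mul_inv_cancel₀ hd0, C_1, one_mul, ← C_mul]
  change _ = (X - C (ZMod.castHom (dvd_refl p) F (i * d))) ^ lam (i * d)
  rw [map_mul (ZMod.castHom (dvd_refl p) F), mul_comm (ZMod.castHom (dvd_refl p) F i)]

theorem aeval_cycPoly_smul_eq_zero_iff {B M : Type*} [Ring B] [Algebra F B] [AddCommGroup M]
    [Module F M] [Module B M] [IsScalarTower F B M] (lam : ZMod p → ℕ) {d : ZMod p} (hd : d ≠ 0)
    (b : B) (m : M) : aeval b (cycPoly F p lam) • m = 0 ↔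
      aeval ((ZMod.castHom (dvd_refl p) F d)⁻¹ • b) (cycPoly F p fun i => lam (i * d)) • m = 0 := by
  have hd0 : ZMod.castHom (dvd_refl p) F d ≠ 0 := (_root_.map_ne_zero _).2 hd
  rw [cycPoly_eq_comp lam hd, map_mul, aeval_C, aeval_comp, map_mul, aeval_C, aeval_X,
    ← Algebra.smul_def, ← Algebra.smul_def, smul_assoc]
  exact smul_eq_zero_iff_right (pow_ne_zero _ hd0)

end Polynomials

section FirstPlace

variable {r n : ℕ} {nh : Comp r n}

theorem Shuffle.exists_apply_eq_zero (k : Fin r) (j : Fin (nh.1 k)) (hj : j.1 = 0) :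
    ∃ α : Shuffle nh, (α.1 ⟨k, j⟩).1 = 0 := by
  suffices h : ∀ (b : ℕ) (α : Shuffle nh), (α.1 ⟨k, j⟩).1 = b →
      ∃ α : Shuffle nh, (α.1 ⟨k, j⟩).1 = 0 from h _ (placeShuffle nh) rfl
  intro b
  induction b with
  | zero => exact fun α h => ⟨α, h⟩
  | succ b ih =>
    intro α h
    let i : Fin (n - 1) := ⟨b, by have := (α.1 ⟨k, j⟩).2; omega⟩
    have hαj : α.1 ⟨k, j⟩ = hi i := Fin.ext h
    have hmixed : Mixed α.1 i := by
      by_contra hsame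
      obtain ⟨k', j', -, hhi⟩ := exists_of_not_mixed α i (not_not.2 hsame)
      obtain rfl : k = k' := congrArg Sigma.fst (α.1.injective (hαj.trans hhi.symm))
      obtain rfl : j = hi j' := by simpa using α.1.injective (hαj.trans hhi.symm)
      simp [hi] at hj
    refine ih (α.swap i hmixed) ?_
    rw [α.swap_apply, hαj, simpleSwap_hi]
    rfl

theorem Shuffle.eq_zero_of_apply_eq_zero (α : Shuffle nh) {k : Fin r} {j : Fin (nh.1 k)}
    (h : (α.1 ⟨k, j⟩).1 = 0) : j.1 = 0 := by
  by_contra hj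
  have hlt : α.1 ⟨k, ⟨0, by have := j.2; omega⟩⟩ < α.1 ⟨k, j⟩ :=
    α.2 k (Fin.lt_def.2 (Nat.pos_of_ne_zero hj))
  rw [Fin.lt_def, h] at hlt
  exact Nat.not_lt_zero _ hlt

end FirstPlace

section Cyclotomic

variable {F : Type u} [Field F] {G : Type u} [Group G] [Fintype G] {r n : ℕ}
  {V : Fin r → Type u} [∀ k, AddCommGroup (V k)] [∀ k, Module F (V k)]
  [∀ k, FiniteDimensional F (V k)]
  {ρ : ∀ k, Representation F G (V k)} {c : Fin r → F}

section Orthogonality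

variable (hρ : SchurOrthogonality ρ c) {M : Type u} [AddCommGroup M] [Module F M]
  [Module (Affine F G n) M] [IsScalarTower F (Affine F G n) M] {nh : Comp r n}

include hρ in
theorem aeval_x_smul_permElt (P : F[X]) {φ : VHat F V nh →ₗ[F] M}
    (hφ : LabelEquivariant ρ (place nh) φ) (α : Shuffle nh) (a : Σ k, Fin (nh.1 k))
    (v : VHat F V nh) :
    aeval (x F G (α.1 a)) P • permElt F G (labelPerm α.1) • φ v =
      permElt F G (labelPerm α.1) • aeval (x F G (place nh a)) P • φ v := by
  induction P using Polynomial.induction_on' with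
  | add P Q hP hQ => rw [map_add, map_add, add_smul, add_smul, smul_add, hP, hQ]
  | monomial m d =>
    rw [aeval_monomial, aeval_monomial, ← Algebra.smul_def, ← Algebra.smul_def, smul_assoc,
      smul_assoc, smul_comm (permElt F G (labelPerm α.1)) d]
    congr 1
    induction m generalizing φ with
    | zero => rw [pow_zero, pow_zero, one_smul, one_smul]
    | succ m ih =>
      rw [pow_succ, pow_succ, mul_smul, mul_smul, x_smul_permElt_place hρ hφ]
      exact ih (hφ.x_smul (place nh a))

theorem homAct_aeval_apply (P : F[X]) (k : Fin r) (j : Fin (nh.1 k)) (φ : HomHat ρ M nh)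
    (v : VHat F V nh) :
    (homAct hρ M nh (PiTensorProduct.singleAlgHom k (aeval (x F PUnit.{u + 1} j) P)) φ).1 v =
      aeval ((c k)⁻¹ • x F G (place nh ⟨k, j⟩)) P • φ.1 v := by
  rw [← aeval_algHom_apply, ← aeval_algHom_apply, homAct_y]
  induction P using Polynomial.induction_on' with
  | add P Q hP hQ =>
    rw [map_add, map_add, add_smul, ← hP, ← hQ]
    rfl
  | monomial m d =>
    rw [aeval_monomial, aeval_monomial, ← Algebra.smul_def, ← Algebra.smul_def, smul_assoc]
    change d • ((homY hρ M nh k j ^ m) φ).1 v = _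
    congr 1
    induction m with
    | zero => rw [pow_zero, pow_zero, one_smul, Module.End.one_apply]
    | succ m ih =>
      rw [pow_succ', pow_succ', mul_smul, ← ih, Module.End.mul_apply, homY_apply, smul_assoc]

theorem factor_smul_homSpace_eq_zero_iff (a : AHat F nh) :
    (∀ u : HomSpace n ρ M hρ, factor F nh a • u = 0) ↔ homAct hρ M nh a = 0 := by
  constructor
  · intro h
    refine LinearMap.ext fun φ => ?_
    have hφ := congrFun (h (homSingle hρ M nh φ)) nh
    rw [homSpace_smul_apply, factor, Pi.single_eq_same, homSingle_apply_same] at hφ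
    exact hφ
  · intro h u
    refine funext fun mh => ?_
    rw [homSpace_smul_apply]
    rcases eq_or_ne mh nh with rfl | hne
    · rw [factor, Pi.single_eq_same, h]
      rfl
    · rw [factor, Pi.single_eq_of_ne hne, map_zero]
      rfl

theorem homAct_cycPoly_eq_zero_iff {p : ℕ} [Fact p.Prime] [CharP F p]
    (hc : ∀ k, c k = ZMod.castHom (dvd_refl p) F (cScalar F p G V k)) (lam : ZMod p → ℕ)
    (k : Fin r) (j : Fin (nh.1 k)) :
    homAct hρ M nh (PiTensorProduct.singleAlgHom k
        (aeval (x F PUnit.{u + 1} j) (cycPoly F p (scaledWeight F G V lam k)))) = 0 ↔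
      ∀ (φ : HomHat ρ M nh) (v : VHat F V nh),
        aeval (x F G (place nh ⟨k, j⟩)) (cycPoly F p lam) • φ.1 v = 0 := by
  have hc0 : cScalar F p G V k ≠ 0 := fun h => hρ.ne_zero k (by rw [hc, h, map_zero])
  simp only [aeval_cycPoly_smul_eq_zero_iff lam hc0, ← hc, LinearMap.ext_iff, Subtype.ext_iff]
  exact forall₂_congr fun φ v => by
    rw [← homAct_aeval_apply hρ]
    rfl

end Orthogonality

variable (hρ : SchurRelations ρ c)

include hρ in
theorem aeval_x_smul_eq_zero_iff {M : Type u} [AddCommGroup M] [Module F M]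
    [Module (Affine F G n) M] [IsScalarTower F (Affine F G n) M] (P : F[X]) :
    (∀ i : Fin n, i.1 = 0 → ∀ m : M, aeval (x F G i) P • m = 0) ↔
      ∀ (nh : Comp r n) (k : Fin r) (j : Fin (nh.1 k)), j.1 = 0 →
        ∀ (φ : HomHat ρ M nh) (v : VHat F V nh),
          aeval (x F G (place nh ⟨k, j⟩)) P • φ.1 v = 0 := by
  have hconj {nh : Comp r n} (α : Shuffle nh) (a) (φ : HomHat ρ M nh) (v : VHat F V nh) :=
    aeval_x_smul_permElt hρ.toSchurOrthogonality P
      ((mem_homHat_iff hρ.toSchurOrthogonality _).1 φ.2) α a v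
  constructor
  · intro h nh k j hj φ v
    obtain ⟨α, hα⟩ := Shuffle.exists_apply_eq_zero k j hj
    refine permElt_smul_injective (F := F) (G := G) (labelPerm α.1) ?_
    simp only [← hconj, h _ hα, smul_zero]
  · intro h i hi m
    have hzero : Algebra.lsmul F F M (aeval (x F G i) P) = 0 :=
      linearMap_ext_permElt_smul (n := n) hρ fun nh α φ v => by
        obtain ⟨⟨k, j⟩, rfl⟩ := α.1.surjective i
        change aeval (x F G (α.1 ⟨k, j⟩)) P • permElt F G (labelPerm α.1) • φ.1 v = 0
        rw [hconj, h nh k j (α.eq_zero_of_apply_eq_zero hi), smul_zero]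
    exact LinearMap.congr_fun hzero m

theorem inflation_essImage_iff_homFunctor {p : ℕ} [Fact p.Prime] [CharP F p]
    (hc : ∀ k, c k = ZMod.castHom (dvd_refl p) F (cScalar F p G V k)) (lam : ZMod p → ℕ)
    (M : FDMod F (Affine F G n)) :
    (inflation F (toCyc F p G n lam)).essImage M ↔
      (inflation F (toACyc F r n p (scaledWeight F G V lam))).essImage
        ((homFunctor hρ.toSchurOrthogonality).obj M) := by
  rw [inflation_cyc_essImage_iff, inflation_aCyc_essImage_iff, aeval_x_smul_eq_zero_iff hρ]
  refine forall₄_congr fun nh k j _ => ?_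
  exact (homAct_cycPoly_eq_zero_iff hρ.toSchurOrthogonality hc lam k j).symm.trans
    (factor_smul_homSpace_eq_zero_iff hρ.toSchurOrthogonality _).symm

end Cyclotomic

end WreathHecke

end

theorem mainTheorem5_general (p : ℕ) [Fact p.Prime] (F : Type u) [Field F] [CharP F p]
    (G : Type u) [Group G] [Fintype G] (hpG : ¬ p ∣ Fintype.card G)
    (r : ℕ) (V : Fin r → Type u) [∀ k, AddCommGroup (V k)] [∀ k, Module F (V k)]
    [∀ k, FiniteDimensional F (V k)] (ρ : ∀ k, Representation F G (V k))
    (hsimple : ∀ k, (ρ k).IsIrreducible)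
    (hend : ∀ k, Function.Surjective (algebraMap F ((ρ k).IntertwiningMap (ρ k))))
    (hdistinct : ∀ k l, k ≠ l → IsEmpty (Representation.Equiv (ρ k) (ρ l)))
    (hcomplete : ∀ (W : Type u) [AddCommGroup W] [Module F W] [FiniteDimensional F W]
      (σ : Representation F G W), σ.IsIrreducible →
        ∃ k, Nonempty (Representation.Equiv σ (ρ k)))
    (n : ℕ) (lam : ZMod p → ℕ) :
    ∃ T : WreathHecke.FDMod F (WreathHecke.Affine F G n) ≌
        WreathHecke.FDMod F (WreathHecke.A F r n),
      Nonempty (WreathHecke.IsHomFunctor ρ p T.functor) ∧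
      ∃ Tlam : WreathHecke.FDMod F (WreathHecke.Cyc F p G n lam) ≌
          WreathHecke.FDMod F
            (WreathHecke.ACyc F r n p (WreathHecke.scaledWeight F G V lam)),
        Nonempty
          (Tlam.functor ⋙
              WreathHecke.inflation F
                (WreathHecke.toACyc F r n p (WreathHecke.scaledWeight F G V lam)) ≅
            WreathHecke.inflation F (WreathHecke.toCyc F p G n lam) ⋙ T.functor) := by
  have hcard : (Fintype.card G : F) ≠ 0 := fun h => hpG ((CharP.cast_eq_zero_iff F p _).1 h)
  have hρ := WreathHecke.schurRelations hcard hsimple hend hdistinct hcomplete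
  have hc (k) : (Fintype.card G : F) / (Module.finrank F (V k) : F) =
      ZMod.castHom (dvd_refl p) F (WreathHecke.cScalar F p G V k) := by
    rw [WreathHecke.cScalar, map_div₀, map_natCast, map_natCast]
  have := WreathHecke.homFunctor_isEquivalence (n := n) hρ
  have := WreathHecke.inflation_full (WreathHecke.toCyc_surjective F p G n lam)
  have := WreathHecke.inflation_full
    (WreathHecke.toACyc_surjective F p r n (WreathHecke.scaledWeight F G V lam))
  exact ⟨(WreathHecke.homFunctor hρ.toSchurOrthogonality).asEquivalence,
    ⟨WreathHecke.homFunctorIsHomFunctor hρ.toSchurOrthogonality p hc⟩,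
    WreathHecke.exists_equivalence_of_essImage
      (WreathHecke.homFunctor hρ.toSchurOrthogonality) _ _
      (WreathHecke.inflation_essImage_iff_homFunctor hρ hc lam)⟩

theorem mainTheorem5 (p : ℕ) [Fact p.Prime] (F : Type u) [Field F] [IsAlgClosed F] [CharP F p]
    (G : Type u) [Group G] [Fintype G] (hpG : ¬ p ∣ Fintype.card G)
    (r : ℕ) (V : Fin r → Type u) [∀ k, AddCommGroup (V k)] [∀ k, Module F (V k)]
    [∀ k, FiniteDimensional F (V k)] (ρ : ∀ k, Representation F G (V k))
    (hsimple : ∀ k, (ρ k).IsIrreducible)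
    (hdistinct : ∀ k l, k ≠ l → IsEmpty (Representation.Equiv (ρ k) (ρ l)))
    (hcomplete : ∀ (W : Type u) [AddCommGroup W] [Module F W] [FiniteDimensional F W]
      (σ : Representation F G W), σ.IsIrreducible →
        ∃ k, Nonempty (Representation.Equiv σ (ρ k)))
    (n : ℕ) (lam : ZMod p → ℕ) :
    ∃ T : WreathHecke.FDMod F (WreathHecke.Affine F G n) ≌
        WreathHecke.FDMod F (WreathHecke.A F r n),
      Nonempty (WreathHecke.IsHomFunctor ρ p T.functor) ∧
      ∃ Tlam : WreathHecke.FDMod F (WreathHecke.Cyc F p G n lam) ≌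
          WreathHecke.FDMod F
            (WreathHecke.ACyc F r n p (WreathHecke.scaledWeight F G V lam)),
        Nonempty
          (Tlam.functor ⋙
              WreathHecke.inflation F
                (WreathHecke.toACyc F r n p (WreathHecke.scaledWeight F G V lam)) ≅
            WreathHecke.inflation F (WreathHecke.toCyc F p G n lam) ⋙ T.functor) :=
  mainTheorem5_general p F G hpG r V ρ hsimple (fun k =>
    have := hsimple k
    Representation.IsIrreducible.algebraMap_intertwiningMap_bijective_of_isAlgClosed.2)
    hdistinct hcomplete n lam
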